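/- **Theorem 4.1.** The context-free subset membership problem for black box groups is in $\mathbf{PSPACE}$. *Black boxes.* A black box for a finite group $G$ consists of $b,c\in\mathbb N$, a map $f:\{0,1\}^b\to G\uplus\{*\}$ whose image contains $G$ (the elements of $f^{-1}(g)$ are the names of $g\in G$), and maps $\mathsf{valid}:\{0,1\}^b\to\{\text{yes},\text{no}\}$, $\mathsf{inv}:\{0,1\}^b\to\{0,1\}^b$, $\mathsf{prod}:\{0,1\}^b\times\{0,1\}^b\to\{0,1\}^b$, $\mathsf{id}:\{0,1\}^b\times\{0,1\}^c\to\{\text{yes},\text{no}\}$ such that $\mathsf{valid}(x)=\text{yes}\iff f(x)\in G$ for all $x$, and, for all $x,y\in f^{-1}(G)$: $f(\mathsf{inv}(x))=f(x)^{-1}$, $f(\mathsf{prod}(x,y))=f(x)f(y)$, and $f(x)=1\iff\exists z\in\{0,1\}^c:\mathsf{id}(x,z)=\text{yes}$. *Black box Turing machines.* A deterministic black box Turing machine is a deterministic Turing machine with a read-only input tape, finitely many work tapes, an oracle tape for bit strings, and one query state for each of $\mathsf{valid},\mathsf{inv},\mathsf{prod},\mathsf{id}$. When it is coupled with a black box $B$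 and enters a query state, the content of the oracle tape is replaced at once by the value of the corresponding map of $B$ on the bit strings formed by the first $b$ (respectively $b$, $2b$, $b+c$) bits on the oracle tape. *The problem.* An instance over a finite group $G$ is a context-free grammar $\mathcal G$ in Chomsky normal form (all productions are of the form $A\to BC$ or $A\to g$ with nonterminals $A,B,C$ and $g\in G$) with terminals from $G$, and a word $w\in G^*$. The question is whether $\phi(w)\in\phi(L(\mathcal G))$, where $\phi:G^*\to G$ maps a word to the product of its letters. (For the empty word $w$ the question is whether $1\in\phi(L(\mathcal G))$.) The input word given to a machine for a black box $B$ for $G$ consists of $b$ and $c$ in unary, $w$ and $\mathcal G$, where nonterminals are written as bit strings and every occurrence of a group element is written as one of its names. *Claim.* There are a deterministic black box Turing machine $T$ and a polynomial $p$ such that for every finite group $G$, every black box $B$ for $G$, every instance $(\mathcal G,w)$ over $G$ and every input word $u$ that represents this instance in this way: $T$ coupled with $B$ halts on $u$; it accepts if $\phi(w)\in\phi(L(\mathcal G))$ and rejects otherwise; and during the computation no head leaves the cells at distance at most $p(|u|)$ from its initial position (so the space used is polynomial in $|u|$). -/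

import Mathlib

/-! ### Black boxes -/

/-- A black box for the group `G`. Bit strings of length `b` are (potential) names of elements
of `G`; `f x = none` says that `x` is not a name of an element (the value `*`), and an element may
have several names. Since `f` hits every element of `G`, the group `G` is finite. -/
structure BlackBox (G : Type*) [Group G] where
  /-- The code length. -/
  b : ℕ
  /-- The length of witnesses for equality with the identity element. -/
  c : ℕ
  f : (Fin b → Bool) → Option G
  exists_name : ∀ g : G, ∃ x, f x = some g
  valid : (Fin b → Bool) → Bool
  valid_iff : ∀ x, valid x = true ↔ ∃ g, f x = some g
  inv : (Fin b → Bool) → (Fin b → Bool)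
  inv_spec : ∀ x g, f x = some g → f (inv x) = some g⁻¹
  prod : (Fin b → Bool) → (Fin b → Bool) → (Fin b → Bool)
  prod_spec : ∀ x y g h, f x = some g → f y = some h → f (prod x y) = some (g * h)
  isId : (Fin b → Bool) → (Fin c → Bool) → Bool
  isId_spec : ∀ x g, f x = some g → (g = 1 ↔ ∃ y, isId x y = true)

/-- The four oracles of a black box Turing machine. -/
inductive OracleKind where
  | valid
  | inv
  | prod
  | isId

/-- The `n` bits on the cells `start, …, start + n - 1` of a tape. (A cell that does not hold a
bit counts as `0`; this only matters for queries to a tape with too few bits.) -/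
def bitsAt (cells : ℤ → Option Bool) (start n : ℕ) : Fin n → Bool :=
  fun i => (cells ((start : ℤ) + (i : ℤ))).getD false

/-- The bit string with which a query overwrites the oracle tape; the answers "yes" and "no" are
the one-bit strings `1` and `0`. -/
def BlackBox.answer {G : Type*} [Group G] (B : BlackBox G) (cells : ℤ → Option Bool) :
    OracleKind → List Bool
  | .valid => [B.valid (bitsAt cells 0 B.b)]
  | .inv => List.ofFn (B.inv (bitsAt cells 0 B.b))
  | .prod => List.ofFn (B.prod (bitsAt cells 0 B.b) (bitsAt cells B.b B.b))
  | .isId => [B.isId (bitsAt cells 0 B.b) (bitsAt cells B.b B.c)]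

/-! ### Black box Turing machines -/

/-- A two-way infinite tape over the alphabet `α` together with a head position;
`none` is the blank symbol. -/
structure OTape (α : Type*) where
  cells : ℤ → Option α
  head : ℤ

namespace OTape

/-- The tape with the word `l` on the cells `0, 1, 2, …`, blanks elsewhere, and head on cell `0`. -/
def ofList {α : Type*} (l : List α) : OTape α where
  cells i := if 0 ≤ i then l[i.toNat]? else none
  head := 0

/-- The scanned symbol. -/
def read {α : Type*} (t : OTape α) : Option α := t.cells t.head

/-- Write the symbol `s` on the scanned cell. -/
def write {α : Type*} (t : OTape α) (s : Option α) : OTape α where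
  cells := Function.update t.cells t.head s
  head := t.head

/-- Move the head by `-1`, `0` or `1`. -/
def move {α : Type*} (t : OTape α) (d : SignType) : OTape α where
  cells := t.cells
  head := t.head + (d : ℤ)

end OTape

/-- What a deterministic machine does in one step: the new state, the move of the head on the
read-only input tape, and the written symbols and head moves on the oracle tape and on the work
tapes (indexed by `K`, with alphabet `Γ`). -/
structure TMAction (Q K Γ : Type) where
  next : Q
  inputMove : SignType
  oracleWrite : Option Bool
  oracleMove : SignType
  workWrite : K → Option Γ
  workMove : K → SignType

/-- A deterministic black box Turing machine with input alphabet `σ`: it has a read-only input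
tape, an oracle tape for bit strings, finitely many work tapes, finitely many states and a finite
work alphabet. Exactly one state is the query state of each of the four oracles. -/
structure BlackBoxTM (σ : Type) where
  Q : Type
  K : Type
  Γ : Type
  [finQ : Finite Q]
  [finK : Finite K]
  [finΓ : Finite Γ]
  start : Q
  accept : Q
  reject : Q
  accept_ne_reject : accept ≠ reject
  query : Q → Option OracleKind
  query_unique : ∀ o, ∃! q, query q = some o
  /-- The transition function: the state and the scanned symbols of the input tape, the oracle
  tape and the work tapes determine the next action. -/
  δ : Q → Option σ → Option Bool → (K → Option Γ) → TMAction Q K Γ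

namespace BlackBoxTM

variable {σ : Type}

structure Config (M : BlackBoxTM σ) where
  state : M.Q
  input : OTape σ
  oracle : OTape Bool
  work : M.K → OTape M.Γ

/-- The initial configuration on the input word `w`. -/
def init (M : BlackBoxTM σ) (w : List σ) : M.Config where
  state := M.start
  input := OTape.ofList w
  oracle := OTape.ofList []
  work _ := OTape.ofList []

/-- The effect of the transition function on a configuration, before oracle queries. -/
def applyδ (M : BlackBoxTM σ) (C : M.Config) : M.Config :=
  let a := M.δ C.state C.input.read C.oracle.read (fun k => (C.work k).read)
  { state := a.next
    input := C.input.move a.inputMove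
    oracle := (C.oracle.write a.oracleWrite).move a.oracleMove
    work := fun k => ((C.work k).write (a.workWrite k)).move (a.workMove k) }

/-- If the current state is a query state, the oracle tape is overwritten by the answer of the
black box `B` (and its head is placed on the first cell). -/
def applyQuery {G : Type*} [Group G] (M : BlackBoxTM σ) (B : BlackBox G) (C : M.Config) :
    M.Config :=
  match M.query C.state with
  | none => C
  | some o => { C with oracle := OTape.ofList (B.answer C.oracle.cells o) }

open Classical in
/-- One step of the machine coupled with the black box `B`. The machine halts in the accepting and
in the rejecting state; whenever it enters a query state, the query is answered at once. -/
noncomputable def step {G : Type*} [Group G] (M : BlackBoxTM σ) (B : BlackBox G) (C : M.Config) :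
    Option M.Config :=
  if C.state = M.accept ∨ C.state = M.reject then none
  else some (M.applyQuery B (M.applyδ C))

/-- `M` coupled with `B` reaches the configuration `C` on the input word `w`. -/
def ReachesOn {G : Type*} [Group G] (M : BlackBoxTM σ) (B : BlackBox G) (w : List σ)
    (C : M.Config) : Prop :=
  StateTransition.Reaches (M.step B) (M.init w) C

def Accepts {G : Type*} [Group G] (M : BlackBoxTM σ) (B : BlackBox G) (w : List σ) : Prop :=
  ∃ C, M.ReachesOn B w C ∧ C.state = M.accept

def Rejects {G : Type*} [Group G] (M : BlackBoxTM σ) (B : BlackBox G) (w : List σ) : Prop :=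
  ∃ C, M.ReachesOn B w C ∧ C.state = M.reject

/-- On the input `w`, no head (the heads of the input tape and of the oracle tape included) ever
leaves the cells `-s, …, s`. So the space used is at most `2 * s + 1` cells on each of the tapes,
whose number depends only on the machine. -/
def RunsInSpace {G : Type*} [Group G] (M : BlackBoxTM σ) (B : BlackBox G) (w : List σ)
    (s : ℕ) : Prop :=
  ∀ C, M.ReachesOn B w C →
    |C.input.head| ≤ s ∧ |C.oracle.head| ≤ s ∧ ∀ k, |(C.work k).head| ≤ s

end BlackBoxTM

/-! ### The context-free subset membership problem -/

/-- A production of a context-free grammar in Chomsky normal form with terminals from `T`: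
`A → B C` or `A → a`. Nonterminals are bit strings. -/
inductive CNFRule (T : Type*) where
  | pair (A B C : List Bool)
  | single (A : List Bool) (a : T)

/-- The production as a context-free rule. -/
def CNFRule.toRule {T : Type*} : CNFRule T → ContextFreeRule T (List Bool)
  | .pair A B C => ⟨A, [.nonterminal B, .nonterminal C]⟩
  | .single A a => ⟨A, [.terminal a]⟩

def CNFRule.map {T T' : Type*} (φ : T → T') : CNFRule T → CNFRule T'
  | .pair A B C => .pair A B C
  | .single A a => .single A (φ a)

/-- The data of an instance of the context-free subset membership problem: a context-free grammar
in Chomsky normal form, with start nonterminal `start` and the productions `rules`, and a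
word `target`, both over `T`. -/
structure CFInstance (T : Type*) where
  target : List T
  start : List Bool
  rules : List (CNFRule T)

namespace CFInstance

def map {T T' : Type*} (φ : T → T') (I : CFInstance T) : CFInstance T' where
  target := I.target.map φ
  start := I.start
  rules := I.rules.map (CNFRule.map φ)

open Classical in
/-- The context-free grammar of an instance. -/
noncomputable def grammar {T : Type*} (I : CFInstance T) : ContextFreeGrammar T where
  NT := List Bool
  initial := I.start
  rules := (I.rules.map CNFRule.toRule).toFinset

/-- The positive instances: the group element to which the word `target` evaluates is
the value of a word that is generated by the grammar. For the empty word `target`, this says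
that the identity element is the value of a generated word. -/
def IsPositive {G : Type*} [Group G] (I : CFInstance G) : Prop :=
  ∃ w ∈ I.grammar.language, w.prod = I.target.prod

end CFInstance

/-- `x` represents the instance `I` over the group `G`: every occurrence of a group element is
replaced by one of its names. -/
def BlackBox.Represents {G : Type*} [Group G] (B : BlackBox G)
    (x : CFInstance (Fin B.b → Bool)) (I : CFInstance G) : Prop :=
  x.map B.f = I.map some

/-! ### Input words -/

/-- The input alphabet: two bits, a separator, and markers that start
a nonterminal, a group element, and a production. -/
inductive InputSym where
  | bit (v : Bool)
  | hash
  | nonterminal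
  | element
  | rule

def encodeNonterminal (A : List Bool) : List InputSym :=
  .nonterminal :: A.map .bit

def encodeName {b : ℕ} (x : Fin b → Bool) : List InputSym :=
  .element :: (List.ofFn x).map .bit

def encodeRule {b : ℕ} : CNFRule (Fin b → Bool) → List InputSym
  | .pair A B C => .rule :: (encodeNonterminal A ++ encodeNonterminal B ++ encodeNonterminal C)
  | .single A x => .rule :: (encodeNonterminal A ++ encodeName x)

/-- The input word for an instance `x` that is written with names of length `b`: the numbers `b`
and `c` in unary, followed by the target word, the start nonterminal and the productions. -/
def encodeInput {b : ℕ} (c : ℕ) (x : CFInstance (Fin b → Bool)) : List InputSym :=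
  List.replicate b (.bit true) ++ [.hash] ++ List.replicate c (.bit true) ++ [.hash] ++
    x.target.flatMap encodeName ++ [.hash] ++
    encodeNonterminal x.start ++ x.rules.flatMap encodeRule

/-!
Values of pieces of derivations are recorded as facts. The fact `(A, B, (u, v))` says that the
nonterminal `A` derives some `x B y` with words `x`, `y` of values `u`, `v⁻¹`, and the fact
`(A, none, (u, v))` says that `A` generates a word of value `u * v⁻¹`. Since the value on the right
is inverted, composing derivations means multiplying in `G × G`, and facts are deduced by the four
rules of `ContextFreeSubset.Proof`.

Derivation trees can be exponentially high, and the point is that proofs need only be polynomially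
high (`Yields.proof`). The facts from `A` to `A` with proofs of height at most `d` generate a
subgroup of `G × G`. As `d` grows these subgroups, for all nonterminals together, form an increasing
chain in a power of `G × G`, which becomes strictly larger only polynomially often
(`exists_subgroup_eq_succ`); so at some polynomial height `d` it stays the same for a long while.
From then on, the path from the root `A` of a tree to a lowest occurrence of `A` is worth a product
of old loops. In a finite group, such a product equals one with at most `|G × G| ≤ 2 ^ (2 * b)`
factors, for which repeated doubling gives a proof of small height. Below the lowest occurrence, `A`
is not used anymore, so that the number of nonterminals decreases (`Tree.proof_of_loops_eq`). That
the path is such a loop is shown by cutting it at its visits to one nonterminal after the other, as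
in Kleene's theorem on regular expressions (`Walk.proof`).

A proof of polynomial height is a winning strategy in a game with polynomially many rounds. In each
round the existential player says how the current fact is deduced and names a nonterminal, two group
elements, a production in the input, and a witness for an identity query; the universal player
chooses one of two premises by a single bit. Group elements are compared only through identity
queries with played witnesses, and the validity of played names is queried, so that the whole game
consists of bits whose evaluation is polynomial. `exists_win_iff` says that the game with the rules
of the input can be won exactly if the instance is positive.

The value of the game is found by depth-first search: the play is a stack of bits, the outcome of a
complete play is recomputed from the input, and a returned value goes up until it reaches a bit that
can still be changed (`exists_exec_search`). The search is written in a structured language for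
finitely many stacks, in which the height of the stacks is bounded in the rules of execution
(`StackProgram.Exec`). A program of this language is compiled to a black box Turing machine with
one work tape for each stack (`Compile.machine_spec`). With an input of length `n`, there are
`n ^ 7` rounds with at most `n ^ 2` bits each, so the heads move at most `n ^ 9` cells away.
-/

/-! ### Stack programs -/

namespace StackProgram

/-- The fields of one round of the verification game, as they appear on the play: a nonterminal
`mid`, the names `left` and `right` of two group elements, a witness `wit` for an identity query,
a position `ptr` in the input, two bits `opt` that select the kind of the round, and the only
universally quantified bit `side`. -/
inductive Label where
  | mid | left | right | wit | ptr | opt | side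
  deriving DecidableEq

/-- The stack alphabet. An unassigned position of the play is a `kind`, an assigned one a `cell`.
The remaining symbols are flags: `mark` is a unit for counters and stands for the absent
nonterminal, `ok` and `fail` are verdicts, `down` and `up v` say whether the search is extending
the play or returning the value `v`. -/
inductive Sym where
  | inp (s : InputSym)
  | bit (v : Bool)
  | kind (l : Label)
  | cell (l : Label) (v : Bool)
  | mark
  | ok
  | fail
  | down
  | up (v : Bool)

/-- The names of the stacks. -/
inductive Reg where
  | rest | seen | ruler | ruler' | future | play | replay
  | fMid | fLeft | fRight | fWit | fOpt | fSide
  | curA | curB | curU | curV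
  | ntP | ntQ | ntR | tmp | status | mode
  deriving DecidableEq

/-- A state of the store: the part of the input that has not been read, the oracle stack and the
other stacks. The top of a stack is the head of the list. -/
structure Store where
  inp : List InputSym
  orc : List Bool
  rest : List Sym
  seen : List Sym
  ruler : List Sym
  ruler' : List Sym
  future : List Sym
  play : List Sym
  replay : List Sym
  fMid : List Sym
  fLeft : List Sym
  fRight : List Sym
  fWit : List Sym
  fOpt : List Sym
  fSide : List Sym
  curA : List Sym
  curB : List Sym
  curU : List Sym
  curV : List Sym
  ntP : List Sym
  ntQ : List Sym
  ntR : List Sym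
  tmp : List Sym
  status : List Sym
  mode : List Sym

namespace Store

def get (R : Store) : Reg → List Sym
  | .rest => R.rest | .seen => R.seen | .ruler => R.ruler | .ruler' => R.ruler'
  | .future => R.future | .play => R.play | .replay => R.replay
  | .fMid => R.fMid | .fLeft => R.fLeft | .fRight => R.fRight | .fWit => R.fWit
  | .fOpt => R.fOpt | .fSide => R.fSide | .curA => R.curA | .curB => R.curB | .curU => R.curU |
    .curV => R.curV
  | .ntP => R.ntP | .ntQ => R.ntQ | .ntR => R.ntR | .tmp => R.tmp
  | .status => R.status | .mode => R.mode

def set (R : Store) (k : Reg) (l : List Sym) : Store :=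
  match k with
  | .rest => { R with rest := l } | .seen => { R with seen := l }
  | .ruler => { R with ruler := l } | .ruler' => { R with ruler' := l }
  | .future => { R with future := l } | .play => { R with play := l }
  | .replay => { R with replay := l } | .fMid => { R with fMid := l }
  | .fLeft => { R with fLeft := l } | .fRight => { R with fRight := l }
  | .fWit => { R with fWit := l } | .fOpt => { R with fOpt := l }
  | .fSide => { R with fSide := l }
  | .curA => { R with curA := l } | .curB => { R with curB := l }
  | .curU => { R with curU := l } | .curV => { R with curV := l }
  | .ntP => { R with ntP := l } | .ntQ => { R with ntQ := l } | .ntR => { R with ntR := l }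
  | .tmp => { R with tmp := l } | .status => { R with status := l }
  | .mode => { R with mode := l }

def setOrc (R : Store) (l : List Bool) : Store := { R with orc := l }

def setInp (R : Store) (l : List InputSym) : Store := { R with inp := l }

@[simp] lemma get_set_self (R : Store) (k : Reg) (l : List Sym) : (R.set k l).get k = l := by
  cases k <;> rfl

lemma get_set_of_ne (R : Store) {k k' : Reg} (h : k' ≠ k) (l : List Sym) :
    (R.set k l).get k' = R.get k' := by
  cases k <;> cases k' <;> first | rfl | exact absurd rfl h

@[simp] lemma set_get (R : Store) (k : Reg) : R.set k (R.get k) = R := by cases k <;> rfl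

@[simp] lemma set_set (R : Store) (k : Reg) (l l' : List Sym) :
    (R.set k l).set k l' = R.set k l' := by
  cases k <;> rfl

lemma set_comm (R : Store) {k k' : Reg} (h : k' ≠ k) (l l' : List Sym) :
    (R.set k l).set k' l' = (R.set k' l').set k l := by
  cases k <;> cases k' <;> first | rfl | exact absurd rfl h

@[simp] lemma orc_set (R : Store) (k : Reg) (l : List Sym) : (R.set k l).orc = R.orc := by
  cases k <;> rfl

@[simp] lemma inp_set (R : Store) (k : Reg) (l : List Sym) : (R.set k l).inp = R.inp := by
  cases k <;> rfl

@[simp] lemma get_setOrc (R : Store) (k : Reg) (l : List Bool) :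
    (R.setOrc l).get k = R.get k := by cases k <;> rfl

@[simp] lemma get_setInp (R : Store) (k : Reg) (l : List InputSym) :
    (R.setInp l).get k = R.get k := by cases k <;> rfl

@[simp] lemma setOrc_set (R : Store) (k : Reg) (l : List Sym) (m : List Bool) :
    (R.set k l).setOrc m = (R.setOrc m).set k l := by cases k <;> rfl

lemma get_set (R : Store) (k k' : Reg) (l : List Sym) :
    (R.set k l).get k' = if k' = k then l else R.get k' := by
  split_ifs with h
  · rw [h, get_set_self]
  · exact get_set_of_ne R h l

lemma ext_get {R R' : Store} (h : ∀ k, R.get k = R'.get k) (h1 : R.orc = R'.orc)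
    (h2 : R.inp = R'.inp) : R = R' := by
  obtain ⟨⟩ := R
  obtain ⟨⟩ := R'
  simp only [Store.mk.injEq]
  exact ⟨h2, h1, h .rest, h .seen, h .ruler, h .ruler', h .future, h .play, h .replay, h .fMid,
    h .fLeft, h .fRight, h .fWit, h .fOpt, h .fSide, h .curA, h .curB, h .curU, h .curV, h .ntP,
    h .ntQ, h .ntR, h .tmp, h .status, h .mode⟩

@[simp] lemma inp_setOrc (R : Store) (l : List Bool) : (R.setOrc l).inp = R.inp := rfl

@[simp] lemma orc_setOrc (R : Store) (l : List Bool) : (R.setOrc l).orc = l := rfl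

@[simp] lemma setOrc_setOrc (R : Store) (l l' : List Bool) :
    (R.setOrc l).setOrc l' = R.setOrc l' := rfl

end Store

/-- What a program can see of the store in one step: the tops of the stacks. -/
structure Top where
  stk : Reg → Option Sym
  orc : Option Bool
  inp : Option InputSym

def Store.top (R : Store) : Top where
  stk k := (R.get k).head?
  orc := R.orc.head?
  inp := R.inp.head?

/-- Structured programs that manipulate a `Store`. -/
inductive Prog where
  | skip
  | push (k : Reg) (f : Top → Sym)
  | pop (k : Reg)
  | opush (f : Top → Bool)
  | opop
  | next
  | query (o : OracleKind)
  | seq (p q : Prog)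
  | ite (c : Top → Bool) (p q : Prog)
  | while (c : Top → Bool) (p : Prog)

/-- The effect of a query on the oracle stack, whose bottom is cell `0` of the oracle tape. -/
def ask {G : Type*} [Group G] (B : BlackBox G) (o : OracleKind) (l : List Bool) : List Bool :=
  (B.answer (OTape.ofList l.reverse).cells o).reverse

/-- `Exec B s p R R'`: with the oracles of `B`, the program `p` turns the store `R` into `R'`, and
no stack that it writes to gets higher than `s`. -/
inductive Exec {G : Type*} [Group G] (B : BlackBox G) (s : ℕ) : Prog → Store → Store → Prop
  | skip {R} : Exec B s .skip R R
  | push {R k f} : (R.get k).length < s → Exec B s (.push k f) R (R.set k (f R.top :: R.get k))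
  | pop {R k} : Exec B s (.pop k) R (R.set k (R.get k).tail)
  | opush {R f} : R.orc.length < s → Exec B s (.opush f) R (R.setOrc (f R.top :: R.orc))
  | opop {R} : Exec B s .opop R (R.setOrc R.orc.tail)
  | next {R} : R.inp ≠ [] → Exec B s .next R (R.setInp R.inp.tail)
  | query {R o} : (ask B o R.orc).length ≤ s → Exec B s (.query o) R (R.setOrc (ask B o R.orc))
  | seq {p q R R' R''} : Exec B s p R R' → Exec B s q R' R'' → Exec B s (.seq p q) R R''
  | ite_true {c p q R R'} : c R.top = true → Exec B s p R R' → Exec B s (.ite c p q) R R'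
  | ite_false {c p q R R'} : c R.top = false → Exec B s q R R' → Exec B s (.ite c p q) R R'
  | while_false {c p R} : c R.top = false → Exec B s (.while c p) R R
  | while_true {c p R R' R''} : c R.top = true → Exec B s p R R' → Exec B s (.while c p) R' R'' →
      Exec B s (.while c p) R R''

/-- The commands to which programs are compiled. -/
inductive Cmd where
  | nop
  | push (k : Reg) (a : Sym)
  | pop (k : Reg)
  | opush (v : Bool)
  | opop
  | next
  | query (o : OracleKind)

namespace Cmd

variable {G : Type*} [Group G]

def apply (B : BlackBox G) (R : Store) : Cmd → Store
  | nop => R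
  | push k a => R.set k (a :: R.get k)
  | pop k => R.set k (R.get k).tail
  | opush v => R.setOrc (v :: R.orc)
  | opop => R.setOrc R.orc.tail
  | next => R.setInp R.inp.tail
  | query o => R.setOrc (ask B o R.orc)

/-- The command does not lead to a stack that is higher than `s`. -/
def Fits (B : BlackBox G) (s : ℕ) (R : Store) : Cmd → Prop
  | nop => True
  | push k _ => (R.get k).length < s
  | pop _ => True
  | opush _ => R.orc.length < s
  | opop => True
  | next => R.inp ≠ []
  | query o => (ask B o R.orc).length ≤ s

end Cmd

namespace Prog

/-- The control states of a program. -/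
def State : Prog → Type
  | seq p q => State p ⊕ State q
  | ite _ p q => Option (State p ⊕ State q)
  | .while _ p => Option (State p)
  | _ => Unit

instance finite_state : ∀ p : Prog, Finite p.State
  | skip | push _ _ | pop _ | opush _ | opop | next | query _ => inferInstanceAs (Finite Unit)
  | seq p q =>
    have := finite_state p
    have := finite_state q
    inferInstanceAs (Finite (State p ⊕ State q))
  | ite _ p q =>
    have := finite_state p
    have := finite_state q
    inferInstanceAs (Finite (Option (State p ⊕ State q)))
  | .while _ p =>
    have := finite_state p
    inferInstanceAs (Finite (Option (State p)))

def entry : (p : Prog) → p.State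
  | seq p _ => .inl (entry p)
  | ite _ _ _ => none
  | .while _ _ => none
  | skip | push _ _ | pop _ | opush _ | opop | next | query _ => ()

/-- One step of the control of a program; the next state `none` means that the program is left. -/
def trans : (p : Prog) → p.State → Top → Option p.State × Cmd
  | skip, _, _ => (none, .nop)
  | push k f, _, t => (none, .push k (f t))
  | pop k, _, _ => (none, .pop k)
  | opush f, _, t => (none, .opush (f t))
  | opop, _, _ => (none, .opop)
  | next, _, _ => (none, .next)
  | query o, _, _ => (none, .query o)
  | seq p q, .inl x, t => (some (((trans p x t).1).elim (.inr q.entry) .inl), (trans p x t).2)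
  | seq _ q, .inr x, t => ((trans q x t).1.map .inr, (trans q x t).2)
  | ite c p q, none, t => (some (some (if c t then .inl p.entry else .inr q.entry)), .nop)
  | ite _ p _, some (.inl x), t => ((trans p x t).1.map (some ∘ .inl), (trans p x t).2)
  | ite _ _ q, some (.inr x), t => ((trans q x t).1.map (some ∘ .inr), (trans q x t).2)
  | .while c p, none, t => (if c t then some (some p.entry) else none, .nop)
  | .while _ p, some x, t => (some (trans p x t).1, (trans p x t).2)

end Prog

variable {G : Type*} [Group G]

/-- The steps of the machine with the transition function `g`, as long as they respect the space
bound `s`. -/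
def CmdStep (B : BlackBox G) (s : ℕ) {Q : Type} (g : Q → Top → Q × Cmd) (x y : Q × Store) : Prop :=
  (g x.1 x.2.top).2.Fits B s x.2 ∧ y = ((g x.1 x.2.top).1, (g x.1 x.2.top).2.apply B x.2)

lemma CmdStep.single {B : BlackBox G} {s : ℕ} {Q : Type} {g : Q → Top → Q × Cmd} {q q' : Q}
    {R : Store} {c : Cmd} (h : g q R.top = (q', c)) (hc : c.Fits B s R) :
    Relation.ReflTransGen (CmdStep B s g) (q, R) (q', c.apply B R) :=
  .single ⟨by simpa [h] using hc, by simp [h]⟩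

/-- If the states of the program `p` are embedded into a machine by `ι`, with exit to the state
`e`, then the machine carries out every execution of `p`. -/
theorem Exec.cmdSteps {B : BlackBox G} {s : ℕ} {p : Prog} {R R' : Store} (h : Exec B s p R R') :
    ∀ {Q : Type} (g : Q → Top → Q × Cmd) (ι : p.State → Q) (e : Q),
      (∀ x t, g (ι x) t = ((p.trans x t).1.elim e ι, (p.trans x t).2)) →
      Relation.ReflTransGen (CmdStep B s g) (ι p.entry, R) (e, R') := by
  induction h with
  | skip => intro Q g ι e H; exact CmdStep.single (H _ _) trivial
  | push h => intro Q g ι e H; exact CmdStep.single (H _ _) h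
  | pop => intro Q g ι e H; exact CmdStep.single (H _ _) trivial
  | opush h => intro Q g ι e H; exact CmdStep.single (H _ _) h
  | opop => intro Q g ι e H; exact CmdStep.single (H _ _) trivial
  | next h => intro Q g ι e H; exact CmdStep.single (H _ _) h
  | query h => intro Q g ι e H; exact CmdStep.single (H _ _) h
  | @seq p q R R' R'' _ _ ih₁ ih₂ =>
    intro Q g ι e H
    refine (ih₁ g (ι ∘ .inl) (ι (.inr q.entry)) ?_).trans (ih₂ g (ι ∘ .inr) e ?_)
    · intro x t
      refine (H _ _).trans ?_
      simp only [Prog.trans, Option.elim]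
      cases (p.trans x t).1 <;> rfl
    · intro x t
      refine (H _ _).trans ?_
      simp only [Prog.trans]
      cases (q.trans x t).1 <;> rfl
  | @ite_true c p q R R' hc _ ih =>
    intro Q g ι e H
    refine .trans (CmdStep.single (c := .nop) (q' := ι (some (.inl p.entry))) ?_ trivial)
      (ih g (ι ∘ some ∘ .inl) e ?_)
    · refine (H _ _).trans ?_
      simp [Prog.trans, Prog.entry, hc]
      rfl
    · intro x t
      refine (H _ _).trans ?_
      simp only [Function.comp, Prog.trans]
      cases (p.trans x t).1 <;> rfl
  | @ite_false c p q R R' hc _ ih =>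
    intro Q g ι e H
    refine .trans (CmdStep.single (c := .nop) (q' := ι (some (.inr q.entry))) ?_ trivial)
      (ih g (ι ∘ some ∘ .inr) e ?_)
    · refine (H _ _).trans ?_
      simp [Prog.trans, Prog.entry, hc]
      rfl
    · intro x t
      refine (H _ _).trans ?_
      simp only [Function.comp, Prog.trans]
      cases (q.trans x t).1 <;> rfl
  | @while_false c p R hc =>
    intro Q g ι e H
    refine CmdStep.single (c := .nop) ?_ trivial
    refine (H _ _).trans ?_
    simp [Prog.trans, Prog.entry, hc]
  | @while_true c p R R' R'' hc _ _ ih₁ ih₂ =>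
    intro Q g ι e H
    refine .trans (.trans (CmdStep.single (c := .nop) (q' := ι (some p.entry)) ?_ trivial)
      (ih₁ g (ι ∘ some) (ι none) ?_)) (ih₂ g ι e H)
    · refine (H _ _).trans ?_
      simp [Prog.trans, Prog.entry, hc]
      rfl
    · intro x t
      refine (H _ _).trans ?_
      simp only [Prog.trans]
      cases (p.trans x t).1 <;> rfl

end StackProgram

/-! ### Compilation to black box Turing machines -/

namespace OTape

variable {α : Type*}

/-- The tape with the word `l` on the cells `0, 1, 2, …` and head on cell `h`. -/
def wordAt (l : List α) (h : ℤ) : OTape α := ⟨(OTape.ofList l).cells, h⟩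

/-- The tape that represents the stack `l`: its bottom is on cell `0`, and the head is on its
top, so on cell `-1` for the empty stack. -/
def ofStack (l : List α) : OTape α := wordAt l.reverse (l.length - 1)

lemma cells_ofList_natCast (l : List α) (i : ℕ) : (OTape.ofList l).cells i = l[i]? := by
  simp [OTape.ofList]

lemma cells_ofList_of_neg (l : List α) {i : ℤ} (hi : i < 0) : (OTape.ofList l).cells i = none := by
  simp [OTape.ofList, hi]

lemma read_wordAt_length (l : List α) : (wordAt l l.length).read = none := by
  simp [wordAt, OTape.read, cells_ofList_natCast]

lemma read_ofStack (l : List α) : (ofStack l).read = l.head? := by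
  cases l with
  | nil =>
    change (OTape.ofList [].reverse).cells ((([] : List α).length : ℤ) - 1) = none
    exact cells_ofList_of_neg _ (by simp)
  | cons a l =>
    simp [ofStack, wordAt, OTape.read, cells_ofList_natCast]

lemma write_read (t : OTape α) : t.write t.read = t := by
  simp [OTape.write, OTape.read]

@[simp] lemma move_zero (t : OTape α) : t.move 0 = t := by
  simp [OTape.move]

lemma ofStack_write_head? (l : List α) : (ofStack l).write l.head? = ofStack l := by
  rw [← read_ofStack, write_read]

lemma ofStack_move_one (l : List α) : (ofStack l).move 1 = wordAt l.reverse l.length := by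
  simp [ofStack, wordAt, OTape.move]

lemma wordAt_write_length (l : List α) (a : α) :
    (wordAt l.reverse l.length).write (some a) = ofStack (a :: l) := by
  have : (OTape.ofList (l.reverse ++ [a])).cells =
      Function.update (OTape.ofList l.reverse).cells (l.length : ℤ) (some a) := by
    funext i
    rcases lt_or_ge i 0 with hi | hi
    · rw [Function.update_of_ne (by omega), cells_ofList_of_neg _ hi, cells_ofList_of_neg _ hi]
    · lift i to ℕ using hi
      by_cases h : i = l.length
      · subst h
        simp [cells_ofList_natCast]
      · rw [Function.update_of_ne (by omega), cells_ofList_natCast, cells_ofList_natCast]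
        grind
  simp [ofStack, wordAt, OTape.write, this]

lemma ofStack_pop (a : α) (l : List α) :
    ((ofStack (a :: l)).write none).move (-1) = ofStack l := by
  have : (OTape.ofList l.reverse).cells =
      Function.update (OTape.ofList (l.reverse ++ [a])).cells (l.length : ℤ) none := by
    funext i
    rcases lt_or_ge i 0 with hi | hi
    · rw [Function.update_of_ne (by omega), cells_ofList_of_neg _ hi, cells_ofList_of_neg _ hi]
    · lift i to ℕ using hi
      by_cases h : i = l.length
      · subst h
        simp [cells_ofList_natCast]
      · rw [Function.update_of_ne (by omega), cells_ofList_natCast, cells_ofList_natCast]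
        grind
  simp [ofStack, wordAt, OTape.write, OTape.move, this, sub_eq_add_neg]

end OTape

namespace StackProgram

namespace Compile

variable (P : Prog)

/-- The states of the machine for `P`. A `main` state is a state of `P` or, for `none`, the exit.
A push moves the head in a first step and writes in a second one. After a query the state `walk`
moves the head from cell `0` to the last bit of the answer. In the state `start` the heads are moved
to the positions that represent empty stacks. -/
inductive State where
  | main (q : Option P.State)
  | push (q : Option P.State) (k : Reg) (a : Sym)
  | opush (q : Option P.State) (v : Bool)
  | query (o : OracleKind)
  | walk (q : Option P.State)
  | start
  | accept
  | reject

instance : Finite InputSym :=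
  Finite.of_injective (β := Bool × Fin 5) (fun
    | .bit v => (v, 0) | .hash => (true, 1) | .nonterminal => (true, 2) | .element => (true, 3)
    | .rule => (true, 4)) (by
      intro a b h
      cases a <;> cases b <;> simp_all)

instance : Finite Label :=
  Finite.of_injective (β := Fin 7) (fun
    | .mid => 0 | .left => 1 | .right => 2 | .wit => 3 | .ptr => 4 | .opt => 5 | .side => 6) (by
      intro a b h
      cases a <;> cases b <;> simp_all)

instance : Finite Sym :=
  Finite.of_injective (β := InputSym ⊕ Bool ⊕ Bool ⊕ Label ⊕ (Label × Bool) ⊕ Fin 4) (fun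
    | .inp s => .inl s | .bit v => .inr (.inl v) | .up v => .inr (.inr (.inl v))
    | .kind l => .inr (.inr (.inr (.inl l)))
    | .cell l v => .inr (.inr (.inr (.inr (.inl (l, v)))))
    | .mark => .inr (.inr (.inr (.inr (.inr 0)))) | .ok => .inr (.inr (.inr (.inr (.inr 1))))
    | .fail => .inr (.inr (.inr (.inr (.inr 2))))
    | .down => .inr (.inr (.inr (.inr (.inr 3))))) (by
      intro a b h
      cases a <;> cases b <;> simp_all)

instance : Finite Reg :=
  Finite.of_injective (β := Fin 23) (fun k => ⟨k.ctorIdx, by cases k <;> decide⟩) (by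
    intro a b h
    cases a <;> cases b <;> first | rfl | simp [Reg.ctorIdx] at h)

instance : Finite (State P) :=
  Finite.of_injective
    (β := (Option P.State × Reg × Sym) ⊕ (Option P.State × Bool) ⊕ Fin 4 ⊕ Option P.State ⊕
      Option P.State ⊕ Fin 3) (fun
    | .push q k a => .inl (q, k, a) | .opush q v => .inr (.inl (q, v))
    | .query .valid => .inr (.inr (.inl 0)) | .query .inv => .inr (.inr (.inl 1))
    | .query .prod => .inr (.inr (.inl 2)) | .query .isId => .inr (.inr (.inl 3))
    | .main q => .inr (.inr (.inr (.inl q))) | .walk q => .inr (.inr (.inr (.inr (.inl q))))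
    | .accept => .inr (.inr (.inr (.inr (.inr 0))))
    | .reject => .inr (.inr (.inr (.inr (.inr 1))))
    | .start => .inr (.inr (.inr (.inr (.inr 2))))) (by
      intro a b h
      rcases a with q | ⟨q, k, a⟩ | ⟨q, a⟩ | (_ | _ | _ | _) | q | _ | _ | _ <;>
      rcases b with q' | ⟨q', k', a'⟩ | ⟨q', a'⟩ | (_ | _ | _ | _) | q' | _ | _ | _ <;> simp_all)

/-- The work alphabet: stack symbols, and the states to which the machine returns from a query. -/
abbrev Alphabet := Sym ⊕ Option P.State

variable {P}

/-- What the program sees when the machine scans the given symbols. -/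
def topOf (i : Option InputSym) (o : Option Bool) (w : Option Reg → Option (Alphabet P)) : Top where
  stk k := (w (some k)).bind fun a => a.elim some fun _ => none
  orc := o
  inp := i

/-- The action that changes nothing but the state. -/
def goto (q : State P) (o : Option Bool) (w : Option Reg → Option (Alphabet P)) :
    TMAction (State P) (Option Reg) (Alphabet P) :=
  ⟨q, 0, o, 0, w, 0⟩

/-- The first machine step for a command; `n` is the state in which the program goes on. The
address `n` for the return from a query is written on the extra work tape `none`. -/
def act (n : Option P.State) (o : Option Bool) (w : Option Reg → Option (Alphabet P)) :
    Cmd → TMAction (State P) (Option Reg) (Alphabet P)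
  | .nop => goto (.main n) o w
  | .push k a => { goto (.push n k a) o w with workMove := Pi.single (some k) 1 }
  | .pop k =>
    if w (some k) = none then goto (.main n) o w
    else { goto (.main n) o w with
      workWrite := Function.update w (some k) none, workMove := Pi.single (some k) (-1) }
  | .opush v => { goto (.opush n v) o w with oracleMove := 1 }
  | .opop =>
    if o = none then goto (.main n) o w
    else { goto (.main n) o w with oracleWrite := none, oracleMove := -1 }
  | .next => { goto (.main n) o w with inputMove := 1 }
  | .query o' => { goto (.query o') o w with workWrite := Function.update w none (some (.inr n)) }

/-- The transition function of the machine for `P`. -/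
def delta (P : Prog) : State P → Option InputSym → Option Bool →
    (Option Reg → Option (Alphabet P)) → TMAction (State P) (Option Reg) (Alphabet P)
  | .main none, i, o, w =>
    goto (if (topOf i o w).stk .mode matches some (.up true) then .accept else .reject) o w
  | .main (some q), i, o, w =>
    act (P.trans q (topOf i o w)).1 o w (P.trans q (topOf i o w)).2
  | .push n k a, _, o, w =>
    { goto (.main n) o w with workWrite := Function.update w (some k) (some (.inl a)) }
  | .opush n v, _, o, w => { goto (.main n) o w with oracleWrite := some v }
  | .query _, _, o, w => goto (.walk ((w none).elim none fun a => a.elim (fun _ => none) id)) o w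
  | .walk n, _, o, w =>
    if o = none then { goto (.main n) o w with oracleMove := -1 }
    else { goto (.walk n) o w with oracleMove := 1 }
  | .start, _, o, w =>
    { goto (.main (some P.entry)) o w with
      oracleMove := -1, workMove := fun k => k.elim 0 fun _ => -1 }
  | .accept, _, o, w => goto .accept o w
  | .reject, _, o, w => goto .reject o w

/-- The black box Turing machine that runs the program `P` and accepts if and only if at the end
the top of the stack `mode` is `up true`. -/
def machine (P : Prog) : BlackBoxTM InputSym where
  Q := State P
  K := Option Reg
  Γ := Alphabet P
  start := .start
  accept := .accept
  reject := .reject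
  accept_ne_reject := by simp
  query := fun
    | .query o => some o
    | _ => none
  query_unique o := by
    refine ⟨.query o, rfl, ?_⟩
    intro q hq
    cases q <;> simp_all
  δ := delta P

/-- The configuration in the state `q` that represents the store `R`, after the part `pre` of the
input has been read; `ret` is the content of the tape for return addresses. -/
def conf (P : Prog) (q : State P) (pre : List InputSym) (ret : ℤ → Option (Alphabet P))
    (R : Store) : (machine P).Config where
  state := q
  input := OTape.wordAt (pre ++ R.inp) pre.length
  oracle := OTape.ofStack R.orc
  work k := k.elim ⟨ret, 0⟩ fun k => OTape.ofStack ((R.get k).map .inl)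

end Compile
end StackProgram

namespace StackProgram

/-- All stacks have height at most `s`. -/
def Store.Fits (s : ℕ) (R : Store) : Prop :=
  (∀ k, (R.get k).length ≤ s) ∧ R.orc.length ≤ s

lemma Store.Fits.apply {G : Type*} [Group G] {B : BlackBox G} {s : ℕ} {R : Store} {c : Cmd}
    (h : R.Fits s) (hc : c.Fits B s R) : (c.apply B R).Fits s := by
  have hset : ∀ k l, l.length ≤ s → (R.set k l).Fits s := by
    intro k l hl
    refine ⟨fun k' => ?_, by simpa using h.2⟩
    by_cases hk : k' = k
    · subst hk; simpa using hl
    · rw [Store.get_set_of_ne _ hk]; exact h.1 k'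
  have hsetOrc : ∀ l : List Bool, l.length ≤ s → (R.setOrc l).Fits s :=
    fun l hl => ⟨by simpa using h.1, hl⟩
  cases c with
  | nop => exact h
  | push k a => exact hset k _ hc
  | pop k => exact hset k _ (by have := h.1 k; simp; omega)
  | opush v => exact hsetOrc _ hc
  | opop => exact hsetOrc _ (by have := h.2; simp; omega)
  | next => exact ⟨by simpa [Cmd.apply] using h.1, h.2⟩
  | query o => exact hsetOrc _ hc

namespace Compile

variable {P : Prog} {G : Type*} [Group G] {B : BlackBox G} {s : ℕ}

/-- All heads are within distance `s` of the origin. -/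
def Within {M : BlackBoxTM InputSym} (s : ℕ) (C : M.Config) : Prop :=
  |C.input.head| ≤ s ∧ |C.oracle.head| ≤ s ∧ ∀ k, |(C.work k).head| ≤ s

/-- A machine step to a configuration in which all heads are within distance `s` of the origin. -/
def BoundedStep (M : BlackBoxTM InputSym) (B : BlackBox G) (s : ℕ) (C C' : M.Config) : Prop :=
  M.step B C = some C' ∧ Within s C'

lemma within_of_reflTransGen {M : BlackBoxTM InputSym} {C C' : M.Config}
    (h : Relation.ReflTransGen (BoundedStep M B s) C C') (hC : Within s C)
    (hC' : M.step B C' = none) {D : M.Config} (hD : StateTransition.Reaches (M.step B) C D) :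
    Within s D := by
  induction h using Relation.ReflTransGen.head_induction_on with
  | refl =>
    rcases hD.cases_head with rfl | ⟨E, hE, -⟩
    · exact hC
    · simp [hC'] at hE
  | head h _ ih =>
    rcases hD.cases_head with rfl | ⟨E, hE, hED⟩
    · exact hC
    · have : E = _ := Option.mem_unique hE h.1
      subst this
      exact ih h.2 hED

lemma reaches_of_reflTransGen {M : BlackBoxTM InputSym} {C C' : M.Config}
    (h : Relation.ReflTransGen (BoundedStep M B s) C C') :
    StateTransition.Reaches (M.step B) C C' :=
  Relation.ReflTransGen.mono (fun _ _ h => h.1) _ _ h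

lemma abs_length_sub_one_le {α : Type*} {l : List α} (h : l.length ≤ s) (hs : 1 ≤ s) :
    |(l.length : ℤ) - 1| ≤ s := by
  rw [abs_le]; omega

lemma within_conf {q : State P} {pre : List InputSym} {ret : ℤ → Option (Alphabet P)} {R : Store}
    (hs : 1 ≤ s) (hR : R.Fits s) (hpre : pre.length ≤ s) : Within s (conf P q pre ret R) := by
  refine ⟨by simpa [conf, OTape.wordAt] using hpre, ?_, ?_⟩
  · exact abs_length_sub_one_le hR.2 hs
  · rintro (_ | k)
    · simp [conf]
    · refine abs_length_sub_one_le (l := (R.get k).map Sum.inl) ?_ hs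
      exact List.length_map (Sum.inl (β := Option P.State)) |>.trans_le (hR.1 k)

/-- The symbols that are scanned on the work tapes in a configuration `conf`. -/
def scanned (P : Prog) (ret : ℤ → Option (Alphabet P)) (R : Store) (k : Option Reg) :
    Option (Alphabet P) :=
  k.elim (ret 0) fun k => ((R.get k).map .inl).head?

lemma conf_work_read (q : State P) (pre : List InputSym) (ret : ℤ → Option (Alphabet P))
    (R : Store) (k : Option Reg) : ((conf P q pre ret R).work k).read = scanned P ret R k := by
  cases k with
  | none => rfl
  | some k => exact OTape.read_ofStack _

lemma topOf_scanned (pre : List InputSym) (ret : ℤ → Option (Alphabet P)) (R : Store) :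
    topOf (OTape.wordAt (pre ++ R.inp) pre.length).read R.orc.head? (scanned P ret R) = R.top := by
  have : (OTape.wordAt (pre ++ R.inp) pre.length).read = R.inp.head? := by
    simp only [OTape.wordAt, OTape.read, OTape.cells_ofList_natCast]
    cases R.inp <;> simp
  simp only [topOf, Store.top, scanned, this, Top.mk.injEq, and_true]
  funext k
  change (((R.get k).map Sum.inl).head?).bind _ = _
  cases R.get k <;> rfl

/-- The state is one of the two halting states. -/
def State.halted : State P → Bool
  | .accept | .reject => true
  | _ => false

lemma step_of_not_halted {C : (machine P).Config} (h : State.halted C.state = false) :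
    (machine P).step B C = some ((machine P).applyQuery B ((machine P).applyδ C)) := by
  rw [BlackBoxTM.step, if_neg]
  rintro (h' | h') <;> rw [h'] at h <;> exact Bool.noConfusion h

lemma step_eq {C D : (machine P).Config}
    {a : TMAction (machine P).Q (machine P).K (machine P).Γ}
    (h : State.halted C.state = false)
    (ha : (machine P).δ C.state C.input.read C.oracle.read (fun k => (C.work k).read) = a)
    (hq : (machine P).query a.next = none) (hstate : a.next = D.state)
    (hinput : C.input.move a.inputMove = D.input)
    (horacle : (C.oracle.write a.oracleWrite).move a.oracleMove = D.oracle)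
    (hwork : ∀ k, ((C.work k).write (a.workWrite k)).move (a.workMove k) = D.work k) :
    (machine P).step B C = some D := by
  subst ha
  rw [step_of_not_halted h, BlackBoxTM.applyQuery]
  have : (machine P).query ((machine P).applyδ C).state = none := hq
  rw [this]
  obtain ⟨D1, D2, D3, D4⟩ := D
  simp only [BlackBoxTM.applyδ, Option.some.injEq, BlackBoxTM.Config.mk.injEq]
  exact ⟨hstate, hinput, horacle, funext hwork⟩

lemma step_eq_query {C D : (machine P).Config}
    {a : TMAction (machine P).Q (machine P).K (machine P).Γ}
    {o : OracleKind} (h : State.halted C.state = false)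
    (ha : (machine P).δ C.state C.input.read C.oracle.read (fun k => (C.work k).read) = a)
    (hq : (machine P).query a.next = some o) (hstate : a.next = D.state)
    (hinput : C.input.move a.inputMove = D.input)
    (horacle : OTape.ofList (B.answer ((C.oracle.write a.oracleWrite).move a.oracleMove).cells o) =
      D.oracle)
    (hwork : ∀ k, ((C.work k).write (a.workWrite k)).move (a.workMove k) = D.work k) :
    (machine P).step B C = some D := by
  subst ha
  rw [step_of_not_halted h, BlackBoxTM.applyQuery]
  have : (machine P).query ((machine P).applyδ C).state = some o := hq
  rw [this]
  obtain ⟨D1, D2, D3, D4⟩ := D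
  simp only [BlackBoxTM.applyδ, Option.some.injEq, BlackBoxTM.Config.mk.injEq]
  exact ⟨hstate, hinput, horacle, funext hwork⟩

lemma delta_conf (q : State P) (pre : List InputSym) (ret : ℤ → Option (Alphabet P)) (R : Store) :
    (machine P).δ (conf P q pre ret R).state (conf P q pre ret R).input.read
      (conf P q pre ret R).oracle.read (fun k => ((conf P q pre ret R).work k).read) =
    delta P q (OTape.wordAt (pre ++ R.inp) pre.length).read R.orc.head? (scanned P ret R) := by
  have h2 : (fun k => ((conf P q pre ret R).work k).read) = scanned P ret R :=
    funext fun k => conf_work_read ..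
  rw [h2]
  change delta P q _ (OTape.ofStack R.orc).read _ = _
  rw [OTape.read_ofStack]
  rfl

lemma work_idle (q : State P) (pre : List InputSym) (ret : ℤ → Option (Alphabet P))
    (R : Store) (k : Option Reg) :
    (((conf P q pre ret R).work k).write (scanned P ret R k)).move 0 =
      (conf P q pre ret R).work k := by
  rw [← conf_work_read q pre, OTape.write_read, OTape.move_zero]

lemma oracle_idle (R : Store) :
    ((OTape.ofStack R.orc).write R.orc.head?).move 0 = OTape.ofStack R.orc := by
  rw [OTape.ofStack_write_head?, OTape.move_zero]

lemma step_goto {q q' : State P} (hq : q.halted = false) (pre : List InputSym)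
    (ret : ℤ → Option (Alphabet P)) (R : Store)
    (ha : delta P q (OTape.wordAt (pre ++ R.inp) pre.length).read R.orc.head?
      (scanned P ret R) = goto q' R.orc.head? (scanned P ret R))
    (hn : (machine P).query q' = none) :
    (machine P).step B (conf P q pre ret R) = some (conf P q' pre ret R) :=
  step_eq hq ((delta_conf ..).trans ha) hn rfl (OTape.move_zero _) (oracle_idle R)
    (work_idle q pre ret R)

end Compile
end StackProgram

namespace StackProgram
namespace Compile

variable {P : Prog} {G : Type*} [Group G] {B : BlackBox G} {s : ℕ}

lemma idle {α : Type*} (t : OTape α) : (t.write t.read).move 0 = t := by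
  rw [OTape.write_read, OTape.move_zero]

lemma conf_work_congr {q q' : State P} {pre pre' : List InputSym} {ret : ℤ → Option (Alphabet P)}
    {R R' : Store} (h : ∀ k, R.get k = R'.get k) (k : Option Reg) :
    (conf P q pre ret R).work k = (conf P q' pre' ret R').work k := by
  cases k with
  | none => rfl
  | some k => simp only [conf, Option.elim, h]

lemma conf_work_set_self (q : State P) (pre : List InputSym) (ret : ℤ → Option (Alphabet P))
    (R : Store) (k : Reg) (l : List Sym) :
    (conf P q pre ret (R.set k l)).work (some k) = OTape.ofStack (l.map .inl) := by
  simp only [conf, Option.elim, Store.get_set_self]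

lemma conf_work_set_of_ne (q q' : State P) (pre pre' : List InputSym)
    (ret : ℤ → Option (Alphabet P)) (R : Store) {k : Reg} (l : List Sym) {k' : Option Reg}
    (h : k' ≠ some k) :
    (conf P q pre ret (R.set k l)).work k' = (conf P q' pre' ret R).work k' := by
  cases k' with
  | none => rfl
  | some k' =>
    have : k' ≠ k := fun e => h (congrArg some e)
    simp only [conf, Option.elim, Store.get_set_of_ne _ this]

lemma conf_input_of_inp_eq {q q' : State P} {pre : List InputSym} {ret : ℤ → Option (Alphabet P)}
    {R R' : Store} (h : R'.inp = R.inp) :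
    (conf P q pre ret R).input = (conf P q' pre ret R').input := by
  simp only [conf, h]

/-- The machine of `P` passes through bounded configurations only. -/
abbrev Steps (P : Prog) (B : BlackBox G) (s : ℕ) :=
  Relation.ReflTransGen (BoundedStep (machine P) B s)

lemma steps_push (n : Option P.State) (k : Reg) (a : Sym) (q : P.State) (pre : List InputSym)
    (ret : ℤ → Option (Alphabet P)) (R : Store) (hs : 1 ≤ s) (hR : R.Fits s)
    (hpre : pre.length ≤ s) (hc : (Cmd.push k a).Fits B s R)
    (ht : P.trans q R.top = (n, .push k a)) :
    Steps P B s (conf P (.main (some q)) pre ret R)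
      (conf P (.main n) pre ret (R.set k (a :: R.get k))) := by
  have hw := within_conf (P := P) (q := .main n) (ret := ret) hs hR hpre
  have hd : delta P (.main (some q)) (OTape.wordAt (pre ++ R.inp) pre.length).read R.orc.head?
      (scanned P ret R) = act n R.orc.head? (scanned P ret R) (.push k a) := by
    simp [delta, topOf_scanned, ht]
  let C : (machine P).Config :=
    { conf P (.push n k a) pre ret R with
      work := fun k' : Option Reg => if k' = some k then
        OTape.wordAt ((R.get k).map .inl).reverse (R.get k).length
        else (conf P (.main n) pre ret R).work k' }
  have h1 : (machine P).step B (conf P (.main (some q)) pre ret R) = some C := by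
    refine step_eq rfl ((delta_conf ..).trans hd) rfl rfl
      (OTape.move_zero _) (oracle_idle R) fun (k' : Option Reg) => ?_
    by_cases hk : k' = some k
    · subst hk
      have h0 : ((R.get k).length : ℤ) =
          ((R.get k).map (Sum.inl (β := Option P.State))).length := by
        rw [List.length_map]
      simp only [C, if_true, act, goto, Pi.single_eq_same]
      rw [h0]
      refine Eq.trans ?_ (OTape.ofStack_move_one _)
      exact congrArg (OTape.move · 1) (OTape.ofStack_write_head? _)
    · simp only [C, if_neg hk, act, goto, Pi.single_eq_of_ne hk]
      exact work_idle _ _ _ _ _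
  have h2 : (machine P).step B C = some (conf P (.main n) pre ret (R.set k (a :: R.get k))) := by
    refine step_eq (a := delta P (.push n k a) C.input.read C.oracle.read fun k => (C.work k).read)
      rfl rfl rfl rfl
      ((OTape.move_zero _).trans (conf_input_of_inp_eq (q := .main n) (by simp))) ?_
        fun (k' : Option Reg) => ?_
    · refine (idle _).trans ?_
      simp [C, conf]
    · by_cases hk : k' = some k
      · subst hk
        have e : Function.update (fun k' : Option Reg => ((C.work k').read : Option (Alphabet P)))
            (some k) (some (.inl a)) (some k) = some (.inl a) := Function.update_self ..
        have e2 : C.work (some k : Option Reg) =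
            OTape.wordAt ((R.get k).map .inl).reverse (R.get k).length := if_pos rfl
        have e3 : (OTape.wordAt ((R.get k).map .inl).reverse (R.get k).length).write
            (some (.inl a : Alphabet P)) = OTape.ofStack ((a :: R.get k).map .inl) := by
          rw [List.map_cons, ← OTape.wordAt_write_length, List.length_map]
        refine Eq.trans ?_ (conf_work_set_self (.main n) pre ret R k (a :: R.get k)).symm
        exact (OTape.move_zero _).trans ((congrArg₂ OTape.write e2 e).trans e3)
      · have e : Function.update (fun k' : Option Reg => ((C.work k').read : Option (Alphabet P)))
            (some k) (some (.inl a)) k' = (C.work k').read := Function.update_of_ne hk ..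
        have e2 : C.work k' = (conf P (.main n) pre ret R).work k' := if_neg hk
        refine Eq.trans ?_ (conf_work_set_of_ne (.main n) (.main n) pre pre ret R _ hk).symm
        exact (OTape.move_zero _).trans
          ((congrArg₂ OTape.write rfl e).trans ((OTape.write_read _).trans e2))
  refine .tail (.single ⟨h1, hw.1, hw.2.1, fun (k' : Option Reg) => ?_⟩)
    ⟨h2, within_conf hs (hR.apply (c := .push k a) hc) hpre⟩
  by_cases hk : k' = some k
  · subst hk
    have : (R.get k).length < s := hc
    simp only [C, if_true, OTape.wordAt]
    rw [abs_le]; omega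
  · simp only [C, if_neg hk]
    exact hw.2.2 k'

lemma steps_opush (n : Option P.State) (v : Bool) (q : P.State) (pre : List InputSym)
    (ret : ℤ → Option (Alphabet P)) (R : Store) (hs : 1 ≤ s) (hR : R.Fits s)
    (hpre : pre.length ≤ s) (hc : (Cmd.opush v).Fits B s R)
    (ht : P.trans q R.top = (n, .opush v)) :
    Steps P B s (conf P (.main (some q)) pre ret R)
      (conf P (.main n) pre ret (R.setOrc (v :: R.orc))) := by
  have hw := within_conf (P := P) (q := .main n) (ret := ret) hs hR hpre
  have hd : delta P (.main (some q)) (OTape.wordAt (pre ++ R.inp) pre.length).read R.orc.head?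
      (scanned P ret R) = act n R.orc.head? (scanned P ret R) (.opush v) := by
    simp [delta, topOf_scanned, ht]
  let C : (machine P).Config :=
    { conf P (.opush n v) pre ret R with oracle := OTape.wordAt R.orc.reverse R.orc.length }
  have h1 : (machine P).step B (conf P (.main (some q)) pre ret R) = some C := by
    refine step_eq rfl ((delta_conf ..).trans hd) rfl rfl
      (OTape.move_zero _) ?_ (work_idle _ _ _ _)
    simp only [C, act, goto]
    rw [← OTape.ofStack_move_one]
    congr 1
    exact OTape.ofStack_write_head? _
  have h2 : (machine P).step B C = some (conf P (.main n) pre ret (R.setOrc (v :: R.orc))) := by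
    refine step_eq (a := delta P (.opush n v) C.input.read C.oracle.read fun k => (C.work k).read)
      rfl rfl rfl rfl
      ((OTape.move_zero _).trans (conf_input_of_inp_eq (q := .main n) (q' := .main n) rfl)) ?_
        fun (k' : Option Reg) => ?_
    · refine (OTape.move_zero _).trans ?_
      exact OTape.wordAt_write_length _ _
    · refine (idle _).trans ?_
      exact conf_work_congr (q := .main n) (pre := pre) (fun k => by simp) k'
  refine .tail (.single ⟨h1, hw.1, ?_, hw.2.2⟩)
    ⟨h2, within_conf hs (hR.apply (c := .opush v) hc) hpre⟩
  have : R.orc.length < s := hc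
  simp only [C, OTape.wordAt]
  rw [abs_le]; omega

lemma steps_pop (n : Option P.State) (k : Reg) (q : P.State) (pre : List InputSym)
    (ret : ℤ → Option (Alphabet P)) (R : Store) (hs : 1 ≤ s) (hR : R.Fits s)
    (hpre : pre.length ≤ s) (ht : P.trans q R.top = (n, .pop k)) :
    Steps P B s (conf P (.main (some q)) pre ret R)
      (conf P (.main n) pre ret (R.set k (R.get k).tail)) := by
  have hd : delta P (.main (some q)) (OTape.wordAt (pre ++ R.inp) pre.length).read R.orc.head?
      (scanned P ret R) = act n R.orc.head? (scanned P ret R) (.pop k) := by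
    simp [delta, topOf_scanned, ht]
  refine .single ⟨?_, within_conf hs (hR.apply (c := .pop k) (B := B) trivial) hpre⟩
  rcases h : R.get k with _ | ⟨a, l⟩
  · have h0 : scanned P ret R (some k) = none := by simp [scanned, h]
    have h1 : R.set k [].tail = R := by rw [List.tail_nil, ← h, Store.set_get]
    rw [h1]
    refine step_goto rfl _ _ _ (hd.trans ?_) rfl
    simp [act, h0]
  · have h0 : scanned P ret R (some k) = some (.inl a) := by simp [scanned, h]
    simp only [act, h0, reduceCtorEq, if_false] at hd
    refine step_eq rfl ((delta_conf ..).trans hd) rfl rfl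
      ((OTape.move_zero _).trans (conf_input_of_inp_eq (q := .main (some q)) (by simp))) ?_
      fun (k' : Option Reg) => ?_
    · refine (oracle_idle R).trans ?_
      simp [conf]
    · by_cases hk : k' = some k
      · subst hk
        rw [conf_work_set_self, List.tail_cons, ← OTape.ofStack_pop (.inl a)]
        simp only [Function.update_self, Pi.single_eq_same, conf, Option.elim, h]
        rfl
      · rw [conf_work_set_of_ne (q' := .main (some q)) (pre' := pre) _ _ _ _ _ hk]
        simp only [Function.update_of_ne hk, Pi.single_eq_of_ne hk]
        exact work_idle _ _ _ _ _

lemma steps_opop (n : Option P.State) (q : P.State) (pre : List InputSym)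
    (ret : ℤ → Option (Alphabet P)) (R : Store) (hs : 1 ≤ s) (hR : R.Fits s)
    (hpre : pre.length ≤ s) (ht : P.trans q R.top = (n, .opop)) :
    Steps P B s (conf P (.main (some q)) pre ret R)
      (conf P (.main n) pre ret (R.setOrc R.orc.tail)) := by
  have hd : delta P (.main (some q)) (OTape.wordAt (pre ++ R.inp) pre.length).read R.orc.head?
      (scanned P ret R) = act n R.orc.head? (scanned P ret R) .opop := by
    simp [delta, topOf_scanned, ht]
  refine .single ⟨?_, within_conf hs (hR.apply (c := .opop) (B := B) trivial) hpre⟩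
  rcases h : R.orc with _ | ⟨a, l⟩
  · have h1 : R.setOrc [].tail = R := by rw [List.tail_nil, ← h]; rfl
    rw [h1]
    refine step_goto rfl _ _ _ (hd.trans ?_) rfl
    simp [act, h]
  · simp only [act, h, List.head?_cons, reduceCtorEq, if_false] at hd
    refine step_eq rfl ((delta_conf ..).trans (by rw [h]; exact hd))
      rfl rfl ((OTape.move_zero _).trans
        (conf_input_of_inp_eq (q := .main (some q)) (q' := .main n) rfl)) ?_
          fun (k' : Option Reg) => ?_
    · simp only [conf, h]
      exact OTape.ofStack_pop a l
    · refine (work_idle _ _ _ _ _).trans ?_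
      exact conf_work_congr (fun k => by simp) k'

lemma steps_next (n : Option P.State) (q : P.State) (pre : List InputSym)
    (ret : ℤ → Option (Alphabet P)) (R : Store) (hs : 1 ≤ s) (hR : R.Fits s)
    {a : InputSym} {l : List InputSym} (hl : R.inp = a :: l)
    (hpre : (pre ++ [a]).length ≤ s) (ht : P.trans q R.top = (n, .next)) :
    Steps P B s (conf P (.main (some q)) pre ret R)
      (conf P (.main n) (pre ++ [a]) ret (R.setInp l)) := by
  have hd : delta P (.main (some q)) (OTape.wordAt (pre ++ R.inp) pre.length).read R.orc.head?
      (scanned P ret R) = act n R.orc.head? (scanned P ret R) .next := by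
    simp [delta, topOf_scanned, ht]
  have hR' : (R.setInp l).Fits s := by
    refine ⟨by simpa using hR.1, hR.2⟩
  refine .single ⟨?_, within_conf hs hR' hpre⟩
  refine step_eq rfl ((delta_conf ..).trans hd)
      rfl rfl ?_ (oracle_idle R) fun (k' : Option Reg) => ?_
  · simp only [act, goto, conf, OTape.wordAt, OTape.move, hl, Store.setInp]
    simp
  · refine (work_idle _ _ _ _ _).trans ?_
    exact conf_work_congr (fun k => by simp) k'

lemma steps_query (n : Option P.State) (o : OracleKind) (q : P.State) (pre : List InputSym)
    (ret : ℤ → Option (Alphabet P)) (R : Store) (hs : 1 ≤ s) (hR : R.Fits s)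
    (hpre : pre.length ≤ s) (hc : (Cmd.query o).Fits B s R)
    (ht : P.trans q R.top = (n, .query o)) :
    ∃ ret', Steps P B s (conf P (.main (some q)) pre ret R)
      (conf P (.main n) pre ret' (R.setOrc (ask B o R.orc))) := by
  have hd : delta P (.main (some q)) (OTape.wordAt (pre ++ R.inp) pre.length).read R.orc.head?
      (scanned P ret R) = act n R.orc.head? (scanned P ret R) (.query o) := by
    simp [delta, topOf_scanned, ht]
  set ret' : ℤ → Option (Alphabet P) := Function.update ret 0 (some (.inr n)) with hret
  set ans := B.answer (OTape.ofList R.orc.reverse).cells o with hans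
  have hask : ask B o R.orc = ans.reverse := rfl
  have hlen : ans.length ≤ s := by
    have : (ask B o R.orc).length ≤ s := hc
    simpa [hask] using this
  have hw := within_conf (P := P) (q := .main n) (ret := ret') hs hR hpre
  refine ⟨ret', ?_⟩
  let C (q : State P) (h : ℤ) : (machine P).Config :=
    { conf P q pre ret' R with oracle := OTape.wordAt ans h }
  have hC : ∀ (q : State P) (h : ℤ), |h| ≤ s → Within s (C q h) := fun q h hh => ⟨hw.1, hh, hw.2.2⟩
  have h1 : (machine P).step B (conf P (.main (some q)) pre ret R) = some (C (.query o) 0) := by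
    refine step_eq_query (o := o) rfl ((delta_conf ..).trans hd)
      rfl rfl (OTape.move_zero _) ?_ fun k => ?_
    · simp only [act, goto, conf]
      rw [oracle_idle]
      rfl
    · rcases k with _ | k
      · simp only [act, goto, C, conf, Function.update_self, hret]
        rfl
      · simp only [act, goto, C, Function.update_of_ne (Option.some_ne_none k)]
        exact work_idle _ _ _ _ _
  have h2 : (machine P).step B (C (.query o) 0) = some (C (.walk n) 0) := by
    refine step_eq (a := delta P (.query o) (C (.query o) 0).input.read
      (C (.query o) 0).oracle.read fun k => ((C (.query o) 0).work k).read)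
      rfl rfl rfl ?_ (OTape.move_zero _) (idle _) fun k => idle _
    have : ((C (.query o) 0).work none).read = some (.inr n) := by
      simp [C, conf, OTape.read, hret]
      rfl
    simp only [delta, goto, this]
    rfl
  have h3 : ∀ i : ℕ, i ≤ ans.length → Steps P B s (C (.walk n) 0) (C (.walk n) i) := by
    intro i
    induction i with
    | zero => exact fun _ => .refl
    | succ i ih =>
      intro hi
      refine (ih (by omega)).tail ⟨?_, hC _ _ (by rw [abs_le]; omega)⟩
      have hread : (C (.walk n) i).oracle.read ≠ none := by
        simp only [C, OTape.wordAt, OTape.read, OTape.cells_ofList_natCast]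
        simp; omega
      refine step_eq (a := { goto (.walk n) (C (.walk n) i).oracle.read
          (fun k => ((C (.walk n) i).work k).read) with oracleMove := 1 })
        rfl ?_ rfl rfl (OTape.move_zero _) ?_ fun k => idle _
      · change delta P (.walk n) (C (.walk n) i).input.read _ _ = _
        simp only [delta, if_neg hread]
        rfl
      · simp only [goto, OTape.write_read]
        simp [C, OTape.move, OTape.wordAt]
  have h4 : (machine P).step B (C (.walk n) ans.length) =
      some (conf P (.main n) pre ret' (R.setOrc (ask B o R.orc))) := by
    have hread : (C (.walk n) ans.length).oracle.read = none := OTape.read_wordAt_length _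
    refine step_eq (a := { goto (.main n) (C (.walk n) ans.length).oracle.read
        (fun k => ((C (.walk n) ans.length).work k).read) with oracleMove := -1 })
      rfl ?_ rfl rfl
      ((OTape.move_zero _).trans (conf_input_of_inp_eq (q := .main n) (q' := .main n) rfl)) ?_
        fun k => ?_
    · change delta P (.walk n) (C (.walk n) ans.length).input.read _ _ = _
      simp only [delta, if_pos hread]
      rfl
    · simp only [goto, OTape.write_read]
      simp [C, conf, OTape.move, OTape.wordAt, OTape.ofStack, hask, sub_eq_add_neg]
    · refine (idle _).trans ?_
      exact conf_work_congr (q := .main n) (pre := pre) (fun k => by simp) k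
  refine .tail (.trans (.tail (.single ⟨h1, hC _ _ (by simp)⟩) ⟨h2, hC _ _ (by simp)⟩)
    (h3 ans.length le_rfl)) ⟨h4, within_conf hs (hR.apply (c := .query o) hc) hpre⟩

/-- The machine simulates a step of the compiled program. -/
lemma steps_of_cmdStep {g : Option P.State → Top → Option P.State × Cmd}
    (hg : ∀ q t, g (some q) t = P.trans q t) {q : P.State} {n : Option P.State} {R R' : Store}
    (h : CmdStep B s g (some q, R) (n, R')) (hs : 1 ≤ s) {pre : List InputSym}
    (ret : ℤ → Option (Alphabet P)) (hR : R.Fits s) (hpre : (pre ++ R.inp).length ≤ s) :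
    ∃ pre' ret', pre' ++ R'.inp = pre ++ R.inp ∧ R'.Fits s ∧
      Steps P B s (conf P (.main (some q)) pre ret R) (conf P (.main n) pre' ret' R') := by
  obtain ⟨hc, h⟩ := h
  simp only [hg, Prod.mk.injEq] at hc h
  obtain ⟨hn, rfl⟩ := h
  have hpre' : pre.length ≤ s := by simp at hpre; omega
  obtain ⟨c, ht⟩ : ∃ c, P.trans q R.top = (n, c) := ⟨_, Prod.ext hn.symm rfl⟩
  rw [ht] at hc ⊢
  have hfit := hR.apply hc
  cases c with
  | nop =>
    refine ⟨pre, ret, rfl, hfit, .single ⟨?_, within_conf hs hR hpre'⟩⟩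
    refine step_goto rfl _ _ _ ?_ rfl
    simp [delta, topOf_scanned, ht, act]
  | push k a =>
    exact ⟨pre, ret, by simp [Cmd.apply], hfit, steps_push n k a q pre ret R hs hR hpre' hc ht⟩
  | pop k => exact ⟨pre, ret, by simp [Cmd.apply], hfit, steps_pop n k q pre ret R hs hR hpre' ht⟩
  | opush v => exact ⟨pre, ret, rfl, hfit, steps_opush n v q pre ret R hs hR hpre' hc ht⟩
  | opop => exact ⟨pre, ret, rfl, hfit, steps_opop n q pre ret R hs hR hpre' ht⟩
  | next =>
    rcases hl : R.inp with _ | ⟨a, l⟩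
    · exact absurd hl hc
    · have hR' : Cmd.apply B R .next = R.setInp l := by simp [Cmd.apply, hl]
      rw [hR'] at hfit ⊢
      refine ⟨pre ++ [a], ret, by simp [Store.setInp], hfit,
        steps_next n q pre ret R hs hR hl ?_ ht⟩
      simp [hl] at hpre ⊢; omega
  | query o =>
    obtain ⟨ret', h⟩ := steps_query n o q pre ret R hs hR hpre' hc ht
    exact ⟨pre, ret', rfl, hfit, h⟩

/-- The store in which the input is `w` and all stacks are empty. -/
def initStore (w : List InputSym) : Store where
  inp := w
  orc := []
  rest := []
  seen := []
  ruler := []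
  ruler' := []
  future := []
  play := []
  replay := []
  fMid := []
  fLeft := []
  fRight := []
  fWit := []
  fOpt := []
  fSide := []
  curA := []
  curB := []
  curU := []
  curV := []
  ntP := []
  ntQ := []
  ntR := []
  tmp := []
  status := []
  mode := []

lemma step_init (w : List InputSym) :
    (machine P).step B ((machine P).init w) =
      some (conf P (.main (some P.entry)) [] (fun _ => none) (initStore w)) := by
  have h : ∀ α : Type, OTape.ofList ([] : List α) = ⟨fun _ => none, 0⟩ := by
    intro α
    simp [OTape.ofList]
  have hr : ∀ α : Type, (OTape.ofList ([] : List α)).read = none := fun α => by simp [h, OTape.read]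
  refine step_eq (a := delta P .start ((machine P).init w).input.read
    ((machine P).init w).oracle.read fun k => (((machine P).init w).work k).read)
    rfl rfl rfl rfl ?_ ?_ fun k => ?_
  · exact OTape.move_zero _
  · refine (congrArg (OTape.move · _) (OTape.write_read _)).trans ?_
    rfl
  · refine (congrArg (OTape.move · _) (OTape.write_read _)).trans ?_
    rcases k with _ | k
    · refine (OTape.move_zero _).trans ?_
      exact h _
    · cases k <;> rfl

/-- A program whose execution on the input `w` ends with a verdict in the stack `mode` gives a
machine that accepts or rejects accordingly, in bounded space. -/
theorem machine_spec {w : List InputSym} {R : Store} (hs : 1 ≤ s) (hw : w.length ≤ s)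
    (h : Exec B s P (initStore w) R) {v : Bool} {l : List Sym} (hv : R.mode = .up v :: l) :
    (v = true → (machine P).Accepts B w) ∧ (v = false → (machine P).Rejects B w) ∧
      (machine P).RunsInSpace B w s := by
  let g : Option P.State → Top → Option P.State × Cmd :=
    fun q t => q.elim (none, .nop) (P.trans · t)
  have h1 := h.cmdSteps g some none (fun x t => by
    change P.trans x t = _
    rcases P.trans x t with ⟨_ | _, _⟩ <;> rfl)
  have hfit : (initStore w).Fits s := ⟨fun k => by cases k <;> simp [initStore, Store.get], by
    simp [initStore]⟩
  -- At the exit state the abstract machine only idles, so the path may be cut at its first visit.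
  have key : ∀ x y : Option P.State × Store, Relation.ReflTransGen (CmdStep B s g) x y →
      y = (none, R) → ∀ pre ret, x.2.Fits s → (pre ++ x.2.inp).length ≤ s →
      ∃ pre' ret', R.Fits s ∧ pre'.length ≤ s ∧
        Steps P B s (conf P (.main x.1) pre ret x.2) (conf P (.main none) pre' ret' R) := by
    intro x y hxy hy
    induction hxy using Relation.ReflTransGen.head_induction_on with
    | refl =>
      subst hy
      intro pre ret hx hp
      exact ⟨pre, ret, hx, by simp at hp; omega, .refl⟩
    | @head x z hxz _ ih =>
      intro pre ret hx hp
      obtain ⟨q, R₁⟩ := x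
      obtain ⟨n, R₂⟩ := z
      cases q with
      | none =>
        obtain ⟨-, hz⟩ := hxz
        have : ((n, R₂) : Option P.State × Store) = (none, R₁) := hz
        simp only [Prod.mk.injEq] at this
        obtain ⟨rfl, rfl⟩ := this
        exact ih pre ret hx hp
      | some q =>
        obtain ⟨pre', ret', h1, h2, h3⟩ := steps_of_cmdStep (fun _ _ => rfl) hxz hs ret hx hp
        obtain ⟨pre'', ret'', h4, h5, h6⟩ := ih pre' ret' h2 (by rw [h1]; exact hp)
        exact ⟨pre'', ret'', h4, h5, h3.trans h6⟩
  obtain ⟨pre, ret, hR, hpre, h2⟩ := key _ _ h1 rfl [] (fun _ => none) hfit (by simpa [initStore])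
  set q : State P := if v then .accept else .reject with hq
  have h3 : (machine P).step B (conf P (.main none) pre ret R) = some (conf P q pre ret R) := by
    refine step_goto rfl _ _ _ ?_ (by cases v <;> rfl)
    have : R.top.stk .mode = some (.up v) := by simp [Store.top, Store.get, hv]
    simp only [delta, topOf_scanned, this]
    cases v <;> rfl
  have h4 : (machine P).step B (conf P q pre ret R) = none := by
    rw [BlackBoxTM.step, if_pos]
    cases v
    · exact .inr rfl
    · exact .inl rfl
  have h5 : Steps P B s ((machine P).init w) (conf P q pre ret R) :=
    .tail (.head ⟨step_init w, within_conf hs hfit (by simp)⟩ h2) ⟨h3, within_conf hs hR hpre⟩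
  refine ⟨?_, ?_, ?_⟩
  · rintro rfl
    exact ⟨_, reaches_of_reflTransGen h5, rfl⟩
  · rintro rfl
    exact ⟨_, reaches_of_reflTransGen h5, rfl⟩
  · intro C hC
    exact within_of_reflTransGen h5
      ⟨by simp [BlackBoxTM.init, OTape.ofList], by simp [BlackBoxTM.init, OTape.ofList],
        fun k => by simp [BlackBoxTM.init, OTape.ofList]⟩ h4 hC

end Compile
end StackProgram

/-! ### Products in finite groups -/

namespace ContextFreeSubset

/-- Every product of a nonempty list in a finite monoid is the product of a short nonempty list. -/
lemma exists_short_list_prod_eq {P : Type*} [Monoid P] [Finite P] (l : List P) (hl : l ≠ []) :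
    ∃ l' : List P, l' ≠ [] ∧ l' ⊆ l ∧ l'.prod = l.prod ∧ l'.length ≤ Nat.card P := by
  induction h : l.length using Nat.strong_induction_on generalizing l with
  | _ n ih =>
    subst h
    by_cases hle : l.length ≤ Nat.card P
    · exact ⟨l, hl, fun _ h => h, rfl, hle⟩
    · -- Two prefixes have the same product, and the part between them can be cut out.
      have hcard : Nat.card P < Nat.card (Fin l.length) := by simp; omega
      have := Fintype.ofFinite P
      have hninj : ¬ Function.Injective fun i : Fin l.length => (l.take (i + 1)).prod := by
        intro hinj
        have := Nat.card_le_card_of_injective _ hinj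
        omega
      obtain ⟨i, j, hij, hlt⟩ : ∃ i j : Fin l.length,
          (l.take (i + 1)).prod = (l.take (j + 1)).prod ∧ i < j := by
        simp only [Function.Injective, not_forall] at hninj
        obtain ⟨i, j, h, hne⟩ := hninj
        rcases lt_or_gt_of_ne hne with h' | h'
        · exact ⟨i, j, h, h'⟩
        · exact ⟨j, i, h.symm, h'⟩
      have hlt' : (i : ℕ) < j := hlt
      have hj := j.isLt
      obtain ⟨l', h1, h2, h3, h4⟩ := ih (l.take (i + 1) ++ l.drop (j + 1)).length
        (by simp; omega) (l.take (i + 1) ++ l.drop (j + 1))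
        (by intro h0; have := congrArg List.length h0; simp at this) rfl
      refine ⟨l', h1, fun x hx => ?_, ?_, h4⟩
      · rcases List.mem_append.1 (h2 hx) with h | h
        · exact List.mem_of_mem_take h
        · exact List.mem_of_mem_drop h
      · rw [h3, List.prod_append, hij, ← List.prod_append, List.take_append_drop]

/-- An increasing chain of subgroups of a finite group with at most `2 ^ m` elements stops growing
for the first time after at most `m` steps. -/
lemma exists_subgroup_eq_succ {P : Type*} [Group P] [Finite P] {m : ℕ} (hm : Nat.card P ≤ 2 ^ m)
    (H : ℕ → Subgroup P) (hH : Monotone H) : ∃ j ≤ m, H j = H (j + 1) := by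
  by_contra! hne
  have hcard : ∀ j ≤ m + 1, 2 ^ j ≤ Nat.card (H j) := by
    intro j
    induction j with
    | zero => exact fun _ => Nat.card_pos (α := H 0)
    | succ j ih =>
      intro hj
      have hlt : H j < H (j + 1) := lt_of_le_of_ne (hH (Nat.le_succ j)) (hne j (by omega))
      obtain ⟨c, hc⟩ := Subgroup.card_dvd_of_le hlt.le
      have hpos : 0 < Nat.card (H (j + 1)) := Nat.card_pos
      have hc2 : 2 ≤ c := by
        rcases c with _ | _ | c
        · simp [hc] at hpos
        · refine absurd (Subgroup.eq_of_le_of_card_ge hlt.le ?_) hlt.ne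
          simp [hc]
        · omega
      calc 2 ^ (j + 1) = 2 ^ j * 2 := pow_succ ..
        _ ≤ Nat.card (H j) * c := Nat.mul_le_mul (ih (by omega)) hc2
        _ = _ := hc.symm
  have h1 := hcard (m + 1) le_rfl
  have h2 := Nat.card_le_card_of_injective (H (m + 1)).subtype Subtype.val_injective
  have h3 : 2 ^ m < 2 ^ (m + 1) := Nat.pow_lt_pow_right (by norm_num) (by omega)
  omega

/-! ### Short proofs of derivability -/

variable {G : Type*} [Group G]

/-- `Yields rules A g`: the nonterminal `A` generates a word with value `g`. -/
inductive Yields (rules : List (CNFRule G)) : List Bool → G → Prop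
  | single {A g} : CNFRule.single A g ∈ rules → Yields rules A g
  | pair {A B C g h} : CNFRule.pair A B C ∈ rules → Yields rules B g → Yields rules C h →
      Yields rules A (g * h)

/-- A proof system for two kinds of facts. `Proof rules d A (some B) (u, v)` implies that `A`
derives a sentential form `x B y` with terminal words `x`, `y` of values `u` and `v⁻¹`, and
`Proof rules d A none (u, v)` implies that `A` generates a word with value `u * v⁻¹`. With the
value of `y` inverted, composition of derivations is multiplication in `G × G`. The number `d`
bounds the height of the proof. -/
inductive Proof (rules : List (CNFRule G)) : ℕ → List Bool → Option (List Bool) → G × G → Prop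
  | single {d A g u v} : CNFRule.single A g ∈ rules → u = g * v → Proof rules (d + 1) A none (u, v)
  | left {d A B C u} : CNFRule.pair A C B ∈ rules → Proof rules d C none (u, 1) →
      Proof rules (d + 1) A (some B) (u, 1)
  | right {d A B C v} : CNFRule.pair A B C ∈ rules → Proof rules d C none (1, v) →
      Proof rules (d + 1) A (some B) (1, v)
  | trans {d A M B p q} : Proof rules d A (some M) p → Proof rules d M B q →
      Proof rules (d + 1) A B (p * q)

namespace Proof

variable {rules : List (CNFRule G)} {d e : ℕ} {A B C : List Bool} {X : Option (List Bool)}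
  {p q : G × G}

lemma succ (h : Proof rules d A X p) : Proof rules (d + 1) A X p := by
  induction h with
  | single h h' => exact single h h'
  | left h _ ih => exact left h ih
  | right h _ ih => exact right h ih
  | trans _ _ ih₁ ih₂ => exact trans ih₁ ih₂

lemma mono (h : Proof rules d A X p) (hde : d ≤ e) : Proof rules e A X p := by
  induction hde with
  | refl => exact h
  | step _ ih => exact ih.succ

/-- A fact about a complete derivation depends on `u * v⁻¹` only. -/
lemma mul_diag (h : Proof rules d A none p) (k : G) : Proof rules d A none (p * (k, k)) := by
  generalize hX : (none : Option (List Bool)) = X at h ⊢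
  induction h with
  | single h h' => subst h'; exact single h (mul_assoc ..)
  | left | right => cases hX
  | trans h₁ _ _ ih₂ =>
    rw [mul_assoc]
    exact trans h₁ (ih₂ hX)

lemma none_congr {u v u' v' : G} (h : Proof rules d A none (u, v)) (e : u * v⁻¹ = u' * v'⁻¹) :
    Proof rules d A none (u', v') := by
  have := h.mul_diag (v⁻¹ * v')
  have h1 : u * (v⁻¹ * v') = u' := by rw [← mul_assoc, e]; group
  simpa [h1] using this

/-- Facts that hold before or after a derivation from `A`, in terms of `Yields`. -/
def Valid (rules : List (CNFRule G)) (A : List Bool) (X : Option (List Bool)) (p : G × G) : Prop :=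
  X.elim (Yields rules A (p.1 * p.2⁻¹))
    fun B => ∀ g, Yields rules B g → Yields rules A (p.1 * g * p.2⁻¹)

theorem valid (h : Proof rules d A X p) : Valid rules A X p := by
  induction h with
  | single h h' =>
    subst h'
    simpa [Valid] using Yields.single h
  | left h _ ih =>
    intro g hg
    simp only [Valid, Option.elim, inv_one, mul_one] at ih ⊢
    exact .pair h ih hg
  | right h _ ih =>
    intro g hg
    simp only [Valid, Option.elim, one_mul] at ih ⊢
    exact .pair h hg ih
  | @trans d A M B p q _ _ ih₁ ih₂ =>
    cases B with
    | none =>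
      have := ih₁ _ ih₂
      simpa [Valid, mul_assoc] using this
    | some B =>
      intro g hg
      have := ih₁ _ (ih₂ g hg)
      simpa [mul_assoc] using this

/-- A product of facts from `A` to `A` has a proof whose height is logarithmic in the number of
factors. -/
lemma list_prod {k : ℕ} (l : List (G × G)) (hl : l ≠ []) (hk : l.length ≤ 2 ^ k)
    (h : ∀ p ∈ l, Proof rules d A (some A) p) : Proof rules (d + k) A (some A) l.prod := by
  induction k generalizing l with
  | zero =>
    obtain ⟨p, rfl⟩ : ∃ p, l = [p] := List.length_eq_one_iff.1 (by
      have := List.length_pos_iff.2 hl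
      simp at hk; omega)
    simpa using h p (by simp)
  | succ k ih =>
    by_cases h2 : l.length ≤ 2 ^ k
    · exact (ih l hl h2 h).succ
    · rw [← List.take_append_drop (2 ^ k) l, List.prod_append]
      have : 1 ≤ 2 ^ k := Nat.one_le_two_pow
      rw [Nat.add_succ]
      refine trans (ih _ ?_ (by simp) fun p hp => h p (List.mem_of_mem_take hp))
        (ih _ ?_ ?_ fun p hp => h p (List.mem_of_mem_drop hp))
      · intro h0
        rcases List.take_eq_nil_iff.1 h0 with h | h
        · omega
        · exact hl h
      · intro h0
        have := congrArg List.length h0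
        simp at this; omega
      · simp [pow_succ] at hk ⊢; omega

lemma list_prod_of_card [Finite G] {L : ℕ} (hL : Nat.card (G × G) ≤ 2 ^ L) (l : List (G × G))
    (hl : l ≠ []) (h : ∀ p ∈ l, Proof rules d A (some A) p) :
    Proof rules (d + L) A (some A) l.prod := by
  obtain ⟨l', h1, h2, h3, h4⟩ := exists_short_list_prod_eq l hl
  rw [← h3]
  exact list_prod l' h1 (h4.trans hL) fun p hp => h p (h2 hp)

end Proof

/-- `Walk S Y A B p`: there is a nonempty walk from `A` to `B` along steps `S`, such that all its
vertices but the last one are in `Y`, and `p` is the product of the labels. -/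
inductive Walk (S : List Bool → List Bool → G × G → Prop) (Y : Finset (List Bool)) :
    List Bool → List Bool → G × G → Prop
  | step {A B p} : A ∈ Y → S A B p → Walk S Y A B p
  | cons {A M B p q} : A ∈ Y → S A M p → Walk S Y M B q → Walk S Y A B (p * q)

namespace Walk

variable {S : List Bool → List Bool → G × G → Prop} {Y : Finset (List Bool)} {A B M : List Bool}
  {p q : G × G}

lemma mem (h : Walk S Y A B p) : A ∈ Y := by cases h <;> assumption

/-- A walk from `A` that does not return to `A`, except possibly at its end. -/
def Excursion (S : List Bool → List Bool → G × G → Prop) (Y : Finset (List Bool))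
    (A B : List Bool) (p : G × G) : Prop :=
  S A B p ∨ ∃ M p₁ p₂, S A M p₁ ∧ Walk S (Y.erase A) M B p₂ ∧ p = p₁ * p₂

/-- Decomposition of a walk at the visits to `A`, for walks that start in `A` or elsewhere. -/
lemma exists_excursions (h : Walk S Y M B p) (A : List Bool) :
    (M = A → ∃ (l : List (G × G)) (q : G × G), (∀ r ∈ l, Excursion S Y A A r) ∧
      Excursion S Y A B q ∧ p = l.prod * q) ∧
    (M ≠ A → Walk S (Y.erase A) M B p ∨
      ∃ (p₀ : G × G) (l : List (G × G)) (q : G × G), Walk S (Y.erase A) M A p₀ ∧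
        (∀ r ∈ l, Excursion S Y A A r) ∧
        Excursion S Y A B q ∧ p = p₀ * (l.prod * q)) := by
  induction h with
  | @step M B p hM hS =>
    refine ⟨?_, fun hne => .inl (step (Finset.mem_erase.2 ⟨hne, hM⟩) hS)⟩
    rintro rfl
    exact ⟨[], p, by simp, .inl hS, by simp⟩
  | @cons M M' B p q hM hS _ ih =>
    by_cases hM' : M' = A
    · obtain ⟨l, r, h1, h2, rfl⟩ := ih.1 hM'
      subst hM'
      refine ⟨?_, fun hne => .inr ⟨p, l, r, step (Finset.mem_erase.2 ⟨hne, hM⟩) hS, h1, h2, rfl⟩⟩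
      rintro rfl
      exact ⟨p :: l, r, List.forall_mem_cons.2 ⟨.inl hS, h1⟩, h2, by simp [mul_assoc]⟩
    · refine ⟨?_, fun hne => ?_⟩
      · rintro rfl
        rcases ih.2 hM' with h | ⟨p₀, l, r, h0, h1, h2, rfl⟩
        · exact ⟨[], p * q, by simp, .inr ⟨M', p, q, hS, h, rfl⟩, by simp⟩
        · exact ⟨(p * p₀) :: l, r, List.forall_mem_cons.2 ⟨.inr ⟨M', p, p₀, hS, h0, rfl⟩, h1⟩, h2,
            by simp [mul_assoc]⟩
      · have hmem := Finset.mem_erase.2 ⟨hne, hM⟩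
        rcases ih.2 hM' with h | ⟨p₀, l, r, h0, h1, h2, rfl⟩
        · exact .inl (cons hmem hS h)
        · exact .inr ⟨p * p₀, l, r, cons hmem hS h0, h1, h2, by simp [mul_assoc]⟩

/-- Walks along provable steps, however long, have proofs that are higher than those of the steps
by a polynomial only: allow one vertex after the other, and use that a product of arbitrarily many
loops at the new vertex is a short product of such loops. -/
theorem proof [Finite G] {rules : List (CNFRule G)} {L d : ℕ} (hL : Nat.card (G × G) ≤ 2 ^ L)
    (hS : ∀ A B p, S A B p → Proof rules d A (some B) p) (h : Walk S Y A B p) :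
    Proof rules (d + Y.card * (L + 2)) A (some B) p := by
  induction hn : Y.card generalizing Y A B p with
  | zero => simp [Finset.card_eq_zero.1 hn] at h; exact absurd h.mem (by simp)
  | succ n ih =>
    have hA := h.mem
    have hn' : (Y.erase A).card = n := by rw [Finset.card_erase_of_mem hA, hn]; rfl
    have hexc : ∀ B p, Excursion S Y A B p →
        Proof rules (d + n * (L + 2) + 1) A (some B) p := by
      rintro B p (h | ⟨M, p₁, p₂, h₁, h₂, rfl⟩)
      · exact (hS _ _ _ h).mono (by omega)
      · exact .trans ((hS _ _ _ h₁).mono (by omega)) (ih h₂ hn')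
    obtain ⟨l, q, h1, h2, rfl⟩ := (h.exists_excursions A).1 rfl
    have hle : d + n * (L + 2) + 1 + L + 1 ≤ d + (n + 1) * (L + 2) := by
      rw [Nat.succ_mul]; omega
    by_cases hl : l = []
    · subst hl
      simpa using (hexc B q h2).mono (by omega)
    · exact (Proof.trans (Proof.list_prod_of_card hL l hl fun r hr => hexc A r (h1 r hr))
        ((hexc B q h2).mono (by omega))).mono hle

end Walk
end ContextFreeSubset

namespace ContextFreeSubset

/-- The nonterminals that have a production. -/
def producers {T : Type*} (rules : List (CNFRule T)) : Finset (List Bool) :=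
  (rules.map fun
    | .pair A _ _ => A
    | .single A _ => A).toFinset

lemma card_producers_le {T : Type*} (rules : List (CNFRule T)) :
    (producers rules).card ≤ rules.length :=
  (List.toFinset_card_le _).trans (by simp)

variable {G : Type*} [Group G]

/-- `Tree rules X n A g`: there is a derivation tree of height at most `n` with root `A` and
value `g`, all of whose nonterminals belong to `X`. -/
inductive Tree (rules : List (CNFRule G)) (X : Finset (List Bool)) : ℕ → List Bool → G → Prop
  | single {n A g} : A ∈ X → CNFRule.single A g ∈ rules → Tree rules X (n + 1) A g
  | pair {n A B C g h} : A ∈ X → CNFRule.pair A B C ∈ rules → Tree rules X n B g →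
      Tree rules X n C h → Tree rules X (n + 1) A (g * h)

namespace Tree

variable {rules : List (CNFRule G)} {X : Finset (List Bool)} {n m : ℕ} {A M : List Bool} {g : G}

lemma mono (h : Tree rules X n A g) (hnm : n ≤ m) : Tree rules X m A g := by
  induction h generalizing m with
  | single hA h =>
    obtain ⟨k, rfl⟩ := Nat.exists_eq_add_of_le' hnm
    exact single hA h
  | @pair n _ _ _ _ _ hA h _ _ ih₁ ih₂ =>
    obtain ⟨k, rfl⟩ := Nat.exists_eq_add_of_le' hnm
    exact pair hA h (ih₁ (m := k + n) (by omega)) (ih₂ (m := k + n) (by omega))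

lemma mem (h : Tree rules X n A g) : A ∈ X := by cases h <;> assumption

/-- The steps of a path in a derivation tree: the subtree beside the path has a value in `D`. -/
def SideStep (rules : List (CNFRule G)) (D : List Bool → G → Prop) (A B : List Bool)
    (p : G × G) : Prop :=
  (∃ C g, CNFRule.pair A C B ∈ rules ∧ D C g ∧ p = (g, 1)) ∨
    ∃ C g, CNFRule.pair A B C ∈ rules ∧ D C g ∧ p = (1, g⁻¹)

/-- `A` is the root of a tree that does not contain `A` elsewhere. -/
def AtRootOnly (rules : List (CNFRule G)) (X : Finset (List Bool)) (n : ℕ) (A : List Bool)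
    (g : G) : Prop :=
  CNFRule.single A g ∈ rules ∨ ∃ B C g₁ g₂, CNFRule.pair A B C ∈ rules ∧
    Tree rules (X.erase A) n B g₁ ∧ Tree rules (X.erase A) n C g₂ ∧ g = g₁ * g₂

/-- A tree avoids `A`, or there is a path from its root to a lowest occurrence of `A`. -/
lemma exists_lowest (h : Tree rules X n M g) (A : List Bool) :
    Tree rules (X.erase A) n M g ∨ ∃ p g', (p = 1 ∧ M = A ∨
      Walk (SideStep rules fun C h => ∃ k < n, Tree rules X k C h) X M A p) ∧
      (∃ k < n, AtRootOnly rules X k A g') ∧ g = p.1 * g' * p.2⁻¹ := by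
  induction h with
  | @single n M g hM h =>
    by_cases hA : M = A
    · subst hA
      exact .inr ⟨1, g, .inl ⟨rfl, rfl⟩, ⟨n, by omega, .inl h⟩, by simp⟩
    · exact .inl (single (Finset.mem_erase.2 ⟨hA, hM⟩) h)
  | @pair n M B C g h hM hr hB hC ih₁ ih₂ =>
    have hmono : ∀ {M A p}, Walk (SideStep rules fun C h => ∃ k < n, Tree rules X k C h) X M A p →
        Walk (SideStep rules fun C h => ∃ k < n + 1, Tree rules X k C h) X M A p := by
      have hs : ∀ {M A p}, SideStep rules (fun C h => ∃ k < n, Tree rules X k C h) M A p →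
          SideStep rules (fun C h => ∃ k < n + 1, Tree rules X k C h) M A p := by
        rintro M A p (⟨C, g, h1, ⟨k, hk, h2⟩, h3⟩ | ⟨C, g, h1, ⟨k, hk, h2⟩, h3⟩)
        · exact .inl ⟨C, g, h1, ⟨k, by omega, h2⟩, h3⟩
        · exact .inr ⟨C, g, h1, ⟨k, by omega, h2⟩, h3⟩
      intro M A p hw
      induction hw with
      | step h1 h2 => exact .step h1 (hs h2)
      | cons h1 h2 _ ih => exact .cons h1 (hs h2) ih
    -- Prolong a path from a child of the root to `A`.
    have hext : ∀ {B p p'}, SideStep rules (fun C h => ∃ k < n + 1, Tree rules X k C h) M B p →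
        (p' = 1 ∧ B = A ∨ Walk (SideStep rules fun C h => ∃ k < n, Tree rules X k C h) X B A p') →
        Walk (SideStep rules fun C h => ∃ k < n + 1, Tree rules X k C h) X M A (p * p') := by
      rintro B p p' hs (⟨rfl, rfl⟩ | hw)
      · rw [mul_one]; exact .step hM hs
      · exact .cons hM hs (hmono hw)
    rcases ih₁ with hB' | ⟨p, g', hp, ⟨k, hk, hlow⟩, rfl⟩
    · rcases ih₂ with hC' | ⟨p, g', hp, ⟨k, hk, hlow⟩, rfl⟩
      · by_cases hA : M = A
        · subst hA
          exact .inr ⟨1, g * h, .inl ⟨rfl, rfl⟩,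
            ⟨n, by omega, .inr ⟨B, C, g, h, hr, hB', hC', rfl⟩⟩, by simp⟩
        · exact .inl (pair (Finset.mem_erase.2 ⟨hA, hM⟩) hr hB' hC')
      · refine .inr ⟨(g, 1) * p, g', .inr (hext (.inl ⟨B, g, hr, ⟨n, by omega, hB⟩, rfl⟩) hp),
          ⟨k, by omega, hlow⟩, ?_⟩
        simp [mul_assoc]
    · refine .inr ⟨(1, h⁻¹) * p, g', .inr (hext (.inr ⟨C, h, hr, ⟨n, by omega, hC⟩, rfl⟩) hp),
        ⟨k, by omega, hlow⟩, ?_⟩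
      simp [mul_assoc]

lemma SideStep.proof {D : List Bool → G → Prop} {d : ℕ}
    (hD : ∀ C g, D C g → Proof rules d C none (g, 1)) {B : List Bool} {p : G × G}
    (h : SideStep rules D A B p) : Proof rules (d + 1) A (some B) p := by
  rcases h with ⟨C, g, h1, h2, rfl⟩ | ⟨C, g, h1, h2, rfl⟩
  · exact .left h1 (hD C g h2)
  · exact .right h1 ((hD C g h2).none_congr (by simp))

lemma AtRootOnly.proof {d : ℕ} (h : AtRootOnly rules X n A g)
    (hX : ∀ C g, Tree rules (X.erase A) n C g → Proof rules d C none (g, 1)) :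
    Proof rules (d + 2) A none (g, 1) := by
  rcases h with h | ⟨B, C, g₁, g₂, h, h₁, h₂, rfl⟩
  · exact .single h (by simp)
  · have := Proof.trans (Proof.left h (hX B g₁ h₁)) ((hX C g₂ h₂).mono (Nat.le_succ _))
    simpa using this

end Tree

/-- The group that is generated by the facts from `A` to `A` with proofs of height at most `d`. -/
def loops (rules : List (CNFRule G)) (d : ℕ) (A : List Bool) : Subgroup (G × G) :=
  Subgroup.closure {p | Proof rules d A (some A) p}

variable {rules : List (CNFRule G)} {L : ℕ}

lemma loops_mono {d e : ℕ} (h : d ≤ e) (A : List Bool) : loops rules d A ≤ loops rules e A :=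
  Subgroup.closure_mono fun _ hp => hp.mono h

lemma proof_of_mem_loops [Finite G] (hL : Nat.card (G × G) ≤ 2 ^ L) {d : ℕ} {A : List Bool}
    {p : G × G} (hp : p ∈ loops rules d A) : p = 1 ∨ Proof rules (d + L) A (some A) p := by
  rw [loops, ← Subgroup.mem_toSubmonoid, Subgroup.closure_toSubmonoid_of_finite] at hp
  obtain ⟨l, hl, rfl⟩ := Submonoid.exists_list_of_mem_closure hp
  by_cases h : l = []
  · exact .inl (by simp [h])
  · exact .inr (Proof.list_prod_of_card hL l h hl)

/-- If the loop groups are the same for proofs of two sufficiently different heights, then all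
derivation trees have proofs of a height between them. In a tree with root `A`, the path to a lowest
occurrence of `A` can be replaced by a product of few loops, and the subtrees below it avoid `A`. -/
theorem Tree.proof_of_loops_eq [Finite G] (hL : Nat.card (G × G) ≤ 2 ^ L) {N : Finset (List Bool)}
    {d : ℕ} (hd : ∀ A ∈ N, loops rules (d + (2 * N.card + 1) * (L + 3)) A = loops rules d A) {n : ℕ}
    {X : Finset (List Bool)} (hX : X ⊆ N) {A : List Bool} {g : G} (h : Tree rules X n A g) :
    Proof rules (d + X.card * (L + 3)) A none (g, 1) := by
  induction n using Nat.strong_induction_on generalizing X A g with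
  | _ n ih =>
    have hA := h.mem
    have hcard : X.card = (X.erase A).card + 1 := by
      rw [Finset.card_erase_of_mem hA]
      have := Finset.card_pos.2 ⟨A, hA⟩
      omega
    have hle : X.card ≤ N.card := Finset.card_le_card hX
    rcases h.exists_lowest A with h | ⟨p, g', hp, ⟨k, hk, hlow⟩, rfl⟩
    · exact absurd h.mem (by simp)
    · have h1 : Proof rules (d + (X.erase A).card * (L + 3) + 2) A none (g', 1) :=
        hlow.proof fun C g hC => ih k hk ((Finset.erase_subset _ _).trans hX) hC
      have h2 : p = 1 ∨ Proof rules (d + L) A (some A) p := by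
        rcases hp with ⟨rfl, -⟩ | hw
        · exact .inl rfl
        · apply proof_of_mem_loops hL
          rw [← hd A (hX hA)]
          have h3 := hw.proof hL (d := d + X.card * (L + 3) + 1) fun A B p hs =>
            hs.proof fun C g ⟨k, hk, hC⟩ => ih k hk hX hC
          refine Subgroup.subset_closure (h3.mono ?_)
          have h4 : X.card * (L + 3) ≤ N.card * (L + 3) := Nat.mul_le_mul_right _ hle
          have h5 : X.card * (L + 2) ≤ N.card * (L + 3) := Nat.mul_le_mul hle (by omega)
          have h6 : (2 * N.card + 1) * (L + 3) = N.card * (L + 3) + N.card * (L + 3) + (L + 3) := by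
            ring
          omega
      have h7 : X.card * (L + 3) = (X.erase A).card * (L + 3) + (L + 3) := by
        rw [hcard, Nat.succ_mul]
      rcases h2 with rfl | h2
      · simpa using h1.mono (by omega)
      · have h8 := Proof.trans (h2.mono (e := d + (X.erase A).card * (L + 3) + L + 2) (by omega))
          (h1.mono (by omega))
        exact (h8.mono (by omega)).none_congr (by simp)

lemma Yields.exists_tree {A : List Bool} {g : G} (h : Yields rules A g) :
    ∃ n, Tree rules (producers rules) n A g := by
  induction h with
  | @single A g h =>
    exact ⟨1, .single (List.mem_toFinset.2 (List.mem_map.2 ⟨_, h, rfl⟩)) h⟩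
  | pair h _ _ ih₁ ih₂ =>
    obtain ⟨n, h₁⟩ := ih₁
    obtain ⟨m, h₂⟩ := ih₂
    exact ⟨max n m + 1, .pair (List.mem_toFinset.2 (List.mem_map.2 ⟨_, h, rfl⟩)) h
      (h₁.mono (le_max_left _ _)) (h₂.mono (le_max_right _ _))⟩

/-- Everything that a grammar generates has a proof of polynomial height, since the loop groups
can grow only polynomially often. -/
theorem Yields.proof [Finite G] (hL : Nat.card (G × G) ≤ 2 ^ L) {A : List Bool} {g : G}
    (h : Yields rules A g) {k : ℕ} (hk : (producers rules).card ≤ k) :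
    Proof rules ((k * L + 1) * ((2 * k + 1) * (L + 3))) A none (g, 1) := by
  set N := producers rules
  set Δ := (2 * N.card + 1) * (L + 3) with hΔ
  -- The product of the loop groups is considered, so that all of them are constant at once.
  let H : ℕ → Subgroup (N → G × G) := fun j =>
    Subgroup.pi Set.univ fun A => loops rules (j * Δ) A
  have hH : Monotone H := fun i j hij p hp A hA =>
    loops_mono (Nat.mul_le_mul_right _ hij) _ (hp A hA)
  have hcard : Nat.card (N → G × G) ≤ 2 ^ (N.card * L) := by
    rw [Nat.card_fun, Nat.card_eq_fintype_card (α := N), Fintype.card_coe, mul_comm, pow_mul]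
    exact Nat.pow_le_pow_left hL _
  obtain ⟨j, hj, hjH⟩ := exists_subgroup_eq_succ hcard H hH
  have hloops : ∀ A ∈ N, loops rules (j * Δ + Δ) A = loops rules (j * Δ) A := by
    intro A hA
    refine le_antisymm (fun p hp => ?_) (loops_mono (Nat.le_add_right _ _) A)
    have h1 : Pi.mulSingle (⟨A, hA⟩ : N) p ∈ H (j + 1) := by
      refine (Subgroup.mulSingle_mem_pi (f := fun _ : N => G × G) _ p).2 fun _ => ?_
      simpa [Nat.succ_mul] using hp
    rw [← hjH] at h1
    simpa using h1 ⟨A, hA⟩ (Set.mem_univ _)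
  obtain ⟨n, hn⟩ := h.exists_tree
  refine (hn.proof_of_loops_eq hL hloops subset_rfl).mono ?_
  have h1 : N.card * (L + 3) ≤ Δ := Nat.mul_le_mul_right _ (by omega)
  calc j * Δ + N.card * (L + 3) ≤ N.card * L * Δ + Δ :=
        Nat.add_le_add (Nat.mul_le_mul_right _ hj) h1
    _ = (N.card * L + 1) * Δ := by ring
    _ ≤ _ := by
      rw [hΔ]
      gcongr

/-! ### Generated words and their values -/

/-- The sentential form `s` derives a word with value `g`, in terms of `Yields`. -/
inductive FormYields (rules : List (CNFRule G)) : List (Symbol G (List Bool)) → G → Prop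
  | nil : FormYields rules [] 1
  | terminal {a s g} : FormYields rules s g → FormYields rules (.terminal a :: s) (a * g)
  | nonterminal {A s g h} : Yields rules A g → FormYields rules s h →
      FormYields rules (.nonterminal A :: s) (g * h)

lemma FormYields.append {s t : List (Symbol G (List Bool))} {g h : G} (hs : FormYields rules s g)
    (ht : FormYields rules t h) : FormYields rules (s ++ t) (g * h) := by
  induction hs with
  | nil => simpa
  | terminal _ ih => rw [mul_assoc]; exact .terminal ih
  | nonterminal hA _ ih => rw [mul_assoc]; exact .nonterminal hA ih

lemma FormYields.of_append {s t : List (Symbol G (List Bool))} {g : G}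
    (h : FormYields rules (s ++ t) g) :
    ∃ g₁ g₂, FormYields rules s g₁ ∧ FormYields rules t g₂ ∧ g = g₁ * g₂ := by
  induction s generalizing g with
  | nil => exact ⟨1, g, .nil, h, by simp⟩
  | cons x s ih =>
    cases h with
    | terminal h =>
      obtain ⟨g₁, g₂, h₁, h₂, rfl⟩ := ih h
      exact ⟨_, g₂, .terminal h₁, h₂, by simp [mul_assoc]⟩
    | nonterminal hA h =>
      obtain ⟨g₁, g₂, h₁, h₂, rfl⟩ := ih h
      exact ⟨_, g₂, .nonterminal hA h₁, h₂, by simp [mul_assoc]⟩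

lemma formYields_terminal (w : List G) : FormYields rules (w.map .terminal) w.prod := by
  induction w with
  | nil => exact .nil
  | cons a w ih => simpa using .terminal ih

lemma formYields_nonterminal_iff {A : List Bool} {g : G} :
    FormYields rules [.nonterminal A] g ↔ Yields rules A g := by
  constructor
  · intro h
    cases h with
    | nonterminal hA h =>
      cases h
      simpa using hA
  · intro h
    simpa using FormYields.nonterminal h .nil

lemma yields_of_toRule {r : CNFRule G} (hr : r ∈ rules) {g : G}
    (h : FormYields rules r.toRule.output g) : Yields rules r.toRule.input g := by
  cases r with
  | pair A B C =>
    obtain ⟨g₁, g₂, h₁, h₂, rfl⟩ := FormYields.of_append (s := [.nonterminal B]) h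
    exact .pair hr (formYields_nonterminal_iff.1 h₁) (formYields_nonterminal_iff.1 h₂)
  | single A a =>
    cases h with
    | terminal h =>
      cases h
      rw [mul_one]
      exact Yields.single hr

/-- An instance is positive if and only if its start symbol generates the value of the target. -/
theorem isPositive_iff_yields (I : CFInstance G) :
    I.IsPositive ↔ Yields I.rules I.start I.target.prod := by
  have hmem : ∀ r, r ∈ I.grammar.rules ↔ ∃ r' ∈ I.rules, r'.toRule = r := by
    exact fun r => (@List.mem_toFinset _ (_) _ _).trans List.mem_map
  constructor
  · rintro ⟨w, hw, hp⟩
    rw [← hp, ← formYields_nonterminal_iff]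
    have hder : I.grammar.Derives [.nonterminal I.start] (w.map .terminal) := hw
    refine Relation.ReflTransGen.head_induction_on (motive := fun s _ =>
      FormYields I.rules s w.prod) hder (formYields_terminal w) ?_
    rintro s t ⟨r, hr, hst⟩ - ht
    obtain ⟨r', hr', rfl⟩ := (hmem r).1 hr
    obtain ⟨p, q, rfl, rfl⟩ := hst.exists_parts
    obtain ⟨g₁, g₂, h₁, h₂, he⟩ := FormYields.of_append ht
    obtain ⟨g₃, g₄, h₃, h₄, rfl⟩ := FormYields.of_append h₁
    rw [he]
    exact (h₃.append (formYields_nonterminal_iff.2 (yields_of_toRule hr' h₄))).append h₂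
  · intro h
    suffices ∀ A g, Yields I.rules A g → ∃ w : List G,
        I.grammar.Derives [.nonterminal A] (w.map .terminal) ∧ w.prod = g from this _ _ h
    have hprod : ∀ r ∈ I.rules, I.grammar.Derives [.nonterminal r.toRule.input] r.toRule.output :=
      fun r hr => .single ⟨r.toRule, (hmem _).2 ⟨r, hr, rfl⟩, ContextFreeRule.Rewrites.input_output⟩
    intro A g h
    induction h with
    | @single A g h => exact ⟨[g], hprod _ h, by simp⟩
    | @pair A B C g h hr _ _ ih₁ ih₂ =>
      obtain ⟨w₁, h₁, rfl⟩ := ih₁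
      obtain ⟨w₂, h₂, rfl⟩ := ih₂
      refine ⟨w₁ ++ w₂, (hprod _ hr).trans ?_, by simp⟩
      rw [List.map_append]
      exact (h₁.append_right [.nonterminal C]).trans (h₂.append_left _)

end ContextFreeSubset

/-! ### Basic programs -/

namespace StackProgram

variable {G : Type*} [Group G] {B : BlackBox G} {s : ℕ}

lemma Exec.congr_right {p : Prog} {R R' R'' : Store} (h : Exec B s p R R') (e : R' = R'') :
    Exec B s p R R'' := e ▸ h

/-- The word `l` as a stack: its last letter is on the top. -/
def stk (l : List Bool) : List Sym := l.reverse.map .bit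

/-- A list of bits as a name of length `n`, truncated or filled up with `0`s. -/
def toName {n : ℕ} (l : List Bool) : Fin n → Bool := fun i => (l[(i : ℕ)]?).getD false

@[simp] lemma toName_ofFn {n : ℕ} (x : Fin n → Bool) : toName (List.ofFn x) = x := by
  funext i
  simp [toName]

lemma bitsAt_ofList_zero {n : ℕ} (l m : List Bool) (hl : l.length = n) :
    bitsAt (OTape.ofList (l ++ m)).cells 0 n = toName l := by
  funext i
  have : ((0 : ℕ) : ℤ) + (i : ℕ) = (i : ℕ) := by simp
  simp only [bitsAt, toName, this, OTape.cells_ofList_natCast]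
  rw [List.getElem?_append_left (by omega)]

lemma bitsAt_ofList_length {n k : ℕ} (l m : List Bool) (hl : l.length = n) :
    bitsAt (OTape.ofList (l ++ m)).cells n k = toName m := by
  funext i
  have : (n : ℤ) + (i : ℕ) = ((n + i : ℕ) : ℤ) := by simp
  simp only [bitsAt, toName, this, OTape.cells_ofList_natCast]
  rw [List.getElem?_append_right (by omega), hl, Nat.add_sub_cancel_left]

section Names

variable (B)

/-- The operations of the black box on bit strings of the form of lists. -/
def isValid (l : List Bool) : Bool := B.valid (toName l)

def inverse (l : List Bool) : List Bool := List.ofFn (B.inv (toName l))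

def mul (l m : List Bool) : List Bool := List.ofFn (B.prod (toName l) (toName m))

def isOne (l z : List Bool) : Bool := B.isId (toName l) (toName z)

@[simp] lemma length_inverse (l : List Bool) : (inverse B l).length = B.b := by simp [inverse]

@[simp] lemma length_mul (l m : List Bool) : (mul B l m).length = B.b := by simp [mul]

variable {B}

lemma ask_valid {l : List Bool} (hl : l.length = B.b) :
    ask B .valid l.reverse = [isValid B l] := by
  have := bitsAt_ofList_zero l [] hl
  rw [List.append_nil] at this
  simp [ask, BlackBox.answer, isValid, this]

lemma ask_inv {l : List Bool} (hl : l.length = B.b) :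
    ask B .inv l.reverse = (inverse B l).reverse := by
  have := bitsAt_ofList_zero l [] hl
  rw [List.append_nil] at this
  simp [ask, BlackBox.answer, inverse, this]

lemma ask_prod {l m : List Bool} (hl : l.length = B.b) :
    ask B .prod (m.reverse ++ l.reverse) = (mul B l m).reverse := by
  rw [← List.reverse_append]
  simp [ask, BlackBox.answer, mul, bitsAt_ofList_zero l m hl, bitsAt_ofList_length l m hl]

lemma ask_isId {l z : List Bool} (hl : l.length = B.b) :
    ask B .isId (z.reverse ++ l.reverse) = [isOne B l z] := by
  rw [← List.reverse_append]
  simp [ask, BlackBox.answer, isOne, bitsAt_ofList_zero l z hl, bitsAt_ofList_length l z hl]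

end Names

/-- Sequential composition of a list of programs. -/
def block : List Prog → Prog
  | [] => .skip
  | [p] => p
  | p :: l => .seq p (block l)

/-- Empty the stack `k`. -/
def clear (k : Reg) : Prog := .while (fun t => (t.stk k).isSome) (.pop k)

lemma exec_clear (k : Reg) (R : Store) : Exec B s (clear k) R (R.set k []) := by
  induction h : R.get k generalizing R with
  | nil =>
    refine (Exec.while_false (by simp [Store.top, h])).congr_right ?_
    rw [← h, Store.set_get]
  | cons a l ih =>
    refine .while_true (by simp [Store.top, h]) .pop ?_
    exact (ih (R.set k (R.get k).tail) (by simp [h])).congr_right (by simp)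

/-- Empty the oracle stack. -/
def oclear : Prog := .while (fun t => t.orc.isSome) .opop

lemma exec_oclear (R : Store) : Exec B s oclear R (R.setOrc []) := by
  induction h : R.orc generalizing R with
  | nil =>
    refine (Exec.while_false (by simp [Store.top, h])).congr_right ?_
    rw [← h]; rfl
  | cons a l ih =>
    refine .while_true (by simp [Store.top, h]) .opop ?_
    exact (ih (R.setOrc R.orc.tail) (by simp [h])).congr_right (by simp)

/-- Move the top of `k` to `k'`. -/
def move (k k' : Reg) : Prog := .seq (.push k' fun t => (t.stk k).getD .mark) (.pop k)

lemma exec_move {k k' : Reg} (hk : k ≠ k') {R : Store} {a : Sym} {l : List Sym}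
    (h : R.get k = a :: l) (hs : (R.get k').length < s) :
    Exec B s (move k k') R ((R.set k l).set k' (a :: R.get k')) := by
  refine (Exec.seq (.push hs) .pop).congr_right ?_
  refine Store.ext_get (fun x => ?_) (by simp) (by simp)
  simp only [Store.get_set, Store.top, h]
  split_ifs <;> simp_all

/-- Move the content of `k`, in reverse order, to `k'`. -/
def moveAll (k k' : Reg) : Prog := .while (fun t => (t.stk k).isSome) (move k k')

lemma exec_moveAll {k k' : Reg} (hk : k ≠ k') {R : Store}
    (hs : (R.get k).length + (R.get k').length ≤ s) :
    Exec B s (moveAll k k') R ((R.set k []).set k' ((R.get k).reverse ++ R.get k')) := by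
  induction h : R.get k generalizing R with
  | nil =>
    refine (Exec.while_false (by simp [Store.top, h])).congr_right ?_
    rw [← h, Store.set_get, h, List.reverse_nil, List.nil_append, Store.set_get]
  | cons a l ih =>
    simp only [h, List.length_cons] at hs
    refine .while_true (by simp [Store.top, h]) (exec_move hk h (by omega)) ?_
    refine (ih (R := (R.set k l).set k' (a :: R.get k')) ?_ ?_).congr_right ?_
    · rw [Store.get_set_of_ne _ hk]; simp; omega
    · rw [Store.get_set_of_ne _ hk]; simp
    · rw [Store.set_comm _ hk]; simp

/-- Replace the content of `k` by that of `k'`, which becomes empty. -/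
def assign (k k' : Reg) : Prog := block [clear k, moveAll k' .tmp, moveAll .tmp k]

lemma exec_assign {k k' : Reg} (hk : k ≠ k') (ht : k ≠ .tmp) (ht' : k' ≠ .tmp) {R : Store}
    (h0 : R.get .tmp = []) (hs : (R.get k').length ≤ s) :
    Exec B s (assign k k') R ((R.set k (R.get k')).set k' []) := by
  refine .seq (exec_clear k R) (.seq (exec_moveAll ht' ?_)
    ((exec_moveAll ht.symm ?_).congr_right ?_))
  · rw [Store.get_set_of_ne _ hk.symm, Store.get_set_of_ne _ ht.symm, h0]; simpa
  · rw [Store.get_set_self, Store.get_set_of_ne _ ht, Store.get_set_of_ne _ hk,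
      Store.get_set_self, Store.get_set_of_ne _ hk.symm, Store.get_set_of_ne _ ht.symm, h0]
    simpa
  · refine Store.ext_get (fun x => ?_) (by simp) (by simp)
    simp only [Store.get_set]
    split_ifs <;> simp_all

/-- The bit that a symbol stands for. -/
def Sym.val : Option Sym → Bool
  | some (.bit v) => v
  | some (.cell _ v) => v
  | some (.inp (.bit v)) => v
  | _ => false

/-- Append the word in the stack `k` to the word on the oracle tape. -/
def append (k : Reg) : Prog :=
  .seq (moveAll k .tmp) (.while (fun t => (t.stk .tmp).isSome)
    (.seq (.opush fun t => Sym.val (t.stk .tmp)) (move .tmp k)))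

lemma exec_append {k : Reg} (hk : k ≠ .tmp) {R : Store} {l : List Bool} (h0 : R.get .tmp = [])
    (h : R.get k = stk l) (hs : R.orc.length + l.length ≤ s) :
    Exec B s (append k) R (R.setOrc (l.reverse ++ R.orc)) := by
  have hloop : ∀ (l : List Bool) (R : Store), R.get .tmp = l.map .bit →
      (R.get k).length + l.length ≤ s → R.orc.length + l.length ≤ s →
      Exec B s (.while (fun t => (t.stk .tmp).isSome)
        (.seq (.opush fun t => Sym.val (t.stk .tmp)) (move .tmp k))) R
        (((R.setOrc (l.reverse ++ R.orc)).set .tmp []).set k (l.reverse.map .bit ++ R.get k)) := by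
    intro l
    induction l with
    | nil =>
      intro R h _ _
      refine (Exec.while_false (by simp [Store.top, h])).congr_right ?_
      have : (R.setOrc ([].reverse ++ R.orc)).set .tmp [] = R := by
        conv_rhs => rw [← Store.set_get R .tmp, h]
        rfl
      rw [this]; simp
    | cons a l ih =>
      intro R h h1 h2
      simp only [List.length_cons] at h1 h2
      refine .while_true (by simp [Store.top, h]) (.seq (.opush (by omega))
        (exec_move hk.symm (a := .bit a) (l := l.map .bit) ?_ ?_)) ((ih _ ?_ ?_ ?_).congr_right ?_)
      · simp [h]
      · simp; omega
      · rw [Store.get_set_of_ne _ hk.symm]; simp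
      · simp; omega
      · simp; omega
      · have ha : Sym.val (R.top.stk .tmp) = a := by simp [Store.top, h, Sym.val]
        refine Store.ext_get (fun x => ?_) (by simp [ha]) (by simp)
        simp only [Store.get_set, Store.get_setOrc]
        split_ifs <;> simp_all
  have hl : (R.get k).length = l.length := by simp [h, stk]
  refine .seq (exec_moveAll hk (by rw [h0]; simp; omega)) ((hloop l _ ?_ ?_ ?_).congr_right ?_)
  · simp [h, h0, stk]
  · rw [Store.get_set_of_ne _ hk]; simp; omega
  · simpa using hs
  · rw [Store.get_set_of_ne _ hk]
    have e1 : R.set k (l.reverse.map .bit) = R := by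
      rw [← stk, ← h, Store.set_get]
    have e2 : R.set .tmp [] = R := by rw [← h0, Store.set_get]
    simp only [Store.setOrc_set, Store.set_set, Store.orc_set, Store.get_set_self, List.append_nil]
    rw [Store.set_comm _ hk, Store.set_set, ← Store.setOrc_set, ← Store.setOrc_set, e1, e2]

end StackProgram

/-! ### Tests and group operations -/

namespace StackProgram

variable {G : Type*} [Group G] {B : BlackBox G} {s : ℕ}

lemma exec_query {o : OracleKind} {R : Store} {l : List Bool} (h : ask B o R.orc = l)
    (hs : l.length ≤ s) : Exec B s (.query o) R (R.setOrc l) := by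
  subst h
  exact .query hs

/-- Report the failure of a test. -/
def setFail : Prog := .seq (clear .status) (.push .status fun _ => .fail)

open Classical in
/-- The content of the stack `status` after a test with the result `v`. -/
noncomputable def verdict (v : Prop) (l : List Sym) : List Sym := if v then l else [.fail]

lemma exec_verdict {c : Top → Bool} {R : Store} {v : Prop} (hc : c R.top = true ↔ v)
    (hs : 0 < s) :
    Exec B s (.ite c .skip setFail) R (R.set .status (verdict v R.status)) := by
  unfold verdict
  split_ifs with h
  · refine (Exec.ite_true (hc.2 h) .skip).congr_right ?_
    exact (Store.set_get R .status).symm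
  · exact .ite_false (by simpa [h] using hc)
      (.seq (exec_clear _ _) ((Exec.push hs).congr_right rfl))

lemma verdict_verdict (v v' : Prop) (l : List Sym) :
    verdict v (verdict v' l) = verdict (v' ∧ v) l := by
  unfold verdict
  split_ifs <;> simp_all

/-- Run a program unless a test has failed. -/
def ifRunning (p : Prog) : Prog := .ite (fun t => (t.stk .status).isNone) p .skip

/-- Equality of two bit symbols. -/
def bitEq : Option Sym → Option Sym → Bool
  | some (.bit v), some (.bit w) => v == w
  | _, _ => false

/-- Test whether `k`, which is destroyed, and `k'` hold the same word. -/
def eqTest (k k' : Reg) : Prog :=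
  block [.while (fun t => bitEq (t.stk k) (t.stk k')) (.seq (.pop k) (move k' .tmp)),
    .ite (fun t => (t.stk k).isNone && (t.stk k').isNone) .skip setFail, moveAll .tmp k']

lemma exec_eqTest {k k' : Reg} (hk : k ≠ k') (ht : k ≠ .tmp) (ht' : k' ≠ .tmp)
    (hst : k ≠ .status) (hst' : k' ≠ .status) {R : Store} {l : List Bool} (hl : R.get k = stk l)
    (h0 : R.get .tmp = []) (hs : 0 < s) (hs' : (R.get k').length ≤ s) :
    ∃ x, Exec B s (eqTest k k') R
      ((R.set k x).set .status (verdict (R.get k' = stk l) R.status)) := by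
  have hloop : ∀ (l : List Bool) (R : Store), R.get k = l.map .bit →
      (R.get k').length + (R.get .tmp).length ≤ s →
      ∃ x y z, Exec B s (.while (fun t => bitEq (t.stk k) (t.stk k'))
        (.seq (.pop k) (move k' .tmp)))
        R (((R.set k x).set k' y).set .tmp z) ∧ z.reverse ++ y = (R.get .tmp).reverse ++ R.get k' ∧
        (x = [] ∧ y = [] ↔ R.get k' = l.map .bit) := by
    intro l
    induction l with
    | nil =>
      intro R h _
      refine ⟨R.get k, R.get k', R.get .tmp, (Exec.while_false ?_).congr_right ?_, rfl, by simp [h]⟩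
      · simp [Store.top, h, bitEq]
      · simp
    | cons a l ih =>
      intro R h hs
      by_cases hy : ∃ y, R.get k' = .bit a :: y
      · obtain ⟨y, hy⟩ := hy
        simp only [hy, List.length_cons] at hs
        have e1 : (R.set k (R.get k).tail).get k' = .bit a :: y := by
          rw [Store.get_set_of_ne _ hk.symm, hy]
        obtain ⟨x', y', z', h1, h2, h3⟩ := ih (((R.set k (R.get k).tail).set k' y).set .tmp
          (.bit a :: (R.set k (R.get k).tail).get .tmp)) (by
            simp only [Store.get_set, hk, ht]
            simp [h]) (by
            simp only [Store.get_set, ht', ht.symm]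
            simp; omega)
        refine ⟨x', y', z', .while_true (by simp [Store.top, h, hy, bitEq])
          (.seq .pop (exec_move ht' e1 (by rw [Store.get_set_of_ne _ ht.symm]; omega)))
          (h1.congr_right ?_), ?_, ?_⟩
        · refine Store.ext_get (fun x => ?_) (by simp) (by simp)
          simp only [Store.get_set, ht.symm]
          split_ifs <;> simp_all
        · simpa [Store.get_set, ht', ht.symm, hy] using h2
        · simpa [Store.get_set, ht', hy] using h3
      · refine ⟨R.get k, R.get k', R.get .tmp, (Exec.while_false ?_).congr_right ?_, rfl, ?_⟩
        · rcases hk' : R.get k' with _ | ⟨b, y⟩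
          · simp [Store.top, h, hk', bitEq]
          · cases b <;> simp_all [Store.top, bitEq]
            exact fun h => hy h.symm
        · simp
        · constructor
          · simp [h]
          · intro h'; exact absurd ⟨_, h'⟩ hy
  obtain ⟨x, y, z, h1, h2, h3⟩ := hloop l.reverse R hl (by simpa [h0] using hs')
  rw [h0, List.reverse_nil, List.nil_append] at h2
  have hlen : z.length + y.length ≤ s := by
    rw [← h2] at hs'; simpa using hs'
  refine ⟨x, .seq h1 (.seq (exec_verdict (v := R.get k' = stk l) ?_ ?_)
    ((exec_moveAll ht'.symm ?_).congr_right ?_))⟩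
  · rw [stk, ← h3]
    simp [Store.top, Store.get_set, hk, ht, ht']
  · exact hs
  · simp only [Store.get_set, ht', hst', reduceCtorEq, if_true, if_false]
    exact hlen
  · have e : (((R.set k x).set k' y).set .tmp z).status = R.status := by
      change (((R.set k x).set k' y).set .tmp z).get .status = R.get .status
      rw [Store.get_set_of_ne _ (by decide), Store.get_set_of_ne _ hst'.symm,
        Store.get_set_of_ne _ hst.symm]
    refine Store.ext_get (fun r => ?_) (by simp) (by simp)
    rw [e]
    simp only [Store.get_set, ht', hst', reduceCtorEq, if_true, if_false]
    split_ifs <;> simp_all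

/-- Test whether `k` holds the name of a group element. -/
def validTest (k : Reg) : Prog :=
  block [append k, .query .valid, .ite (fun t => t.orc == some true) .skip setFail, .opop]

lemma exec_validTest {k : Reg} (ht : k ≠ .tmp) {R : Store} {l : List Bool} (hl : R.get k = stk l)
    (h0 : R.get .tmp = []) (ho : R.orc = []) (hlen : l.length = B.b) (hs : 0 < s)
    (hb : B.b ≤ s) :
    Exec B s (validTest k) R (R.set .status (verdict (isValid B l = true) R.status)) := by
  have e : ask B .valid (R.setOrc (l.reverse ++ R.orc)).orc = [isValid B l] := by
    rw [ho, List.append_nil]; exact ask_valid hlen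
  refine .seq (exec_append ht h0 hl (by simp [ho]; omega)) (.seq (exec_query e (by simp; omega))
    (.seq (exec_verdict (v := isValid B l = true) ?_ hs) (Exec.opop.congr_right ?_)))
  · simp [Store.top]
  · refine Store.ext_get (fun r => ?_) (by simp [ho]) (by simp)
    simp only [Store.get_set, Store.get_setOrc]
    rfl

/-- Test with the given witness whether `k` holds a name of the identity element. -/
def idTest (k : Reg) : Prog :=
  block [append k, append .fWit, .query .isId, .ite (fun t => t.orc == some true) .skip setFail,
    .opop]

lemma exec_idTest {k : Reg} (ht : k ≠ .tmp) {R : Store} {l z : List Bool} (hl : R.get k = stk l)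
    (hz : R.fWit = stk z) (h0 : R.get .tmp = []) (ho : R.orc = []) (hlen : l.length = B.b)
    (hs : 0 < s) (hb : B.b + z.length ≤ s) :
    Exec B s (idTest k) R (R.set .status (verdict (isOne B l z = true) R.status)) := by
  have e : ask B .isId ((R.setOrc (l.reverse ++ R.orc)).setOrc
      (z.reverse ++ (R.setOrc (l.reverse ++ R.orc)).orc)).orc = [isOne B l z] := by
    simp only [ho, List.append_nil, Store.orc_setOrc]; exact ask_isId hlen
  refine .seq (exec_append ht h0 hl (by simp [ho]; omega))
    (.seq (exec_append (by decide) h0 hz (by simp [ho]; omega))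
      (.seq (exec_query e (by simp; omega))
    (.seq (exec_verdict (v := isOne B l z = true) ?_ hs) (Exec.opop.congr_right ?_))))
  · simp [Store.top]
  · refine Store.ext_get (fun r => ?_) (by simp [ho]) (by simp)
    simp only [Store.get_set, Store.get_setOrc]
    rfl

/-- Move the word on the oracle tape to the stack `k`. -/
def orcTo (k : Reg) : Prog :=
  block [.while (fun t => t.orc.isSome) (.seq (.push .tmp fun t => .bit (t.orc.getD false)) .opop),
    clear k, moveAll .tmp k]

lemma exec_orcTo {k : Reg} (ht : k ≠ .tmp) {R : Store} {l : List Bool} (ho : R.orc = l.reverse)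
    (h0 : R.get .tmp = []) (hs : l.length ≤ s) :
    Exec B s (orcTo k) R ((R.setOrc []).set k (stk l)) := by
  have hloop : ∀ (l : List Bool) (R : Store), R.orc = l → (R.get .tmp).length + l.length ≤ s →
      Exec B s (.while (fun t => t.orc.isSome)
        (.seq (.push .tmp fun t => .bit (t.orc.getD false)) .opop)) R
        ((R.setOrc []).set .tmp (l.reverse.map .bit ++ R.get .tmp)) := by
    intro l
    induction l with
    | nil =>
      intro R h _
      refine (Exec.while_false (by simp [Store.top, h])).congr_right ?_
      refine Store.ext_get (fun r => ?_) (by simp [h]) (by simp)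
      simp only [Store.get_set, Store.get_setOrc]
      split_ifs with hr <;> simp [hr]
    | cons a l ih =>
      intro R h hs
      simp only [List.length_cons] at hs
      refine .while_true (by simp [Store.top, h]) (.seq (.push (by omega)) .opop)
        ((ih _ (by simp [h]) ?_).congr_right ?_)
      · simp; omega
      · refine Store.ext_get (fun r => ?_) (by simp) (by simp)
        simp [Store.get_set, Store.top, h]
  refine .seq (hloop _ R ho (by simpa [h0] using hs)) (.seq (exec_clear k _)
    ((exec_moveAll ht.symm ?_).congr_right ?_))
  · simp [Store.get_set, h0, ht.symm]; omega
  · refine Store.ext_get (fun r => ?_) (by simp) (by simp)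
    simp only [Store.get_set, h0, ht, ht.symm, Store.get_setOrc]
    split_ifs <;> simp_all [stk]

/-- Multiply the group element in `k` from the left by the inverse of that in `k'`. -/
def divLeft (k k' : Reg) : Prog :=
  block [append k', .query .inv, append k, .query .prod, orcTo k]

lemma exec_divLeft {k k' : Reg} (ht : k ≠ .tmp) (ht' : k' ≠ .tmp) {R : Store} {l l' : List Bool}
    (hl : R.get k = stk l) (hl' : R.get k' = stk l') (ho : R.orc = []) (h0 : R.get .tmp = [])
    (hlen : l.length = B.b) (hlen' : l'.length = B.b) (hs : 2 * B.b ≤ s) :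
    Exec B s (divLeft k k') R (R.set k (stk (mul B (inverse B l') l))) := by
  have e : ask B .inv (R.setOrc (l'.reverse ++ R.orc)).orc = (inverse B l').reverse := by
    rw [ho, List.append_nil]; exact ask_inv hlen'
  have hlm : (mul B (inverse B l') l).length ≤ s := by rw [length_mul]; omega
  refine .seq (exec_append (l := l') ht' h0 hl' (by simp [ho]; omega))
    (.seq (exec_query e (by simp; omega))
    (.seq (exec_append (l := l) ht h0 hl (by simp; omega)) (.seq
    (exec_query (ask_prod (length_inverse B l')) (by simp; omega))
    ((exec_orcTo (l := mul B (inverse B l') l) ht rfl (by exact h0) hlm).congr_right ?_))))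
  refine Store.ext_get (fun r => ?_) (by simp [ho]) (by simp)
  simp [Store.get_set]

/-! ### Reading the input -/

/-- Input symbols as stack symbols. -/
abbrev inps (l : List InputSym) : List Sym := l.map .inp

/-- Read one more symbol of the input. -/
def advance : Prog := move .rest .seen

lemma exec_advance {R : Store} {a : InputSym} {w : List InputSym} (h : R.rest = inps (a :: w))
    (hs : R.seen.length < s) :
    Exec B s advance R { R with rest := inps w, seen := .inp a :: R.seen } :=
  exec_move (k := .rest) (k' := .seen) (by decide) h hs

def isBit : Option Sym → Bool
  | some (.inp (.bit _)) => true
  | _ => false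

/-- The word does not start with a bit. -/
def NoBit (w : List InputSym) : Prop := isBit (inps w).head? = false

/-- Append the bits that come next in the input to the word in `k`. -/
def loadBits (k : Reg) : Prog :=
  .while (fun t => isBit (t.stk .rest))
    (.seq (.push k fun t => .bit (Sym.val (t.stk .rest))) advance)

lemma exec_loadBits {k : Reg} (hk : k ≠ .rest) (hk' : k ≠ .seen) {l : List Bool}
    {w : List InputSym} (hw : NoBit w) {R : Store} (h : R.rest = inps (l.map .bit ++ w))
    (hs : (R.get k).length + l.length ≤ s) (hs' : R.seen.length + l.length ≤ s) :
    Exec B s (loadBits k) R ({ R with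
      rest := inps w, seen := (inps (l.map .bit)).reverse ++ R.seen }.set k
      (stk l ++ R.get k)) := by
  induction l generalizing R with
  | nil =>
    refine (Exec.while_false ?_).congr_right ?_
    · have : R.top.stk .rest = (inps w).head? := congrArg List.head? h
      simp only [this]; exact hw
    · simp only [stk, List.reverse_nil, List.map_nil, List.nil_append]
      have : { R with rest := inps w, seen := R.seen } = R := by
        have h : R.rest = inps w := h
        rw [← h]
      rw [this, Store.set_get]
  | cons a l ih =>
    simp only [List.length_cons] at hs hs'
    have e : R.top.stk .rest = some (.inp (.bit a)) := congrArg List.head? h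
    have e1 : ∀ x, (R.set k x).rest = R.rest := fun x => Store.get_set_of_ne R hk.symm x
    have e2 : ∀ x, (R.set k x).seen = R.seen := fun x => Store.get_set_of_ne R hk'.symm x
    refine .while_true (by rw [e]; rfl) (.seq (.push (by omega))
      (exec_advance ((e1 _).trans h) ?_)) ((ih rfl ?_ ?_).congr_right ?_)
    · rw [e2]; omega
    · have : ({R.set k (.bit (Sym.val (R.top.stk .rest)) :: R.get k) with
          rest := inps (l.map .bit ++ w),
          seen := .inp (.bit a) :: (R.set k (.bit (Sym.val (R.top.stk .rest)) :: R.get k)).seen } :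
          Store).get k = .bit (Sym.val (R.top.stk .rest)) :: R.get k := by
        cases k <;> first | rfl | contradiction
      refine (Nat.add_le_add_right (congrArg List.length this).le _).trans ?_
      simp; omega
    · simp only [e2, List.length_cons]; omega
    · rw [e]
      cases k <;> first | contradiction | simp [Store.set, Store.get, stk, Sym.val]

/-- Append the bits that come next in the input to the word on the oracle tape. -/
def appendBits : Prog :=
  .while (fun t => isBit (t.stk .rest)) (.seq (.opush fun t => Sym.val (t.stk .rest)) advance)

lemma exec_appendBits {l : List Bool} {w : List InputSym} (hw : NoBit w) {R : Store}
    (h : R.rest = inps (l.map .bit ++ w)) (hs : R.orc.length + l.length ≤ s)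
    (hs' : R.seen.length + l.length ≤ s) :
    Exec B s appendBits R { R with
      rest := inps w, seen := (inps (l.map .bit)).reverse ++ R.seen,
      orc := l.reverse ++ R.orc } := by
  induction l generalizing R with
  | nil =>
    refine (Exec.while_false ?_).congr_right ?_
    · have : R.top.stk .rest = (inps w).head? := congrArg List.head? h
      simp only [this]; exact hw
    · have h : R.rest = inps w := h
      simp [← h]
  | cons a l ih =>
    simp only [List.length_cons] at hs hs'
    have e : R.top.stk .rest = some (.inp (.bit a)) := congrArg List.head? h
    refine .while_true (by rw [e]; rfl) (.seq (.opush (by omega))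
      (exec_advance h (by change R.seen.length < s; omega))) ((ih rfl ?_ ?_).congr_right ?_)
    · simp [Store.setOrc]; omega
    · simp [Store.setOrc]; omega
    · rw [e]
      simp [Store.setOrc, Sym.val]

def isElement : Option Sym → Bool
  | some (.inp .element) => true
  | _ => false

/-- For names `u` in `ku` and `v` in `kv`, test with the given witness whether `u⁻¹ * w * v` is the
identity element, where `w` is the product of the elements that come next in the input. The result
is left on the oracle tape. -/
def wordTest (ku kv : Reg) : Prog :=
  block [append ku, .query .inv,
    .while (fun t => isElement (t.stk .rest)) (block [advance, appendBits, .query .prod]),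
    append kv, .query .prod, append .fWit, .query .isId]

lemma exec_wordTest {ku kv : Reg} (hu : ku ≠ .tmp) (hv : kv ≠ .tmp) (hv1 : kv ≠ .rest)
    (hv2 : kv ≠ .seen) {R : Store} {u v z : List Bool}
    {xs : List (Fin B.b → Bool)} {w : List InputSym} (hw : NoBit w)
    (hw' : isElement (inps w).head? = false) (h : R.rest = inps (xs.flatMap encodeName ++ w))
    (hku : R.get ku = stk u) (hkv : R.get kv = stk v) (hz : R.fWit = stk z) (ho : R.orc = [])
    (h0 : R.tmp = []) (hul : u.length = B.b) (hvl : v.length = B.b) (hs : 2 * B.b ≤ s)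
    (hs1 : B.b + z.length ≤ s) (hs2 : 1 ≤ s)
    (hs' : R.seen.length + (xs.flatMap encodeName).length ≤ s) :
    Exec B s (wordTest ku kv) R { R with
      rest := inps w, seen := (inps (xs.flatMap encodeName)).reverse ++ R.seen,
      orc := [isOne B (mul B (xs.foldl (fun a x => mul B a (List.ofFn x)) (inverse B u)) v)
        z] } := by
  have hloop : ∀ (xs : List (Fin B.b → Bool)) (R : Store) (a : List Bool),
      R.rest = inps (xs.flatMap encodeName ++ w) →
      a.length = B.b → R.orc = a.reverse → R.seen.length + (xs.flatMap encodeName).length ≤ s →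
      Exec B s (.while (fun t => isElement (t.stk .rest))
        (block [advance, appendBits, .query .prod]))
        R { R with
          rest := inps w, seen := (inps (xs.flatMap encodeName)).reverse ++ R.seen,
          orc := (xs.foldl (fun a x => mul B a (List.ofFn x)) a).reverse } := by
    intro xs
    induction xs with
    | nil =>
      intro R a h ha ho _
      refine (Exec.while_false ?_).congr_right ?_
      · have : R.top.stk .rest = (inps w).head? := congrArg List.head? h
        simp only [this]; exact hw'
      · have h : R.rest = inps w := h
        simp [← h, ← ho]
    | cons x xs ih =>
      intro R a h ha ho hs'
      have hx : (encodeName x).length = B.b + 1 := by simp [encodeName]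
      simp only [List.flatMap_cons, List.length_append, hx] at hs'
      have e : R.top.stk .rest = some (.inp .element) := congrArg List.head? h
      have hn : NoBit (xs.flatMap encodeName ++ w) := by
        cases xs with
        | nil => exact hw
        | cons _ _ => rfl
      refine .while_true (by rw [e]; rfl) (.seq
        (exec_advance (a := .element) (w := (List.ofFn x).map .bit ++ (xs.flatMap encodeName ++ w))
          ?_ (by omega))
        (.seq (exec_appendBits hn rfl ?_ ?_)
          (exec_query (l := (mul B a (List.ofFn x)).reverse) ?_ (by simp; omega))))
        ((ih _ (mul B a (List.ofFn x)) rfl (by simp) rfl ?_).congr_right ?_)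
      · rw [h]; simp [encodeName]
      · simp [ho]; omega
      · simp; omega
      · simp only [ho]; exact ask_prod ha
      · simp only [Store.setOrc, List.length_append, List.length_cons, List.length_reverse,
          List.length_map, List.length_ofFn]
        omega
      · simp [Store.setOrc, encodeName]
  have e : ask B .inv (R.setOrc (u.reverse ++ R.orc)).orc = (inverse B u).reverse := by
    rw [ho, List.append_nil]; exact ask_inv hul
  set f := xs.foldl (fun a x => mul B a (List.ofFn x)) (inverse B u) with hf
  have hfl : f.length = B.b := by
    have : ∀ (xs : List (Fin B.b → Bool)) (a : List Bool), a.length = B.b →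
        (xs.foldl (fun a x => mul B a (List.ofFn x)) a).length = B.b := by
      intro xs
      induction xs with
      | nil => exact fun a h => h
      | cons x xs ih => exact fun a _ => ih _ (by simp)
    exact this _ _ (by simp)
  have hget : ∀ (k : Reg) (r se : List Sym) (o : List Bool), k ≠ .rest → k ≠ .seen →
      ({ R with rest := r, seen := se, orc := o } : Store).get k = R.get k := by
    intro k r se o h1 h2
    cases k <;> first | rfl | contradiction
  refine .seq (exec_append hu h0 hku (by simp [ho]; omega)) (.seq (exec_query e (by simp; omega))
    (.seq (hloop xs _ _ h (by simp) rfl hs') (.seq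
      (exec_append hv h0 (l := v) ((hget kv _ _ _ hv1 hv2).trans hkv) (by simp [← hf, hfl]; omega))
      (.seq (exec_query (ask_prod (by rw [← hf]; exact hfl)) (by simp; omega))
      (.seq (exec_append (by decide) h0 hz (by simp; omega))
      ((exec_query (ask_isId (by simp)) (by simp; omega)).congr_right ?_))))))
  simp [Store.setOrc, hf]

end StackProgram

/-! ### The rounds of the verification game -/

namespace StackProgram

variable {G : Type*} [Group G] {B : BlackBox G} {s : ℕ}

/-- The moves of one round of the verification game. -/
structure Round where
  mid : List Bool
  left : List Bool
  right : List Bool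
  wit : List Bool
  ptr : List Bool
  opt : Bool × Bool
  side : Bool

/-- The moves of a round in the order in which they are played. -/
def Round.cells (m : Round) : List Sym :=
  m.mid.map (Sym.cell .mid) ++ (m.left.map (Sym.cell .left) ++ (m.right.map (Sym.cell .right) ++
    (m.wit.map (Sym.cell .wit) ++ (m.ptr.map (Sym.cell .ptr) ++
      ([m.opt.1, m.opt.2].map (Sym.cell .opt) ++
      [m.side].map (Sym.cell .side))))))

/-- The position in the input to which a round points. -/
def Round.pos (m : Round) : ℕ := m.ptr.count false

/-- The fact that is to be verified, or the result of the verification. -/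
inductive Outcome where
  | running (A : List Bool) (X : Option (List Bool)) (u v : List Bool)
  | success
  | failure

namespace Outcome

def status : Outcome → List Sym
  | running _ _ _ _ => []
  | success => [.ok]
  | failure => [.fail]

/-- The content of the stack `curB`. -/
def encodeOption : Option (List Bool) → List Sym
  | none => [.mark]
  | some B => stk B

lemma encodeOption_eq_stk {X : Option (List Bool)} {l : List Bool} :
    encodeOption X = stk l ↔ X = some l := by
  have hinj : Function.Injective (Sym.bit) := fun a b h => by simpa using h
  cases X with
  | none => rcases h : l.reverse with _ | ⟨a, t⟩ <;> simp [encodeOption, stk, h]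
  | some m =>
    simp only [encodeOption, stk, Option.some.injEq]
    exact ((List.map_injective_iff.2 hinj).eq_iff).trans List.reverse_inj

/-- Write the outcome to the store. -/
def put (T : Store) : Outcome → Store
  | running A X u v =>
    { T with curA := stk A, curB := encodeOption X, curU := stk u, curV := stk v, status := [] }
  | success => { T with curA := [], curB := [], curU := [], curV := [], status := [.ok] }
  | failure => { T with curA := [], curB := [], curU := [], curV := [], status := [.fail] }

end Outcome

lemma stk_injective : Function.Injective stk := by
  intro l m h
  have : Outcome.encodeOption (some l) = stk m := h
  simpa using Outcome.encodeOption_eq_stk.1 this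

/-- The store of the verifier for the input `w`, before an outcome is written to it. -/
def base (w : List InputSym) (future play replay : List Sym) : Store where
  inp := []
  orc := []
  rest := inps w
  seen := []
  ruler := []
  ruler' := []
  future := future
  play := play
  replay := replay
  fMid := []
  fLeft := []
  fRight := []
  fWit := []
  fOpt := []
  fSide := []
  curA := []
  curB := []
  curU := []
  curV := []
  ntP := []
  ntQ := []
  ntR := []
  tmp := []
  status := []
  mode := [.down]

/-! ### Loading the moves of a round -/

/-- The symbol is a cell with the label `L`. -/
def isCell (L : Label) : Option Sym → Bool
  | some (.cell L' _) => decide (L' = L)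
  | _ => false

/-- Copy the cells with the label `L` that come next in the replay to `k`. -/
def loadField (L : Label) (k : Reg) : Prog :=
  .while (fun t => isCell L (t.stk .replay))
    (.seq (.push k fun t => .bit (Sym.val (t.stk .replay))) (move .replay .play))

lemma exec_loadField {L : Label} {k : Reg} (hk : k ≠ .replay) (hk' : k ≠ .play) {l : List Bool}
    {t : List Sym} (ht : isCell L t.head? = false) {R : Store}
    (h : R.replay = l.map (Sym.cell L) ++ t) (hs : (R.get k).length + l.length ≤ s)
    (hs' : R.play.length + l.length ≤ s) :
    Exec B s (loadField L k) R ({ R with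
      replay := t, play := (l.map (Sym.cell L)).reverse ++ R.play }.set k (stk l ++ R.get k)) := by
  induction l generalizing R with
  | nil =>
    refine (Exec.while_false ?_).congr_right ?_
    · have : R.top.stk .replay = t.head? := congrArg List.head? h
      simp only [this]; exact ht
    · simp only [stk, List.reverse_nil, List.map_nil, List.nil_append]
      have : { R with replay := t, play := R.play } = R := by
        have h : R.replay = t := h
        rw [← h]
      rw [this, Store.set_get]
  | cons a l ih =>
    simp only [List.length_cons] at hs hs'
    have e : R.top.stk .replay = some (.cell L a) := congrArg List.head? h
    have e1 : ∀ x, (R.set k x).replay = R.replay := fun x => Store.get_set_of_ne R hk.symm x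
    have e2 : ∀ x, (R.set k x).play = R.play := fun x => Store.get_set_of_ne R hk'.symm x
    refine .while_true (by simp [e, isCell]) (.seq (.push (by omega))
      (exec_move (k := .replay) (k' := .play) (by decide) ((e1 _).trans h) ?_))
      ((ih rfl ?_ ?_).congr_right ?_)
    · change (Store.play _).length < s
      rw [e2]; omega
    · rw [Store.get_set_of_ne _ hk', Store.get_set_of_ne _ hk]
      simp; omega
    · change (_ :: (Store.play _)).length + _ ≤ _
      rw [e2, List.length_cons]; omega
    · rw [e]
      cases k <;> first | contradiction | simp [Store.set, Store.get, stk, Sym.val]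

/-- Read the pointer that comes next in the replay and move to its position in the input. -/
def follow : Prog :=
  .while (fun t => isCell .ptr (t.stk .replay))
    (.seq (.ite (fun t => !Sym.val (t.stk .replay) && (t.stk .rest).isSome) advance .skip)
      (move .replay .play))

lemma exec_follow {p : List Bool} {t : List Sym} (ht : isCell .ptr t.head? = false)
    {w : List InputSym} {R : Store} {i : ℕ} (h : R.replay = p.map (Sym.cell .ptr) ++ t)
    (hr : R.rest = inps (w.drop i)) (hq : R.seen = (inps (w.take i)).reverse)
    (hs : R.play.length + p.length ≤ s) (hw : w.length ≤ s) :
    Exec B s follow R { R with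
      replay := t, play := (p.map (Sym.cell .ptr)).reverse ++ R.play,
      rest := inps (w.drop (i + p.count false)),
      seen := (inps (w.take (i + p.count false))).reverse } := by
  induction p generalizing R i with
  | nil =>
    refine (Exec.while_false ?_).congr_right ?_
    · have : R.top.stk .replay = t.head? := congrArg List.head? h
      simp only [this]; exact ht
    · have h : R.replay = t := h
      simp only [List.map_nil, List.reverse_nil, List.nil_append, List.count_nil, Nat.add_zero,
        ← h, ← hr, ← hq]
  | cons a p ih =>
    simp only [List.length_cons] at hs
    have e : R.top.stk .replay = some (.cell .ptr a) := congrArg List.head? h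
    have hstep : ∃ j, j + p.count false = i + (a :: p).count false ∧ Exec B s
        (.ite (fun t => !Sym.val (t.stk .replay) && (t.stk .rest).isSome) advance .skip) R
        { R with rest := inps (w.drop j), seen := (inps (w.take j)).reverse } := by
      cases a with
      | true =>
        refine ⟨i, by simp, (Exec.ite_false (by simp [e, Sym.val]) .skip).congr_right ?_⟩
        rw [← hr, ← hq]
      | false =>
        refine ⟨i + 1, by simp; omega, ?_⟩
        by_cases hi : i < w.length
        · refine (Exec.ite_true ?_ (exec_advance (a := w[i]) (w := w.drop (i + 1))
            ?_ ?_)).congr_right ?_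
          · have : R.top.stk .rest = (inps (w.drop i)).head? := congrArg List.head? hr
            simp [e, Sym.val, this, hi]
          · rw [hr, List.drop_eq_getElem_cons hi]
          · rw [hq]; simp; omega
          · rw [hq, List.take_succ_eq_append_getElem hi, show inps (w.take i ++ [w[i]]) =
              inps (w.take i) ++ [.inp w[i]] from List.map_append, List.reverse_append]
            rfl
        · refine (Exec.ite_false ?_ .skip).congr_right ?_
          · have : R.top.stk .rest = (inps (w.drop i)).head? := congrArg List.head? hr
            simp [e, Sym.val, this]; omega
          · have h1 : w.drop (i + 1) = w.drop i := by
              rw [List.drop_eq_nil_of_le (by omega), List.drop_eq_nil_of_le (by omega)]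
            have h2 : w.take (i + 1) = w.take i := by
              rw [List.take_of_length_le (by omega), List.take_of_length_le (by omega)]
            rw [h1, h2, ← hr, ← hq]
    obtain ⟨j, hj, hE⟩ := hstep
    refine .while_true (by simp [e, isCell]) (.seq hE
      (exec_move (k := .replay) (k' := .play) (l := p.map (Sym.cell .ptr) ++ t) (by decide) h ?_))
      ((ih (i := j) rfl rfl rfl ?_).congr_right ?_)
    · change R.play.length < s
      omega
    · change (_ :: R.play).length + _ ≤ _
      rw [List.length_cons]; omega
    · rw [hj]
      simp [Store.set, Store.get]

/-- Load the moves of the next round from the replay. -/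
def load : Prog :=
  block [loadField .mid .fMid, loadField .left .fLeft, loadField .right .fRight,
    loadField .wit .fWit, follow, loadField .opt .fOpt, loadField .side .fSide]

/-- The store after the moves of the round `m` have been loaded. -/
def loaded (w : List InputSym) (m : Round) (T : Store) : Store :=
  { T with
    rest := inps (w.drop m.pos)
    seen := (inps (w.take m.pos)).reverse
    fMid := stk m.mid
    fLeft := stk m.left
    fRight := stk m.right
    fWit := stk m.wit
    fOpt := stk [m.opt.1, m.opt.2]
    fSide := stk [m.side] }

lemma isCell_head?_map {L L' : Label} (h : L' ≠ L) (l : List Bool) {t : List Sym}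
    (ht : isCell L t.head? = false) :
    isCell L (l.map (Sym.cell L') ++ t).head? = false := by
  cases l with
  | nil => exact ht
  | cons _ _ => simp [isCell, h]

lemma exec_load {w : List InputSym} {m : Round} {t : List Sym}
    (ht : ∀ L, L ≠ .mid → isCell L t.head? = false) {T : Store} (hr : T.replay = m.cells ++ t)
    (hw : T.rest = inps w) (hq : T.seen = []) (h1 : T.fMid = []) (h2 : T.fLeft = [])
    (h3 : T.fRight = []) (h4 : T.fWit = []) (h5 : T.fOpt = []) (h6 : T.fSide = [])
    (hs : T.play.length + m.cells.length ≤ s) (hs' : w.length ≤ s) :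
    Exec B s load T (loaded w m { T with replay := t, play := m.cells.reverse ++ T.play }) := by
  simp only [Round.cells, List.length_append, List.length_map, List.length_cons,
    List.length_nil] at hs
  have e6 : ∀ L, L ≠ .mid → L ≠ .side →
      isCell L ([m.side].map (Sym.cell .side) ++ t).head? = false := by
    intro L _ h; simp [isCell, h.symm]
  have e5 : ∀ L, L ≠ .mid → L ≠ .side → L ≠ .opt → isCell L
      ([m.opt.1, m.opt.2].map (Sym.cell .opt) ++ ([m.side].map (Sym.cell .side) ++ t)).head? =
        false := by
    intro L _ _ h; simp [isCell, h.symm]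
  have e4 := fun L h h' h'' (h3 : L ≠ .ptr) => isCell_head?_map h3.symm m.ptr (e5 L h h' h'')
  have e3 := fun L h h' h'' h3 (h4 : L ≠ .wit) => isCell_head?_map h4.symm m.wit (e4 L h h' h'' h3)
  have e2 := fun L h h' h'' h3 h4 (h5 : L ≠ .right) =>
    isCell_head?_map h5.symm m.right (e3 L h h' h'' h3 h4)
  have e1 : isCell .mid (m.left.map (Sym.cell .left) ++ (m.right.map (Sym.cell .right) ++
      (m.wit.map (Sym.cell .wit) ++ (m.ptr.map (Sym.cell .ptr) ++
      ([m.opt.1, m.opt.2].map (Sym.cell .opt) ++ ([m.side].map (Sym.cell .side) ++ t)))))).head? =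
      false :=
    isCell_head?_map (by decide) _ (isCell_head?_map (by decide) _ (isCell_head?_map (by decide) _
      (isCell_head?_map (by decide) _ (by simp [isCell]))))
  refine .seq (exec_loadField (L := .mid) (k := .fMid) (l := m.mid) (by decide) (by decide) e1
    (by rw [hr]; simp [Round.cells]) ?_ ?_) (.seq (exec_loadField (L := .left) (k := .fLeft)
      (l := m.left) (by decide) (by decide)
      (e2 .left (by decide) (by decide) (by decide) (by decide) (by decide) (by decide)) rfl ?_ ?_)
    (.seq (exec_loadField (L := .right) (k := .fRight) (l := m.right) (by decide) (by decide)
      (e3 .right (by decide) (by decide) (by decide) (by decide) (by decide)) rfl ?_ ?_)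
    (.seq (exec_loadField (L := .wit) (k := .fWit) (l := m.wit) (by decide) (by decide)
      (e4 .wit (by decide) (by decide) (by decide) (by decide)) rfl ?_ ?_)
    (.seq (exec_follow (p := m.ptr) (i := 0) (e5 .ptr (by decide) (by decide) (by decide)) rfl hw
      hq ?_ hs')
    (.seq (exec_loadField (L := .opt) (k := .fOpt) (l := [m.opt.1, m.opt.2]) (by decide)
      (by decide) (e6 .opt (by decide) (by decide)) rfl ?_ ?_)
    ((exec_loadField (L := .side) (k := .fSide) (l := [m.side]) (by decide)
      (by decide) (ht .side (by decide)) rfl ?_ ?_).congr_right ?_))))))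
  all_goals
    try simp only [Store.get, Store.set, h1, h2, h3, h4, h5, h6, List.length_append,
      List.length_reverse, List.length_map, List.length_nil, List.length_cons]
  all_goals try omega
  simp only [loaded, Round.pos, Round.cells, List.append_nil, List.reverse_append,
    List.append_assoc, Nat.zero_add]

end StackProgram

/-! ### Reading a production -/

namespace StackProgram

variable {G : Type*} [Group G] {B : BlackBox G} {s : ℕ}

lemma append_eq_append_of_noBit {l l' : List Bool} {w w' : List InputSym} (hw : NoBit w)
    (hw' : NoBit w') (h : l.map InputSym.bit ++ w = l'.map .bit ++ w') : l = l' ∧ w = w' := by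
  induction l generalizing l' with
  | nil =>
    cases l' with
    | nil => exact ⟨rfl, h⟩
    | cons a l' =>
      simp only [List.map_nil, List.nil_append] at h
      subst h
      simp [NoBit, isBit] at hw
  | cons a l ih =>
    cases l' with
    | nil =>
      simp only [List.map_nil, List.nil_append] at h
      subst h
      simp [NoBit, isBit] at hw'
    | cons a' l' =>
      simp only [List.map_cons, List.cons_append, List.cons.injEq, InputSym.bit.injEq] at h
      obtain ⟨rfl, rfl⟩ := ih h.2
      exact ⟨by rw [h.1], rfl⟩

def isRule : Option Sym → Bool
  | some (.inp .rule) => true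
  | _ => false

def isNonterminal : Option Sym → Bool
  | some (.inp .nonterminal) => true
  | _ => false

/-- The word is empty or starts with the marker of a production. -/
def AtRule (w : List InputSym) : Prop := w = [] ∨ ∃ w', w = .rule :: w'

lemma AtRule.noBit {w : List InputSym} (h : AtRule w) : NoBit w := by
  obtain rfl | ⟨w', rfl⟩ := h <;> rfl

lemma AtRule.not_element {w : List InputSym} (h : AtRule w) : isElement (inps w).head? = false := by
  obtain rfl | ⟨w', rfl⟩ := h <;> rfl

/-- The word starts with the code of the production `r`. -/
def StartsWith {b : ℕ} (w : List InputSym) (r : CNFRule (Fin b → Bool)) : Prop :=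
  ∃ w', AtRule w' ∧ w = encodeRule r ++ w'

lemma StartsWith.unique {b : ℕ} {w : List InputSym} {r r' : CNFRule (Fin b → Bool)}
    (h : StartsWith w r) (h' : StartsWith w r') : r = r' := by
  obtain ⟨w₁, h₁, rfl⟩ := h
  obtain ⟨w₂, h₂, e⟩ := h'
  have hn : ∀ w, NoBit (.nonterminal :: w) := fun _ => rfl
  have he : ∀ w, NoBit (.element :: w) := fun _ => rfl
  cases r <;> cases r' <;>
    simp only [encodeRule, encodeNonterminal, encodeName, List.cons_append, List.append_assoc,
      List.cons.injEq, true_and] at e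
  · obtain ⟨rfl, e₁⟩ := append_eq_append_of_noBit (hn _) (hn _) e
    simp only [List.cons.injEq, true_and] at e₁
    obtain ⟨rfl, e₂⟩ := append_eq_append_of_noBit (hn _) (hn _) e₁
    simp only [List.cons.injEq, true_and] at e₂
    obtain ⟨rfl, _⟩ := append_eq_append_of_noBit h₁.noBit h₂.noBit e₂
    rfl
  · have := (append_eq_append_of_noBit (hn _) (he _) e).2
    simp at this
  · have := (append_eq_append_of_noBit (he _) (hn _) e).2
    simp at this
  · obtain ⟨rfl, e₁⟩ := append_eq_append_of_noBit (he _) (he _) e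
    simp only [List.cons.injEq, true_and] at e₁
    have := (append_eq_append_of_noBit h₁.noBit h₂.noBit e₁).1
    rw [List.ofFn_inj.1 this]

/-- Read the marker of a production and its left-hand side. -/
def readRule : Prog :=
  .ite (fun t => isRule (t.stk .rest)) (block [advance, advance, loadBits .ntP]) setFail

/-- Read the right-hand side of a production that consists of two nonterminals. -/
def readPair : Prog :=
  .ite (fun t => isNonterminal (t.stk .rest))
    (block [advance, loadBits .ntQ, advance, loadBits .ntR]) setFail

lemma exec_readRule {P : List Bool} {w : List InputSym} (hw : NoBit w) {R : Store}
    (h : R.rest = inps (.rule :: (encodeNonterminal P ++ w))) (h0 : R.ntP = [])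
    (hs : R.rest.length + R.seen.length ≤ s) :
    Exec B s readRule R { R with
      rest := inps w, seen := (inps (.rule :: encodeNonterminal P)).reverse ++ R.seen,
      ntP := stk P } := by
  have h' : R.rest = inps (.rule :: .nonterminal :: (P.map .bit ++ w)) := h
  have hl : R.rest.length = P.length + w.length + 2 := by rw [h']; simp
  have e : R.top.stk .rest = some (.inp .rule) := congrArg List.head? h
  refine .ite_true (by rw [e]; rfl) (.seq (exec_advance h' (by omega))
    (.seq (exec_advance (a := .nonterminal) (w := P.map .bit ++ w) rfl ?_)
    ((exec_loadBits (k := .ntP) (l := P) (by decide) (by decide) hw rfl ?_ ?_).congr_right ?_)))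
  · simp; omega
  · simp [Store.get, h0]; omega
  · simp; omega
  · simp [Store.set, Store.get, encodeNonterminal, h0]

lemma exec_readPair {Q S : List Bool} {w : List InputSym} (hw : NoBit w) {R : Store}
    (h : R.rest = inps (encodeNonterminal Q ++ (encodeNonterminal S ++ w))) (h0 : R.ntQ = [])
    (h0' : R.ntR = []) (hs : R.rest.length + R.seen.length ≤ s) :
    Exec B s readPair R { R with
      rest := inps w,
      seen := (inps (encodeNonterminal Q ++ encodeNonterminal S)).reverse ++ R.seen,
      ntQ := stk Q, ntR := stk S } := by
  have h' : R.rest = inps (.nonterminal :: (Q.map .bit ++ .nonterminal :: (S.map .bit ++ w))) := by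
    rw [h]; simp [encodeNonterminal]
  have hl : R.rest.length = Q.length + S.length + w.length + 2 := by rw [h']; simp; omega
  have e : R.top.stk .rest = some (.inp .nonterminal) := congrArg List.head? h
  have hn : ∀ w, NoBit (.nonterminal :: w) := fun _ => rfl
  refine .ite_true (by rw [e]; rfl) (.seq (exec_advance h' (by omega))
    (.seq (exec_loadBits (k := .ntQ) (l := Q) (by decide) (by decide) (hn _) rfl ?_ ?_)
    (.seq (exec_advance (a := .nonterminal) (w := S.map .bit ++ w) rfl ?_)
    ((exec_loadBits (k := .ntR) (l := S) (by decide) (by decide) hw rfl ?_ ?_).congr_right ?_))))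
  · simp [Store.get, h0]; omega
  · simp; omega
  · simp [Store.set, Store.get]; omega
  · simp [Store.set, Store.get, h0']; omega
  · simp [Store.set, Store.get]; omega
  · simp [Store.set, Store.get, encodeNonterminal, h0, h0']

/-! ### Decoding a nonterminal -/

/-- A nonterminal `A` is played as `A`, followed by `1` and an arbitrary number of `0`s. -/
def decode (l : List Bool) : List Bool := ((l.reverse.dropWhile (! ·)).tail).reverse

lemma decode_append (A : List Bool) (n : ℕ) : decode (A ++ true :: List.replicate n false) = A := by
  have : ∀ n l, (List.replicate n false ++ l).dropWhile (! ·) = l.dropWhile (! ·) := by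
    intro n l
    induction n with
    | zero => rfl
    | succ n ih => simp [List.replicate_succ]
  simp [decode, this]

lemma length_decode_le (l : List Bool) : (decode l).length ≤ l.length := by
  have := (List.dropWhile_sublist (p := (! ·)) (l := l.reverse)).length_le
  simp [decode] at *; omega

/-- Replace the word in the stack `fMid` by the nonterminal that it encodes. -/
def decodeMid : Prog :=
  .seq (.while (fun t => (t.stk .fMid).isSome && !Sym.val (t.stk .fMid)) (.pop .fMid)) (.pop .fMid)

lemma exec_decodeMid {l : List Bool} {R : Store} (h : R.fMid = stk l) :
    Exec B s decodeMid R { R with fMid := stk (decode l) } := by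
  have hloop : ∀ (l : List Bool) (R : Store), R.fMid = l.map .bit →
      Exec B s (.while (fun t => (t.stk .fMid).isSome && !Sym.val (t.stk .fMid)) (.pop .fMid)) R
        { R with fMid := (l.dropWhile (! ·)).map .bit } := by
    intro l
    induction l with
    | nil =>
      intro R h
      refine (Exec.while_false (by simp [Store.top, Store.get, h])).congr_right ?_
      rw [List.dropWhile_nil, ← h]
    | cons a l ih =>
      intro R h
      cases a with
      | false =>
        refine .while_true (by simp [Store.top, Store.get, h, Sym.val]) .pop
          ((ih _ (by simp [Store.set, Store.get, h])).congr_right ?_)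
        simp [Store.set]
      | true =>
        refine (Exec.while_false (by simp [Store.top, Store.get, h, Sym.val])).congr_right ?_
        simp [← h]
  refine .seq (hloop _ R h) (Exec.pop.congr_right ?_)
  simp [Store.set, Store.get, stk, decode]

end StackProgram

/-! ### The outcome of a round -/

namespace StackProgram

variable {G : Type*} [Group G] {B : BlackBox G} {s : ℕ}

open Classical in
/-- The production at the beginning of a word. -/
noncomputable def ruleAt {b : ℕ} (w : List InputSym) : Option (CNFRule (Fin b → Bool)) :=
  if h : ∃ r, StartsWith w r then some h.choose else none

lemma ruleAt_eq_some_iff {b : ℕ} {w : List InputSym} {r : CNFRule (Fin b → Bool)} :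
    ruleAt w = some r ↔ StartsWith w r := by
  unfold ruleAt
  split_ifs with h
  · rw [Option.some.injEq]
    exact ⟨fun e => e ▸ h.choose_spec, fun hr => h.choose_spec.unique hr⟩
  · simpa using fun hr => h ⟨r, hr⟩

variable (B) in
/-- The name of `u⁻¹ * w * v` that is computed from names `u`, `xs` and `v`, where `w` is the
product of `xs`. -/
def quotient (u : List Bool) (xs : List (Fin B.b → Bool)) (v : List Bool) : List Bool :=
  mul B (xs.foldl (fun a x => mul B a (List.ofFn x)) (inverse B u)) v

namespace Outcome

section

open Classical

variable (B) (m : Round) (A : List Bool) (X : Option (List Bool)) (u v : List Bool)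

/-- Deduction from two facts with the intermediate nonterminal `m.mid`; the first fact has the
values `m.left` and `m.right`, and `m.side` selects the fact with which the game goes on. -/
noncomputable def split : Outcome :=
  if isValid B m.left = true ∧ isValid B m.right = true then
    if m.side = true then
      running (decode m.mid) X (mul B (inverse B m.left) u) (mul B (inverse B m.right) v)
    else running A (some (decode m.mid)) m.left m.right
  else failure

/-- Deduction of `A →* x X` from a production `A → Q X` and `Q →* x`. -/
noncomputable def leftEdge : Option (CNFRule (Fin B.b → Bool)) → Outcome
  | some (.pair P Q S) =>
    if (P = A ∧ X = some S) ∧ isOne B v m.wit = true then running Q none u v else failure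
  | _ => failure

/-- Deduction of `A →* X y` from a production `A → X S` and `S →* y`. -/
noncomputable def rightEdge : Option (CNFRule (Fin B.b → Bool)) → Outcome
  | some (.pair P Q S) =>
    if (P = A ∧ X = some Q) ∧ isOne B u m.wit = true then running S none u v else failure
  | _ => failure

/-- Deduction from a production `A → g`. -/
noncomputable def leaf : Option (CNFRule (Fin B.b → Bool)) → Outcome
  | some (.single P g) =>
    if (P = A ∧ X = none) ∧ isOne B (quotient B u [g] v) m.wit = true then success else failure
  | _ => failure

end

variable (B) in
/-- The outcome after the round `m` of the verification game. The bits `m.opt` decide how the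
current fact is deduced; if this involves a production, it is the one at the position `m.pos` of the
input. -/
noncomputable def next (w : List InputSym) (m : Round) : Outcome → Outcome
  | running A X u v =>
    match m.opt with
    | (false, false) => split B m A X u v
    | (false, true) => leftEdge B m A X u v (ruleAt (w.drop m.pos))
    | (true, false) => rightEdge B m A X u v (ruleAt (w.drop m.pos))
    | (true, true) => leaf B m A X u v (ruleAt (w.drop m.pos))
  | o => o

/-- The words in the outcome have length at most `s`, those that stand for group elements have
length `b`. -/
def Fits (b s : ℕ) : Outcome → Prop
  | running A X u v => A.length ≤ s ∧ (encodeOption X).length ≤ s ∧ u.length = b ∧ v.length = b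
  | _ => True

end Outcome

/-- The lengths of the moves are as they should be. -/
structure Round.Fits (b c s : ℕ) (m : Round) : Prop where
  mid : m.mid.length ≤ s
  left : m.left.length = b
  right : m.right.length = b
  wit : m.wit.length = c

@[simp] lemma length_stk (l : List Bool) : (stk l).length = l.length := by simp [stk]

lemma StartsWith.length_le {b : ℕ} {w : List InputSym} {r : CNFRule (Fin b → Bool)}
    (h : StartsWith w r) : (encodeRule r).length ≤ w.length := by
  obtain ⟨w', -, rfl⟩ := h
  simp

lemma Outcome.Fits.next {c : ℕ} {w : List InputSym} {m : Round} (hm : m.Fits B.b c s)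
    (hw : w.length ≤ s) (hs : 1 ≤ s) {o : Outcome} (ho : o.Fits B.b s) :
    (o.next B w m).Fits B.b s := by
  cases o with
  | success => trivial
  | failure => trivial
  | running A X u v =>
    obtain ⟨hA, hX, hu, hv⟩ := ho
    have hpair : ∀ P Q S, (ruleAt (w.drop m.pos) : Option (CNFRule (Fin B.b → Bool))) =
        some (.pair P Q S) → Q.length ≤ s ∧ S.length ≤ s := by
      intro P Q S h
      have := (ruleAt_eq_some_iff.1 h).length_le
      simp [encodeRule, encodeNonterminal] at this
      omega
    have hd := (length_decode_le m.mid).trans hm.mid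
    have h1 : (encodeOption none).length ≤ s := hs
    rcases hopt : m.opt with ⟨_ | _, _ | _⟩ <;> simp only [Outcome.next, hopt]
    · unfold Outcome.split
      split_ifs
      · exact ⟨hd, hX, by simp, by simp⟩
      · exact ⟨hA, by simpa [encodeOption] using hd, hm.left, hm.right⟩
      · trivial
    · unfold leftEdge
      split
      · split_ifs
        · exact ⟨(hpair _ _ _ ‹_›).1, h1, hu, hv⟩
        · trivial
      · trivial
    · unfold rightEdge
      split
      · split_ifs
        · exact ⟨(hpair _ _ _ ‹_›).2, h1, hu, hv⟩
        · trivial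
      · trivial
    · unfold leaf
      split
      · split_ifs <;> trivial
      · trivial

/-! ### Executing a round -/

/-- The content of the store outside of the stacks that belong to the current round. -/
structure Frame (w : List InputSym) (future play replay : List Sym) (R : Store) : Prop where
  inp : R.inp = []
  input : R.seen.reverse ++ R.rest = inps w
  ruler : R.ruler = []
  ruler' : R.ruler' = []
  future : R.future = future
  play : R.play = play
  replay : R.replay = replay
  tmp : R.tmp = []
  mode : R.mode = [.down]

/-- The outcome `o` has been computed. -/
structure Done (w : List InputSym) (future play replay : List Sym) (o : Outcome) (R : Store) : Prop
    extends Frame w future play replay R where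
  status : R.status = o.status
  running : ∀ A X u v, o = .running A X u v →
    R.curA = stk A ∧ R.curB = Outcome.encodeOption X ∧ R.curU = stk u ∧ R.curV = stk v

variable {w : List InputSym} {future play replay : List Sym}

lemma Frame.fail {R : Store} (h : Frame w future play replay R) (hs : 0 < s) :
    ∃ R', Exec B s setFail R R' ∧ Done w future play replay .failure R' :=
  ⟨_, .seq (exec_clear _ _) (.push hs), ⟨⟨h.1, h.2, h.3, h.4, h.5, h.6, h.7, h.8, h.9⟩, rfl,
    fun _ _ _ _ h => by simp at h⟩⟩

lemma exec_ifRunning {p : Prog} {R R' : Store} (h : R.status = []) (hp : Exec B s p R R') :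
    Exec B s (ifRunning p) R R' :=
  .ite_true (by simp [Store.top, Store.get, h]) hp

lemma exec_ifRunning_of_ne {p : Prog} {R : Store} (h : R.status ≠ []) :
    Exec B s (ifRunning p) R R := by
  refine .ite_false ?_ .skip
  rcases h' : R.status with _ | _
  · exact absurd h' h
  · simp [Store.top, Store.get, h']

/-- A deduction from two facts. -/
def splitFact : Prog :=
  block [validTest .fLeft, validTest .fRight, decodeMid,
    .ite (fun t => Sym.val (t.stk .fSide))
      (block [assign .curA .fMid, divLeft .curU .fLeft, divLeft .curV .fRight])
      (block [assign .curB .fMid, assign .curU .fLeft, assign .curV .fRight])]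

/-- The store at the beginning of a round. -/
abbrev start (w : List InputSym) (future play replay : List Sym) (m : Round)
    (o : Outcome) : Store :=
  loaded w m (o.put (base w future play replay))

lemma take_reverse_append_drop (w : List InputSym) (i : ℕ) :
    (inps (w.take i)).reverse.reverse ++ inps (w.drop i) = inps w := by
  rw [List.reverse_reverse, ← List.map_append, List.take_append_drop]

lemma exec_splitFact {m : Round} {c : ℕ} (hm : m.Fits B.b c s) (hs : 0 < s) (hb : 2 * B.b ≤ s)
    {A u v : List Bool} {X : Option (List Bool)} (ho : (Outcome.running A X u v).Fits B.b s)
    (hopt : m.opt = (false, false)) :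
    ∃ R, Exec B s splitFact (start w future play replay m (.running A X u v)) R ∧
      Done w future play replay ((Outcome.running A X u v).next B w m) R := by
  obtain ⟨hA, hX, hu, hv⟩ := ho
  have hl := hm.left
  have hr := hm.right
  have hd := (length_decode_le m.mid).trans hm.mid
  simp only [Outcome.next, hopt]
  have hst : verdict (isValid B m.right = true) (verdict (isValid B m.left = true) []) =
      (Outcome.split B m A X u v).status := by
    rw [verdict_verdict]
    unfold verdict Outcome.split
    split_ifs <;> rfl
  rcases hside : m.side
  · refine ⟨_, .seq (exec_validTest (l := m.left) (by decide) rfl rfl rfl hl hs (by omega))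
      (.seq (exec_validTest (l := m.right) (by decide) rfl rfl rfl hr hs (by omega))
      (.seq (exec_decodeMid (l := m.mid) rfl) (.ite_false hside
      (.seq (exec_assign (k := .curB) (k' := .fMid) (by decide) (by decide) (by decide) rfl ?_)
      (.seq (exec_assign (k := .curU) (k' := .fLeft) (by decide) (by decide) (by decide) rfl ?_)
      (exec_assign (k := .curV) (k' := .fRight) (by decide) (by decide) (by decide) rfl ?_)))))),
      ⟨⟨rfl, take_reverse_append_drop _ _, rfl, rfl, rfl, rfl, rfl, rfl, rfl⟩, hst, ?_⟩⟩
    · exact (length_stk _).trans_le hd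
    · exact (length_stk _).trans_le (by omega)
    · exact (length_stk _).trans_le (by omega)
    · unfold Outcome.split
      simp only [hside, Bool.false_eq_true, if_false]
      split_ifs
      · rintro A X u v ⟨⟩
        exact ⟨rfl, rfl, rfl, rfl⟩
      · simp
  · refine ⟨_, .seq (exec_validTest (l := m.left) (by decide) rfl rfl rfl hl hs (by omega))
      (.seq (exec_validTest (l := m.right) (by decide) rfl rfl rfl hr hs (by omega))
      (.seq (exec_decodeMid (l := m.mid) rfl) (.ite_true hside
      (.seq (exec_assign (k := .curA) (k' := .fMid) (by decide) (by decide) (by decide) rfl ?_)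
      (.seq (exec_divLeft (k := .curU) (k' := .fLeft) (by decide) (by decide) (l := u)
        (l' := m.left)         rfl rfl rfl rfl hu hl hb)
      (exec_divLeft (k := .curV) (k' := .fRight) (by decide) (by decide) (l := v) (l' := m.right)
        rfl rfl rfl rfl hv hr hb)))))),
      ⟨⟨rfl, take_reverse_append_drop _ _, rfl, rfl, rfl, rfl, rfl, rfl, rfl⟩, hst, ?_⟩⟩
    · exact (length_stk _).trans_le hd
    · unfold Outcome.split
      simp only [hside, if_true]
      split_ifs
      · rintro A X u v ⟨⟩
        exact ⟨rfl, rfl, rfl, rfl⟩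
      · simp

end StackProgram

namespace StackProgram

variable {G : Type*} [Group G] {B : BlackBox G} {s : ℕ}
variable {w : List InputSym} {future play replay : List Sym}

/-- In the input `w`, the marker of a production is always followed by a production. -/
def RulesWellFormed (b : ℕ) (w : List InputSym) : Prop :=
  ∀ i w', w.drop i = .rule :: w' → ∃ r : CNFRule (Fin b → Bool), StartsWith (w.drop i) r

/-- Read the production to which the current round points and continue with `p`. -/
def withRule (p : Prog) : Prog := .seq readRule (ifRunning p)

lemma exec_withRule_of_none {m : Round} (hs : 0 < s) (hw : RulesWellFormed B.b w) {o : Outcome}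
    (h : (ruleAt (w.drop m.pos) : Option (CNFRule (Fin B.b → Bool))) = none) (p : Prog) :
    ∃ R, Exec B s (withRule p) (start w future play replay m o) R ∧
      Done w future play replay .failure R := by
  have hF : Frame w future play replay (start w future play replay m o) := by
    cases o <;> exact ⟨rfl, take_reverse_append_drop _ _, rfl, rfl, rfl, rfl, rfl, rfl, rfl⟩
  obtain ⟨R, h1, h2⟩ := hF.fail (B := B) hs
  refine ⟨R, .seq (.ite_false ?_ h1)
    (exec_ifRunning_of_ne (by rw [h2.status]; simp [Outcome.status])), h2⟩
  have e : (start w future play replay m o).top.stk .rest = (inps (w.drop m.pos)).head? := by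
    cases o <;> rfl
  rw [e]
  rcases h' : w.drop m.pos with _ | ⟨a, w'⟩
  · rfl
  · cases a with
    | rule =>
      obtain ⟨r, hr⟩ := hw _ _ h'
      rw [ruleAt_eq_some_iff.2 hr] at h
      simp at h
    | _ => rfl

/-- The stack `curB` says that there is no nonterminal. -/
def isMark : Option Sym → Bool
  | some .mark => true
  | _ => false

/-- Continue with `p` if the current round points to a production with two nonterminals on the
right-hand side. -/
def withPair (p : Prog) : Prog := withRule (.seq readPair (ifRunning p))

/-- Deduction of `A →* x X` from a production `A → Q X` and `Q →* x`. -/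
def leftEdge : Prog :=
  withPair (block [eqTest .ntP .curA, eqTest .ntR .curB, idTest .curV,
    assign .curA .ntQ, clear .curB, .push .curB fun _ => .mark])

/-- Deduction of `A →* X y` from a production `A → X S` and `S →* y`. -/
def rightEdge : Prog :=
  withPair (block [eqTest .ntP .curA, eqTest .ntQ .curB, idTest .curU,
    assign .curA .ntR, clear .curB, .push .curB fun _ => .mark])

/-- Deduction from a production `A → g`. -/
def leaf : Prog :=
  withRule (.ite (fun t => isElement (t.stk .rest))
    (block [eqTest .ntP .curA, .ite (fun t => isMark (t.stk .curB)) .skip setFail,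
      wordTest .curU .curV, .ite (fun t => t.orc == some true) .skip setFail,
      ifRunning (.push .status fun _ => .ok)]) setFail)

variable {m : Round} {c : ℕ} {A u v : List Bool} {X : Option (List Bool)}

/-- The store after a production has been read. -/
abbrev parsed (w' : List InputSym) (q P Q S : List Sym) (R : Store) : Store :=
  { R with rest := inps w', seen := q, ntP := P, ntQ := Q, ntR := S }

lemma exec_withRule {P : List Bool} {w' : List InputSym} (hw' : NoBit w') (hlen : w.length ≤ s)
    (h : w.drop m.pos = .rule :: (encodeNonterminal P ++ w')) :
    ∃ q, q.reverse ++ inps w' = inps w ∧ ∀ p R,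
      Exec B s p (parsed w' q (stk P) [] [] (start w future play replay m (.running A X u v))) R →
      Exec B s (withRule p) (start w future play replay m (.running A X u v)) R := by
  have hfr := take_reverse_append_drop w m.pos
  have hlen' : (inps (w.drop m.pos)).length + ((inps (w.take m.pos)).reverse).length ≤ s := by
    simp; omega
  refine ⟨(inps (.rule :: encodeNonterminal P)).reverse ++ (inps (w.take m.pos)).reverse, ?_,
    fun p R hp => .seq (exec_readRule (P := P) (w := w') hw' (congrArg inps h) rfl hlen')
      (exec_ifRunning rfl hp)⟩
  rw [← hfr, h]
  simp

lemma exec_withPair {P Q S : List Bool} (hlen : w.length ≤ s)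
    (h : StartsWith (b := B.b) (w.drop m.pos) (.pair P Q S)) :
    ∃ w' q, q.reverse ++ inps w' = inps w ∧ ∀ p R,
      Exec B s p (parsed w' q (stk P) (stk Q) (stk S)
        (start w future play replay m (.running A X u v))) R →
      Exec B s (withPair p) (start w future play replay m (.running A X u v)) R := by
  obtain ⟨w', hw', e⟩ := h
  obtain ⟨q, hq, H⟩ := exec_withRule (B := B) (future := future) (play := play) (replay := replay)
    (A := A) (X := X) (u := u) (v := v) (m := m) (P := P)
    (w' := encodeNonterminal Q ++ (encodeNonterminal S ++ w')) rfl hlen (by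
      rw [e]; simp [encodeRule])
  have hq' := congrArg List.length hq
  simp only [List.length_append, List.length_reverse, List.length_map] at hq'
  refine ⟨w', (inps (encodeNonterminal Q ++ encodeNonterminal S)).reverse ++ q, ?_,
    fun p R hp => H _ _ (.seq (exec_readPair (Q := Q) (S := S) hw'.noBit rfl rfl rfl ?_)
      (exec_ifRunning rfl hp))⟩
  · rw [← hq]; simp
  · simp; omega

lemma exec_withRule_of_not_pair (hs : 0 < s) (hw : RulesWellFormed B.b w) (hlen : w.length ≤ s)
    (h : ∀ P Q S, ¬ StartsWith (b := B.b) (w.drop m.pos) (.pair P Q S)) (p : Prog) :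
    ∃ R, Exec B s (withPair p) (start w future play replay m (.running A X u v)) R ∧
      Done w future play replay .failure R := by
  rcases hr : (ruleAt (w.drop m.pos) : Option (CNFRule (Fin B.b → Bool))) with _ | r
  · exact exec_withRule_of_none hs hw hr _
  have hr := ruleAt_eq_some_iff.1 hr
  cases r with
  | pair P Q S => exact absurd hr (h P Q S)
  | single P g =>
    obtain ⟨w', hw', e⟩ := hr
    obtain ⟨q, hq, H⟩ := exec_withRule (B := B) (future := future) (play := play) (replay := replay)
      (A := A) (X := X) (u := u) (v := v) (m := m) (P := P)
      (w' := encodeName g ++ w') rfl hlen (by rw [e]; simp [encodeRule])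
    have hF : Frame w future play replay (parsed (encodeName g ++ w') q (stk P) [] []
        (start w future play replay m (.running A X u v))) :=
      ⟨rfl, hq, rfl, rfl, rfl, rfl, rfl, rfl, rfl⟩
    obtain ⟨R, h2, h3⟩ := hF.fail (B := B) hs
    exact ⟨R, H _ _ (.seq (.ite_false rfl h2)
      (exec_ifRunning_of_ne (by rw [h3.status]; simp [Outcome.status]))), h3⟩

lemma StartsWith.length_le_of_pair {b : ℕ} {P Q S : List Bool}
    (h : StartsWith (b := b) w (.pair P Q S)) :
    P.length ≤ w.length ∧ Q.length ≤ w.length ∧ S.length ≤ w.length := by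
  have := h.length_le
  simp [encodeRule, encodeNonterminal] at this
  omega

lemma exec_leftEdge (hm : m.Fits B.b c s) (hs : 0 < s) (hc : B.b + c ≤ s)
    (hw : RulesWellFormed B.b w) (hlen : w.length ≤ s)
    (ho : (Outcome.running A X u v).Fits B.b s) (hopt : m.opt = (false, true)) :
    ∃ R, Exec B s leftEdge (start w future play replay m (.running A X u v)) R ∧
      Done w future play replay ((Outcome.running A X u v).next B w m) R := by
  obtain ⟨hA, hX, hu, hv⟩ := ho
  simp only [Outcome.next, hopt]
  by_cases hr : ∃ P Q S, StartsWith (b := B.b) (w.drop m.pos) (.pair P Q S)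
  · obtain ⟨P, Q, S, hr⟩ := hr
    rw [ruleAt_eq_some_iff.2 hr]
    obtain ⟨w', q, hq, H⟩ := exec_withPair (A := A) (X := X) (u := u) (v := v) (future := future)
      (play := play) (replay := replay) hlen hr
    obtain ⟨hP, hQ, hS⟩ := hr.length_le_of_pair
    rw [List.length_drop] at hP hQ hS
    set R₀ := parsed w' q (stk P) (stk Q) (stk S)
      (start w future play replay m (.running A X u v)) with hR₀
    have e1 : R₀.get .curA = stk P ↔ P = A := stk_injective.eq_iff.trans eq_comm
    have e2 : R₀.get .curB = stk S ↔ X = some S := Outcome.encodeOption_eq_stk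
    obtain ⟨x₁, h1⟩ := exec_eqTest (B := B) (s := s) (k := .ntP) (k' := .curA) (l := P) (R := R₀)
      (by decide) (by decide) (by decide) (by decide) (by decide) rfl rfl hs
      ((length_stk _).trans_le hA)
    obtain ⟨x₂, h2⟩ := exec_eqTest (B := B) (s := s) (k := .ntR) (k' := .curB) (l := S)
      (R := (R₀.set .ntP x₁).set .status (verdict (R₀.get .curA = stk P) R₀.status))
      (by decide) (by decide) (by decide) (by decide) (by decide) rfl rfl hs hX
    refine ⟨_, H _ _ (.seq h1 (.seq h2 (.seq
      (exec_idTest (k := .curV) (l := v) (z := m.wit) (by decide) rfl rfl rfl rfl hv hs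
        (by rw [hm.wit]; exact hc))
      (.seq (exec_assign (k := .curA) (k' := .ntQ) (by decide) (by decide) (by decide) rfl
        ((length_stk _).trans_le (by omega))) (.seq (exec_clear _ _) (.push hs)))))),
      ⟨⟨rfl, hq, rfl, rfl, rfl, rfl, rfl, rfl, rfl⟩, ?_, ?_⟩⟩
    · change verdict _ (verdict (R₀.get .curB = stk S) (verdict (R₀.get .curA = stk P) [])) = _
      rw [verdict_verdict, verdict_verdict, ← and_assoc, e1, e2]
      unfold verdict Outcome.leftEdge
      dsimp only
      split_ifs <;> rfl
    · unfold Outcome.leftEdge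
      dsimp only
      split_ifs
      · rintro A X u v ⟨⟩
        exact ⟨rfl, rfl, rfl, rfl⟩
      · simp
  · push Not at hr
    have : Outcome.leftEdge B m A X u v (ruleAt (w.drop m.pos)) = .failure := by
      unfold Outcome.leftEdge
      split
      · exact absurd (ruleAt_eq_some_iff.1 ‹_›) (hr _ _ _)
      · rfl
    rw [this]
    exact exec_withRule_of_not_pair hs hw hlen hr _

lemma exec_rightEdge (hm : m.Fits B.b c s) (hs : 0 < s) (hc : B.b + c ≤ s)
    (hw : RulesWellFormed B.b w) (hlen : w.length ≤ s)
    (ho : (Outcome.running A X u v).Fits B.b s) (hopt : m.opt = (true, false)) :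
    ∃ R, Exec B s rightEdge (start w future play replay m (.running A X u v)) R ∧
      Done w future play replay ((Outcome.running A X u v).next B w m) R := by
  obtain ⟨hA, hX, hu, hv⟩ := ho
  simp only [Outcome.next, hopt]
  by_cases hr : ∃ P Q S, StartsWith (b := B.b) (w.drop m.pos) (.pair P Q S)
  · obtain ⟨P, Q, S, hr⟩ := hr
    rw [ruleAt_eq_some_iff.2 hr]
    obtain ⟨w', q, hq, H⟩ := exec_withPair (A := A) (X := X) (u := u) (v := v) (future := future)
      (play := play) (replay := replay) hlen hr
    obtain ⟨hP, hQ, hS⟩ := hr.length_le_of_pair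
    rw [List.length_drop] at hP hQ hS
    set R₀ := parsed w' q (stk P) (stk Q) (stk S)
      (start w future play replay m (.running A X u v)) with hR₀
    have e1 : R₀.get .curA = stk P ↔ P = A := stk_injective.eq_iff.trans eq_comm
    have e2 : R₀.get .curB = stk Q ↔ X = some Q := Outcome.encodeOption_eq_stk
    obtain ⟨x₁, h1⟩ := exec_eqTest (B := B) (s := s) (k := .ntP) (k' := .curA) (l := P) (R := R₀)
      (by decide) (by decide) (by decide) (by decide) (by decide) rfl rfl hs
      ((length_stk _).trans_le hA)
    obtain ⟨x₂, h2⟩ := exec_eqTest (B := B) (s := s) (k := .ntQ) (k' := .curB) (l := Q)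
      (R := (R₀.set .ntP x₁).set .status (verdict (R₀.get .curA = stk P) R₀.status))
      (by decide) (by decide) (by decide) (by decide) (by decide) rfl rfl hs hX
    refine ⟨_, H _ _ (.seq h1 (.seq h2 (.seq
      (exec_idTest (k := .curU) (l := u) (z := m.wit) (by decide) rfl rfl rfl rfl hu hs
        (by rw [hm.wit]; exact hc))
      (.seq (exec_assign (k := .curA) (k' := .ntR) (by decide) (by decide) (by decide) rfl
        ((length_stk _).trans_le (by omega))) (.seq (exec_clear _ _) (.push hs)))))),
      ⟨⟨rfl, hq, rfl, rfl, rfl, rfl, rfl, rfl, rfl⟩, ?_, ?_⟩⟩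
    · change verdict _ (verdict (R₀.get .curB = stk Q) (verdict (R₀.get .curA = stk P) [])) = _
      rw [verdict_verdict, verdict_verdict, ← and_assoc, e1, e2]
      unfold verdict Outcome.rightEdge
      dsimp only
      split_ifs <;> rfl
    · unfold Outcome.rightEdge
      dsimp only
      split_ifs
      · rintro A X u v ⟨⟩
        exact ⟨rfl, rfl, rfl, rfl⟩
      · simp
  · push Not at hr
    have : Outcome.rightEdge B m A X u v (ruleAt (w.drop m.pos)) = .failure := by
      unfold Outcome.rightEdge
      split
      · exact absurd (ruleAt_eq_some_iff.1 ‹_›) (hr _ _ _)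
      · rfl
    rw [this]
    exact exec_withRule_of_not_pair hs hw hlen hr _

lemma exec_leaf (hm : m.Fits B.b c s) (hs : 0 < s) (hb : 2 * B.b ≤ s) (hc : B.b + c ≤ s)
    (hw : RulesWellFormed B.b w) (hlen : w.length ≤ s)
    (ho : (Outcome.running A X u v).Fits B.b s) (hopt : m.opt = (true, true)) :
    ∃ R, Exec B s leaf (start w future play replay m (.running A X u v)) R ∧
      Done w future play replay ((Outcome.running A X u v).next B w m) R := by
  obtain ⟨hA, hX, hu, hv⟩ := ho
  simp only [Outcome.next, hopt]
  rcases hr : (ruleAt (w.drop m.pos) : Option (CNFRule (Fin B.b → Bool))) with _ | r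
  · exact exec_withRule_of_none hs hw hr _
  obtain ⟨w', hw', e⟩ := ruleAt_eq_some_iff.1 hr
  cases r with
  | pair P Q S =>
    obtain ⟨q, hq, H⟩ := exec_withRule (B := B) (future := future) (play := play) (replay := replay)
      (A := A) (X := X) (u := u) (v := v) (m := m) (P := P)
      (w' := encodeNonterminal Q ++ (encodeNonterminal S ++ w')) rfl hlen
      (by rw [e]; simp [encodeRule])
    have hF : Frame w future play replay
      (parsed (encodeNonterminal Q ++ (encodeNonterminal S ++ w'))
        q (stk P) [] [] (start w future play replay m (.running A X u v))) :=
      ⟨rfl, hq, rfl, rfl, rfl, rfl, rfl, rfl, rfl⟩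
    obtain ⟨R, h2, h3⟩ := hF.fail (B := B) hs
    exact ⟨R, H _ _ (.ite_false rfl h2), h3⟩
  | single P g =>
    obtain ⟨q, hq, H⟩ := exec_withRule (B := B) (future := future) (play := play) (replay := replay)
      (A := A) (X := X) (u := u) (v := v) (m := m) (P := P)
      (w' := encodeName g ++ w') rfl hlen (by rw [e]; simp [encodeRule])
    have hql := congrArg List.length hq
    simp only [List.length_append, List.length_reverse, List.length_map] at hql
    set R₀ := parsed (encodeName g ++ w') q (stk P) [] []
      (start w future play replay m (.running A X u v)) with hR₀
    have e1 : R₀.get .curA = stk P ↔ P = A := stk_injective.eq_iff.trans eq_comm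
    obtain ⟨x₁, h1⟩ := exec_eqTest (B := B) (s := s) (k := .ntP) (k' := .curA) (l := P) (R := R₀)
      (by decide) (by decide) (by decide) (by decide) (by decide) rfl rfl hs
      ((length_stk _).trans_le hA)
    set R₁ := (R₀.set .ntP x₁).set .status (verdict (R₀.get .curA = stk P) R₀.status) with hR₁
    have h2 : Exec B s (.ite (fun t => isMark (t.stk .curB)) .skip setFail) R₁
        (R₁.set .status (verdict (X = none) R₁.status)) := by
      refine exec_verdict ?_ hs
      have : R₁.top.stk .curB = (Outcome.encodeOption X).head? := rfl
      rw [this]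
      cases X with
      | none => simp [Outcome.encodeOption, isMark]
      | some X => rcases h : X.reverse with _ | _ <;> simp [Outcome.encodeOption, stk, h, isMark]
    have h3 := exec_wordTest (B := B) (s := s) (ku := .curU) (kv := .curV) (by decide) (by decide)
      (by decide) (by decide) (R := R₁.set .status (verdict (X = none) R₁.status)) (u := u) (v := v)
      (z := m.wit) (xs := [g]) hw'.noBit hw'.not_element
      (by change inps (encodeName g ++ w') = _; simp) rfl rfl rfl rfl rfl hu hv hb
      (by rw [hm.wit]; exact hc) hs (by
        change q.length + _ ≤ s
        simp only [List.flatMap_cons, List.flatMap_nil, List.append_nil]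
        omega)
    set R₃ := _
    replace h3 : Exec B s _ _ R₃ := h3
    have h4 : Exec B s (.ite (fun t => t.orc == some true) .skip setFail) R₃
        (R₃.set .status (verdict (isOne B (quotient B u [g] v) m.wit = true) R₃.status)) :=
      exec_verdict (by simp [R₃, Store.top, quotient]) hs
    have hst : (R₃.set .status
        (verdict (isOne B (quotient B u [g] v) m.wit = true) R₃.status)).status =
        verdict ((P = A ∧ X = none) ∧ isOne B (quotient B u [g] v) m.wit = true) [] := by
      rw [← verdict_verdict, ← verdict_verdict, ← e1]
      rfl
    have hF : Frame w future play replay (R₃.set .status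
        (verdict (isOne B (quotient B u [g] v) m.wit = true) R₃.status)) := by
      refine ⟨rfl, ?_, rfl, rfl, rfl, rfl, rfl, rfl, rfl⟩
      rw [← hq]
      simp [R₃, R₁, R₀, Store.set]
    by_cases hv : (P = A ∧ X = none) ∧ isOne B (quotient B u [g] v) m.wit = true
    · replace hst := hst.trans (if_pos hv)
      refine ⟨_, H _ _ (.ite_true rfl (.seq h1 (.seq h2 (.seq h3 (.seq h4
        (exec_ifRunning hst (.push ?_))))))),
          ⟨⟨hF.1, hF.2, hF.3, hF.4, hF.5, hF.6, hF.7, hF.8, hF.9⟩,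
        ?_, ?_⟩⟩
      · change List.length (Store.status _) < s
        rw [hst]; exact hs
      · change _ :: (Store.status _) = _
        rw [hst]
        simp [Outcome.leaf, hv, Outcome.status]
      · simp [Outcome.leaf, hv]
    · replace hst := hst.trans (if_neg hv)
      refine ⟨_, H _ _ (.ite_true rfl (.seq h1 (.seq h2 (.seq h3 (.seq h4
        (exec_ifRunning_of_ne (by rw [hst]; simp))))))), ⟨hF, ?_, ?_⟩⟩
      · rw [hst]
        simp only [Outcome.leaf, if_neg hv]
        rfl
      · simp only [Outcome.leaf, if_neg hv]
        simp

end StackProgram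

namespace StackProgram

variable {G : Type*} [Group G] {B : BlackBox G} {s : ℕ}
variable {w : List InputSym} {future play replay : List Sym}
variable {m : Round} {c : ℕ} {A u v : List Bool} {X : Option (List Bool)}

/-- Empty the stacks in `l`. -/
def clearAll (l : List Reg) : Prog := block (l.map clear)

lemma exec_clearAll (l : List Reg) (R : Store) :
    Exec B s (clearAll l) R (l.foldl (fun R k => R.set k []) R) := by
  induction l generalizing R with
  | nil => exact .skip
  | cons k l ih =>
    cases l with
    | nil => exact exec_clear _ _
    | cons k' l => exact .seq (exec_clear _ _) (ih _)

/-- Empty the stacks that belong to the current round and, if the game has been decided, those that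
hold the current fact. -/
def cleanup : Prog :=
  block [clearAll [.fMid, .fLeft, .fRight, .fWit, .fOpt, .fSide, .ntP, .ntQ, .ntR], oclear,
    moveAll .seen .rest,
    .ite (fun t => (t.stk .status).isNone) .skip (clearAll [.curA, .curB, .curU, .curV])]

lemma exec_cleanup {o : Outcome} {R : Store} (h : Done w future play replay o R)
    (hw : w.length ≤ s) : Exec B s cleanup R (o.put (base w future play replay)) := by
  have hl := congrArg List.length h.input
  simp only [List.length_append, List.length_reverse, List.length_map] at hl
  let R₁ : Store := { R with
    orc := [], fMid := [], fLeft := [], fRight := [], fWit := [], fOpt := [], fSide := [],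
    ntP := [], ntQ := [], ntR := [] }
  let R' : Store := { R₁ with seen := [], rest := R.seen.reverse ++ R.rest }
  have h1 : Exec B s (clearAll [.fMid, .fLeft, .fRight, .fWit, .fOpt, .fSide, .ntP, .ntQ, .ntR]) R
    { R₁ with orc := R.orc } := (exec_clearAll _ _).congr_right (by simp [R₁, Store.set])
  have h2 : Exec B s oclear { R₁ with orc := R.orc } R₁ := exec_oclear _
  have h3 : Exec B s (moveAll .seen .rest) R₁ R' :=
    (exec_moveAll (k := .seen) (k' := .rest) (R := R₁) (by decide) (hl.trans_le hw)).congr_right rfl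
  refine .seq h1 (.seq h2 (.seq h3 ?_))
  have hs : R'.top.stk .status = o.status.head? := congrArg List.head? h.status
  have key : ∀ R'' : Store, R''.inp = [] → R''.orc = [] →
      (∀ k ∉ [Reg.curA, .curB, .curU, .curV], R''.get k = R'.get k) →
      (∀ k ∈ [Reg.curA, .curB, .curU, .curV],
        R''.get k = (o.put (base w future play replay)).get k) →
      R'' = o.put (base w future play replay) := by
    intro R'' h1 h2 h3 h4
    refine Store.ext_get (fun k => ?_) (h2.trans (by cases o <;> rfl))
      (h1.trans (by cases o <;> rfl))
    by_cases hk : k ∈ [Reg.curA, .curB, .curU, .curV]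
    · exact h4 k hk
    rw [h3 k hk]
    cases k <;> first
      | (exfalso; exact hk (by decide))
      | (cases o <;> rfl)
      | skip
    · exact h.input.trans (by cases o <;> rfl)
    · exact h.ruler.trans (by cases o <;> rfl)
    · exact h.ruler'.trans (by cases o <;> rfl)
    · exact h.future.trans (by cases o <;> rfl)
    · exact h.play.trans (by cases o <;> rfl)
    · exact h.replay.trans (by cases o <;> rfl)
    · exact h.tmp.trans (by cases o <;> rfl)
    · exact h.status.trans (by cases o <;> rfl)
    · exact h.mode.trans (by cases o <;> rfl)
  cases o with
  | running A X u v =>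
    obtain ⟨hA, hX, hu, hv⟩ := h.running A X u v rfl
    refine (Exec.ite_true (by rw [hs]; rfl) .skip).congr_right
      (key R' h.inp rfl (fun _ _ => rfl) ?_)
    simp only [List.mem_cons, List.not_mem_nil, or_false]
    rintro k (rfl | rfl | rfl | rfl) <;> assumption
  | _ =>
    refine (Exec.ite_false (by rw [hs]; rfl) (exec_clearAll _ _)).congr_right
      (key _ h.inp rfl ?_ ?_)
    · intro k hk
      cases k <;> first | rfl | exact absurd (by decide) hk
    · simp only [List.mem_cons, List.not_mem_nil, or_false]
      rintro k (rfl | rfl | rfl | rfl) <;> rfl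

/-- Play a round whose moves have been loaded. -/
def playMoves : Prog :=
  .ite (fun t => Sym.val (t.stk .fOpt))
    (.seq (.pop .fOpt) (.ite (fun t => Sym.val (t.stk .fOpt))
      (.seq (.push .fOpt fun _ => .bit true) leaf)
      (.seq (.push .fOpt fun _ => .bit true) leftEdge)))
    (.seq (.pop .fOpt) (.ite (fun t => Sym.val (t.stk .fOpt))
      (.seq (.push .fOpt fun _ => .bit false) rightEdge)
      (.seq (.push .fOpt fun _ => .bit false) splitFact)))

lemma exec_playMoves {m : Round} {R R' : Store} (hs : 2 ≤ s)
    (h : R.fOpt = stk [m.opt.1, m.opt.2])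
    (hR : Exec B s (match m.opt with
      | (false, false) => splitFact
      | (false, true) => leftEdge
      | (true, false) => rightEdge
      | (true, true) => leaf) R R') : Exec B s playMoves R R' := by
  have e1 : Sym.val (R.top.stk .fOpt) = m.opt.2 := by
    simp [Store.top, Store.get, h, stk, Sym.val]
  have e2 : Sym.val ((R.set .fOpt (R.get .fOpt).tail).top.stk .fOpt) = m.opt.1 := by
    simp [Store.top, Store.get, h, stk, Sym.val, Store.set]
  have e3 : (R.set .fOpt (R.get .fOpt).tail).set .fOpt
      (.bit m.opt.2 :: (R.set .fOpt (R.get .fOpt).tail).get .fOpt) = R := by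
    have : Sym.bit m.opt.2 :: (R.get .fOpt).tail = R.get .fOpt := by simp [Store.get, h, stk]
    rw [Store.get_set_self, this, Store.set_set, Store.set_get]
  have e4 : ((R.set .fOpt (R.get .fOpt).tail).get .fOpt).length < s := by
    simp [Store.get, h, stk, Store.set]; omega
  have hpush : Exec B s (.push .fOpt fun _ => .bit m.opt.2) (R.set .fOpt (R.get .fOpt).tail) R :=
    (Exec.push e4).congr_right e3
  rcases ho : m.opt with ⟨_ | _, _ | _⟩ <;> rw [ho] at e1 e2 hpush <;> simp only [ho] at hR
  · exact .ite_false e1 (.seq .pop (.ite_false e2 (.seq hpush hR)))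
  · exact .ite_true e1 (.seq .pop (.ite_false e2 (.seq hpush hR)))
  · exact .ite_false e1 (.seq .pop (.ite_true e2 (.seq hpush hR)))
  · exact .ite_true e1 (.seq .pop (.ite_true e2 (.seq hpush hR)))

/-- Play one round. -/
def round : Prog := block [load, ifRunning playMoves, cleanup]

lemma exec_round {t : List Sym} {o : Outcome} (hm : m.Fits B.b c s) (hs : 2 ≤ s) (hb : 2 * B.b ≤ s)
    (hc : B.b + c ≤ s) (hw : RulesWellFormed B.b w) (hlen : w.length ≤ s) (ho : o.Fits B.b s)
    (ht : ∀ L, L ≠ .mid → isCell L t.head? = false) (hp : play.length + m.cells.length ≤ s) :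
    Exec B s round (o.put (base w future play (m.cells ++ t)))
      ((o.next B w m).put (base w future (m.cells.reverse ++ play) t)) := by
  have hload : Exec B s load (o.put (base w future play (m.cells ++ t)))
      (start w future (m.cells.reverse ++ play) t m o) := by
    cases o <;> exact exec_load ht rfl rfl rfl rfl rfl rfl rfl rfl rfl hp hlen
  refine .seq hload ?_
  cases o with
  | running A X u v =>
    obtain ⟨R, h1, h2⟩ : ∃ R, Exec B s (match m.opt with
      | (false, false) => splitFact
      | (false, true) => leftEdge
      | (true, false) => rightEdge
      | (true, true) => leaf) (start w future (m.cells.reverse ++ play) t m (.running A X u v)) R ∧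
        Done w future (m.cells.reverse ++ play) t ((Outcome.running A X u v).next B w m) R := by
      rcases hopt : m.opt with ⟨_ | _, _ | _⟩
      · exact exec_splitFact hm (by omega) hb ho hopt
      · exact exec_leftEdge hm (by omega) hc hw hlen ho hopt
      · exact exec_rightEdge hm (by omega) hc hw hlen ho hopt
      · exact exec_leaf hm (by omega) hb hc hw hlen ho hopt
    exact .seq (exec_ifRunning rfl (exec_playMoves (m := m) hs rfl h1)) (exec_cleanup h2 hlen)
  | _ =>
    exact .seq (exec_ifRunning_of_ne (List.cons_ne_nil _ _)) (exec_cleanup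
      ⟨⟨rfl, take_reverse_append_drop _ _, rfl, rfl, rfl, rfl, rfl, rfl, rfl⟩, rfl, by
        intro _ _ _ _ h; simp [Outcome.next] at h⟩ hlen)

/-- Play all rounds that are left. -/
def rounds : Prog := .while (fun t => (t.stk .replay).isSome) round

lemma isCell_head?_flatMap_cells {ms : List Round} (h : ∀ m ∈ ms, m.mid ≠ []) {L : Label}
    (hL : L ≠ .mid) : isCell L (ms.flatMap Round.cells).head? = false := by
  cases ms with
  | nil => rfl
  | cons m ms =>
    rcases hm : m.mid with _ | _
    · exact absurd hm (h m (by simp))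
    · simp [Round.cells, hm, isCell, hL.symm]

lemma exec_rounds {ms : List Round} {o : Outcome} (hm : ∀ m ∈ ms, m.Fits B.b c s)
    (hm' : ∀ m ∈ ms, m.mid ≠ []) (hs : 2 ≤ s) (hb : 2 * B.b ≤ s)
    (hc : B.b + c ≤ s) (hw : RulesWellFormed B.b w) (hlen : w.length ≤ s) (ho : o.Fits B.b s)
    (hp : play.length + (ms.flatMap Round.cells).length ≤ s) :
    Exec B s rounds (o.put (base w future play (ms.flatMap Round.cells)))
      ((ms.foldl (fun o m => o.next B w m) o).put
        (base w future ((ms.flatMap Round.cells).reverse ++ play) [])) := by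
  induction ms generalizing o play with
  | nil => exact .while_false (by cases o <;> rfl)
  | cons m ms ih =>
    simp only [List.flatMap_cons, List.length_append] at hp
    refine .while_true ?_ (exec_round (t := ms.flatMap Round.cells) (hm m (by simp)) hs hb hc hw
      hlen ho
      (fun L hL => isCell_head?_flatMap_cells (fun m h => hm' m (by simp [h])) hL) (by omega))
      ((ih (o := o.next B w m) (play := m.cells.reverse ++ play) (fun m h => hm m (by simp [h]))
        (fun m h => hm' m (by simp [h])) (ho.next (hm m (by simp)) hlen (by omega))
        ?_).congr_right ?_)
    · have : (o.put (base w future play ((m :: ms).flatMap Round.cells))).top.stk .replay =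
          ((m :: ms).flatMap Round.cells).head? := by cases o <;> rfl
      rw [this]
      rcases h : m.mid with _ | _
      · exact absurd h (hm' m (by simp))
      · simp [Round.cells, h]
    · simp only [List.length_append, List.length_reverse]; omega
    · simp

end StackProgram

/-! ### Checking a play -/

namespace StackProgram

variable {G : Type*} [Group G] {B : BlackBox G} {s : ℕ}
variable {future play replay : List Sym} {m : Round} {c : ℕ}

/-- Skip the bits that come next in the input. -/
def skipBits : Prog := .while (fun t => isBit (t.stk .rest)) advance

lemma exec_skipBits {l : List Bool} {w : List InputSym} (hw : NoBit w) {R : Store}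
    (h : R.rest = inps (l.map .bit ++ w)) (hs : R.seen.length + l.length ≤ s) :
    Exec B s skipBits R { R with
      rest := inps w, seen := (inps (l.map .bit)).reverse ++ R.seen } := by
  induction l generalizing R with
  | nil =>
    refine (Exec.while_false ?_).congr_right ?_
    · have : R.top.stk .rest = (inps w).head? := congrArg List.head? h
      simp only [this]; exact hw
    · have h : R.rest = inps w := h
      simp [← h]
  | cons a l ih =>
    simp only [List.length_cons] at hs
    have e : R.top.stk .rest = some (.inp (.bit a)) := congrArg List.head? h
    refine .while_true (by rw [e]; rfl) (exec_advance h (by omega)) ((ih rfl ?_).congr_right ?_)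
    · simp; omega
    · simp

variable (B) in
open Classical in
/-- The outcome of the first round, in which the names `m.left` and `m.right` of group elements `u`
and `v` are played such that the target word has the value `u * v⁻¹`. -/
noncomputable def Outcome.initial (x : CFInstance (Fin B.b → Bool)) (m : Round) : Outcome :=
  if (isValid B m.left = true ∧ isValid B m.right = true) ∧
      isOne B (quotient B m.left x.target m.right) m.wit = true then
    running x.start none m.left m.right
  else failure

/-- The first round. -/
def firstRound : Prog :=
  block [load, moveAll .seen .rest,
    block [validTest .fLeft, validTest .fRight],
    block [skipBits, advance, skipBits, advance],
    wordTest .fLeft .fRight,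
    .ite (fun t => t.orc == some true) .skip setFail,
    block [advance, advance, loadBits .curA],
    block [.push .curB fun _ => .mark, assign .curU .fLeft, assign .curV .fRight],
    cleanup]

/-- The part of the input after the target word. -/
abbrev encodeGrammar {b : ℕ} (x : CFInstance (Fin b → Bool)) : List InputSym :=
  .hash :: .nonterminal :: (x.start.map .bit ++ x.rules.flatMap encodeRule)

lemma encodeInput_eq {b : ℕ} (c : ℕ) (x : CFInstance (Fin b → Bool)) :
    encodeInput c x = (List.replicate b true).map .bit ++ .hash ::
      ((List.replicate c true).map .bit ++ .hash :: (x.target.flatMap encodeName ++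
        encodeGrammar x)) := by
  simp [encodeInput, encodeGrammar, encodeNonterminal]

lemma atRule_flatMap {b : ℕ} (l : List (CNFRule (Fin b → Bool))) :
    AtRule (l.flatMap encodeRule) := by
  cases l with
  | nil => exact .inl rfl
  | cons r l => cases r <;> exact .inr ⟨_, rfl⟩

lemma exec_firstRound {x : CFInstance (Fin B.b → Bool)} {t : List Sym} (hm : m.Fits B.b B.c s)
    (hs : 1 ≤ s) (hb : 2 * B.b ≤ s) (hc : B.b + B.c ≤ s) (hlen : (encodeInput B.c x).length ≤ s)
    (ht : ∀ L, L ≠ .mid → isCell L t.head? = false) (hp : play.length + m.cells.length ≤ s) :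
    Exec B s firstRound (base (encodeInput B.c x) future play (m.cells ++ t))
      ((Outcome.initial B x m).put
        (base (encodeInput B.c x) future (m.cells.reverse ++ play) t)) := by
  have hw := encodeInput_eq B.c x
  set w := encodeInput B.c x
  have hwl := congrArg List.length hw
  simp only [encodeGrammar, List.length_append, List.length_map, List.length_replicate,
    List.length_cons] at hwl
  set R₀ : Store := { loaded w m (base w future (m.cells.reverse ++ play) t) with
    seen := [], rest := inps w } with hR₀
  have h1 : Exec B s (moveAll .seen .rest) (loaded w m (base w future (m.cells.reverse ++ play) t))
      R₀ := by
    refine (exec_moveAll (k := .seen) (k' := .rest) (by decide) ?_).congr_right ?_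
    · have := congrArg List.length (take_reverse_append_drop w m.pos)
      simp only [List.length_append, List.length_reverse, List.length_map] at this
      change ((inps (w.take m.pos)).reverse).length + (inps (w.drop m.pos)).length ≤ s
      simp only [List.length_reverse, List.length_map]
      omega
    · change { loaded w m (base w future (m.cells.reverse ++ play) t) with
        seen := [], rest := (inps (w.take m.pos)).reverse.reverse ++ inps (w.drop m.pos) } = R₀
      rw [take_reverse_append_drop]
  set st := verdict (isValid B m.right = true) (verdict (isValid B m.left = true) []) with hst
  have h2 : Exec B s (block [validTest .fLeft, validTest .fRight]) R₀ { R₀ with status := st } :=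
    .seq (exec_validTest (l := m.left) (by decide) rfl rfl rfl hm.left hs (by omega))
      (exec_validTest (l := m.right) (by decide) rfl rfl rfl hm.right hs (by omega))
  set w₁ := x.target.flatMap encodeName ++ encodeGrammar x with hw₁
  have hN : ∀ w, NoBit (.hash :: w) := fun _ => rfl
  set q := Sym.inp .hash :: ((inps ((List.replicate B.c true).map .bit)).reverse ++
    Sym.inp .hash :: (inps ((List.replicate B.b true).map .bit)).reverse) with hq
  have hql : q.length + w₁.length = w.length := by
    simp only [hq, hw₁, hwl, encodeGrammar, List.length_append, List.length_map,
      List.length_replicate, List.length_cons, List.length_reverse]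
    omega
  have h3 : Exec B s (block [skipBits, advance, skipBits, advance]) { R₀ with status := st }
      { R₀ with status := st, rest := inps w₁, seen := q } := by
    refine .seq (exec_skipBits (hN _) (congrArg inps hw) ?_) (.seq
      (exec_advance (a := .hash) (w := (List.replicate B.c true).map .bit ++ .hash :: w₁) rfl ?_)
      (.seq (exec_skipBits (hN w₁) rfl ?_)
      ((exec_advance (a := .hash) (w := w₁) rfl ?_).congr_right ?_)))
    · simp [R₀]; omega
    · simp [R₀]; omega
    · simp [R₀]; omega
    · simp [R₀]; omega
    · simp [R₀, q]
  set q₁ := (inps (x.target.flatMap encodeName)).reverse ++ q with hq₁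
  have hq₁l : q₁.length + (encodeGrammar x).length = w.length := by
    rw [← hql, hq₁, hw₁]
    simp only [List.length_append, List.length_reverse, List.length_map]
    omega
  set bit := isOne B (quotient B m.left x.target m.right) m.wit with hbit
  have h4 : Exec B s (wordTest .fLeft .fRight) { R₀ with status := st, rest := inps w₁, seen := q }
      { R₀ with status := st, rest := inps (encodeGrammar x), seen := q₁, orc := [bit] } :=
    exec_wordTest (R := { R₀ with status := st, rest := inps w₁, seen := q }) (u := m.left)
      (v := m.right) (z := m.wit) (xs := x.target) (w := encodeGrammar x)
      (by decide) (by decide) (by decide) (by decide) rfl rfl rfl rfl rfl rfl rfl rfl hm.left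
      hm.right hb (by rw [hm.wit]; exact hc) hs (by
        change q.length + _ ≤ s
        simp only [hw₁, List.length_append] at hql
        omega)
  set st' := verdict (bit = true) st with hst'
  have h5 : Exec B s (.ite (fun t => t.orc == some true) .skip setFail)
      { R₀ with status := st, rest := inps (encodeGrammar x), seen := q₁, orc := [bit] }
      { R₀ with status := st', rest := inps (encodeGrammar x), seen := q₁, orc := [bit] } :=
    exec_verdict (by simp [Store.top]) hs
  have hst'' : st' = (Outcome.initial B x m).status := by
    rw [hst', hst, verdict_verdict, verdict_verdict, ← and_assoc]
    unfold verdict Outcome.initial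
    split_ifs <;> rfl
  set w₂ := x.rules.flatMap encodeRule with hw₂
  set q₂ := (inps (x.start.map .bit)).reverse ++ .inp .nonterminal :: .inp .hash :: q₁ with hq₂
  have hgl : (encodeGrammar x).length = x.start.length + w₂.length + 2 := by
    simp only [encodeGrammar, hw₂, List.length_append, List.length_map, List.length_cons]
  have h6 : Exec B s (block [advance, advance, loadBits .curA])
      { R₀ with status := st', rest := inps (encodeGrammar x), seen := q₁, orc := [bit] }
      { R₀ with
        status := st', rest := inps w₂, seen := q₂, orc := [bit], curA := stk x.start } := by
    refine .seq (exec_advance (a := .hash) (w := .nonterminal :: (x.start.map .bit ++ w₂)) rfl ?_)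
      (.seq (exec_advance (a := .nonterminal) (w := x.start.map .bit ++ w₂) rfl ?_)
      ((exec_loadBits (k := .curA) (l := x.start) (by decide) (by decide)
        (atRule_flatMap _).noBit rfl ?_ ?_).congr_right ?_))
    · change q₁.length < s; omega
    · change q₁.length + 1 < s; omega
    · change 0 + x.start.length ≤ s; omega
    · change q₁.length + 1 + 1 + x.start.length ≤ s; omega
    · change { R₀ with
        status := st', rest := inps w₂, seen := q₂, orc := [bit], curA := stk x.start ++ [] } = _
      rw [List.append_nil]
  have h7 : Exec B s (block [.push .curB fun _ => .mark, assign .curU .fLeft, assign .curV .fRight])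
      { R₀ with status := st', rest := inps w₂, seen := q₂, orc := [bit], curA := stk x.start }
      { R₀ with
        status := st', rest := inps w₂, seen := q₂, orc := [bit], curA := stk x.start,
        curB := [.mark], curU := stk m.left, curV := stk m.right, fLeft := [], fRight := [] } := by
    refine .seq (.push (by exact hs)) (.seq
      (exec_assign (k := .curU) (k' := .fLeft) (by decide) (by decide) (by decide) rfl ?_)
      (exec_assign (k := .curV) (k' := .fRight) (by decide) (by decide) (by decide) rfl ?_))
    · exact (length_stk _).trans_le (by rw [hm.left]; omega)
    · exact (length_stk _).trans_le (by rw [hm.right]; omega)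
  have h8 : Done w future (m.cells.reverse ++ play) t (Outcome.initial B x m) { R₀ with
        status := st', rest := inps w₂, seen := q₂, orc := [bit], curA := stk x.start,
        curB := [.mark], curU := stk m.left, curV := stk m.right, fLeft := [], fRight := [] } := by
    refine ⟨⟨rfl, ?_, rfl, rfl, rfl, rfl, rfl, rfl, rfl⟩, hst'', ?_⟩
    · rw [hw]
      simp [hq₂, hq₁, hq, hw₂, hw₁, encodeGrammar]
    · unfold Outcome.initial
      split_ifs
      · rintro A X u v ⟨⟩
        exact ⟨rfl, rfl, rfl, rfl⟩
      · simp
  have h0 : Exec B s load (base w future play (m.cells ++ t))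
      (loaded w m (base w future (m.cells.reverse ++ play) t)) :=
    exec_load ht rfl rfl rfl rfl rfl rfl rfl rfl rfl hp hlen
  exact .seq h0 (.seq h1 (.seq h2 (.seq h3 (.seq h4 (.seq h5 (.seq h6 (.seq h7
    (exec_cleanup h8 hlen))))))))

/-- The symbol says that the verification was successful. -/
def isOk : Option Sym → Bool
  | some .ok => true
  | _ => false

/-- Evaluate the play and return the result. -/
def check : Prog :=
  block [moveAll .play .replay, firstRound, rounds, clear .mode,
    .push .mode fun t => .up (isOk (t.stk .status)), clearAll [.status, .curA, .curB, .curU, .curV]]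

/-- The store in which the search goes on after the value `v` of a play has been computed. -/
abbrev returning (w : List InputSym) (future play : List Sym) (v : Bool) : Store :=
  { base w future play [] with mode := [.up v] }

variable (B) in
/-- The outcome of a play. -/
noncomputable def outcome (x : CFInstance (Fin B.b → Bool)) (m : Round) (ms : List Round) :
    Outcome :=
  ms.foldl (fun o m => o.next B (encodeInput B.c x) m) (Outcome.initial B x m)

lemma Outcome.fits_initial {x : CFInstance (Fin B.b → Bool)} (hm : m.Fits B.b B.c s)
    (hs : 1 ≤ s) (hlen : (encodeInput B.c x).length ≤ s) : (Outcome.initial B x m).Fits B.b s := by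
  have := congrArg List.length (encodeInput_eq B.c x)
  simp only [encodeGrammar, List.length_append, List.length_map, List.length_replicate,
    List.length_cons] at this
  unfold Outcome.initial
  split_ifs
  · exact ⟨by omega, hs, hm.left, hm.right⟩
  · trivial

lemma exec_check {x : CFInstance (Fin B.b → Bool)} {ms : List Round}
    (hm : ∀ m' ∈ m :: ms, m'.Fits B.b B.c s) (hm' : ∀ m' ∈ m :: ms, m'.mid ≠ []) (hs : 2 ≤ s)
    (hb : 2 * B.b ≤ s) (hc : B.b + B.c ≤ s) (hlen : (encodeInput B.c x).length ≤ s)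
    (hw : RulesWellFormed B.b (encodeInput B.c x))
    (hp : ((m :: ms).flatMap Round.cells).length ≤ s) :
    ∃ v : Bool, (v = true ↔ outcome B x m ms = .success) ∧ Exec B s check
      (base (encodeInput B.c x) future ((m :: ms).flatMap Round.cells).reverse [])
      (returning (encodeInput B.c x) future ((m :: ms).flatMap Round.cells).reverse v) := by
  set w := encodeInput B.c x with hwdef
  set play := ((m :: ms).flatMap Round.cells).reverse with hplay
  have hcells : play.reverse = m.cells ++ ms.flatMap Round.cells := by simp [hplay]
  have h1 : Exec B s (moveAll .play .replay) (base w future play [])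
      (base w future [] (m.cells ++ ms.flatMap Round.cells)) := by
    refine (exec_moveAll (k := .play) (k' := .replay) (by decide) ?_).congr_right ?_
    · change play.length + 0 ≤ s
      rw [hplay, List.length_reverse]; exact hp
    · rw [← hcells, ← List.append_nil play.reverse]; rfl
  have hp' : m.cells.length + (ms.flatMap Round.cells).length ≤ s := by simpa using hp
  have h2 : Exec B s firstRound (base w future [] (m.cells ++ ms.flatMap Round.cells))
      ((Outcome.initial B x m).put (base w future (m.cells.reverse ++ [])
        (ms.flatMap Round.cells))) :=
    exec_firstRound (hm m (by simp)) (by omega) hb hc hlen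
      (fun L hL => isCell_head?_flatMap_cells (fun m' h => hm' m' (by simp [h])) hL)
      (by simp only [List.length_nil]; omega)
  have h3 : Exec B s rounds
      ((Outcome.initial B x m).put (base w future (m.cells.reverse ++ []) (ms.flatMap Round.cells)))
      ((outcome B x m ms).put (base w future play [])) := by
    refine (exec_rounds (fun m' h => hm m' (by simp [h])) (fun m' h => hm' m' (by simp [h])) hs hb
      hc hw hlen (Outcome.fits_initial (hm m (by simp)) (by omega) hlen) ?_).congr_right ?_
    · simp only [List.append_nil, List.length_reverse]; omega
    · rw [hplay, List.append_nil, List.flatMap_cons, List.reverse_append]; rfl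
  refine ⟨isOk (outcome B x m ms).status.head?, ?_, .seq h1 (.seq h2 (.seq h3 (.seq (exec_clear _ _)
    (.seq (.push ?_) ((exec_clearAll _ _).congr_right ?_)))))⟩
  · cases outcome B x m ms <;> simp [Outcome.status, isOk]
  · rw [Store.get_set_self]; exact Nat.lt_of_lt_of_le Nat.zero_lt_two hs
  · cases outcome B x m ms <;> rfl

end StackProgram

/-! ### The search through all plays -/

namespace StackProgram

variable {G : Type*} [Group G] {B : BlackBox G} {s : ℕ}

def isDown : Option Sym → Bool
  | some .down => true
  | _ => false

def isUp : Option Sym → Bool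
  | some (.up _) => true
  | _ => false

/-- The value that the search returns. -/
def returned : Option Sym → Bool
  | some (.up v) => v
  | _ => false

/-- The label of an assigned or unassigned position of the play. -/
def labelOf : Option Sym → Label
  | some (.kind L) => L
  | some (.cell L _) => L
  | _ => .mid

/-- Assign the first bit to the next position of the play. -/
def descend : Prog :=
  .seq (.push .play fun t => .cell (labelOf (t.stk .future)) false) (.pop .future)

/-- The last position of the play needs no further attempt: its second bit has been tried, or the
result for its first bit settles the matter. -/
def settled (t : Top) : Bool :=
  Sym.val (t.stk .play) ||
    (if labelOf (t.stk .play) = .side then ! returned (t.stk .mode) else returned (t.stk .mode))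

/-- Withdraw the bit at the last position of the play. -/
def withdraw : Prog :=
  .seq (.push .future fun t => .kind (labelOf (t.stk .play))) (.pop .play)

/-- Assign the second bit to the last position of the play. -/
def flip : Prog :=
  block [withdraw, .push .play fun t => .cell (labelOf (t.stk .future)) true, .pop .future,
    clear .mode, .push .mode fun _ => .down]

/-- Determine the value of the game by a depth-first search. -/
def search : Prog :=
  .while (fun t => ! (isUp (t.stk .mode) && (t.stk .play).isNone))
    (.ite (fun t => isDown (t.stk .mode))
      (.ite (fun t => (t.stk .future).isSome) descend check)
      (.ite settled withdraw flip))

variable (B s) in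
/-- When the play `P` has been reached and the positions with the labels `ls` are unassigned, the
search returns a value that tells whether `p` holds. -/
def Evaluates (w : List InputSym) (ls : List Label) (P : List Sym) (p : Prop) : Prop :=
  P.length + ls.length ≤ s → ∃ v : Bool, (v = true ↔ p) ∧
    ∀ R, Exec B s search (returning w (ls.map .kind) P v) R →
      Exec B s search (base w (ls.map .kind) P []) R

variable {m : Round} {w : List InputSym} {ls : List Label} {P : List Sym}

lemma Evaluates.congr {p q : Prop} (h : Evaluates B s w ls P p) (e : p ↔ q) :
    Evaluates B s w ls P q := propext e ▸ h

lemma exec_withdraw {L : Label} {a v : Bool} (hs : ls.length < s) :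
    Exec B s withdraw (returning w (ls.map .kind) (.cell L a :: P) v)
      (returning w ((L :: ls).map .kind) P v) :=
  .seq (.push (by simpa [Store.get, base])) .pop

lemma Evaluates.step {L : Label} {f : Bool → Bool → Bool} {p : Bool → Prop} {q : Prop}
    (hf : ∀ v, (if L = .side then ! v else v) = true → ∀ v', f v v' = v)
    (hf' : ∀ v, (if L = .side then ! v else v) = false → ∀ v', f v v' = v')
    (hq : ∀ v₀ v₁ : Bool, (v₀ = true ↔ p false) → (v₁ = true ↔ p true) → (f v₀ v₁ = true ↔ q))
    (h : ∀ a, Evaluates B s w ls (.cell L a :: P) (p a)) : Evaluates B s w (L :: ls) P q := by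
  intro hs
  simp only [List.length_cons] at hs
  obtain ⟨v₀, h₀, H₀⟩ := h false (by simp only [List.length_cons]; omega)
  obtain ⟨v₁, h₁, H₁⟩ := h true (by simp only [List.length_cons]; omega)
  refine ⟨f v₀ v₁, hq v₀ v₁ h₀ h₁, fun R hR => ?_⟩
  have hl : ls.length < s := by omega
  refine .while_true rfl (.ite_true rfl (.ite_true rfl (.seq (.push (by
    change P.length < s; omega)) .pop))) (H₀ R ?_)
  cases hv : (if L = .side then ! v₀ else v₀) with
  | true =>
    refine .while_true rfl (.ite_false rfl (.ite_true ?_ (exec_withdraw hl))) ?_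
    · exact (Bool.false_or _).trans hv
    · rw [← hf v₀ hv v₁]; exact hR
  | false =>
    refine .while_true rfl (.ite_false rfl (.ite_false ?_ (.seq (exec_withdraw hl)
      (.seq (.push (by change P.length < s; omega)) (.seq .pop (.seq (exec_clear _ _)
        (.push (by rw [Store.get_set_self]; exact Nat.zero_lt_of_lt hl)))))))) (H₁ R ?_)
    · exact (Bool.false_or _).trans hv
    refine .while_true rfl (.ite_false rfl (.ite_true rfl (exec_withdraw hl))) ?_
    rw [← hf' v₀ hv v₁]; exact hR

lemma Evaluates.exists_bit {L : Label} (hL : L ≠ .side) {p : Bool → Prop}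
    (h : ∀ a, Evaluates B s w ls (.cell L a :: P) (p a)) :
    Evaluates B s w (L :: ls) P (∃ a, p a) := by
  refine Evaluates.step (f := fun v v' => v || v') ?_ ?_ (fun v₀ v₁ h₀ h₁ => ?_) h
  · simp +contextual [hL]
  · simp +contextual [hL]
  · simp [h₀, h₁]

lemma Evaluates.forall_bit {p : Bool → Prop}
    (h : ∀ a, Evaluates B s w ls (.cell .side a :: P) (p a)) :
    Evaluates B s w (.side :: ls) P (∀ a, p a) := by
  refine Evaluates.step (f := fun v v' => v && v') ?_ ?_ (fun v₀ v₁ h₀ h₁ => ?_) h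
  · simp +contextual
  · simp +contextual
  · simp [h₀, h₁]

lemma Evaluates.exists_word {L : Label} (hL : L ≠ .side) (n : ℕ) {p : List Bool → Prop}
    (h : ∀ l, l.length = n → Evaluates B s w ls ((l.map (Sym.cell L)).reverse ++ P) (p l)) :
    Evaluates B s w (List.replicate n L ++ ls) P (∃ l, l.length = n ∧ p l) := by
  induction n generalizing P p with
  | zero => exact (h [] rfl).congr (by simp [List.length_eq_zero_iff])
  | succ n ih =>
    rw [List.replicate_succ, List.cons_append]
    refine (Evaluates.exists_bit hL fun a => ih (p := fun l => p (a :: l)) fun l hl => ?_).congr ?_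
    · simpa using h (a :: l) (by simp [hl])
    · constructor
      · rintro ⟨a, l, hl, h⟩
        exact ⟨a :: l, by simp [hl], h⟩
      · rintro ⟨_ | ⟨a, l⟩, hl, h⟩
        · simp at hl
        · exact ⟨a, l, by simpa using hl, h⟩

/-- The labels of the moves of a round. -/
def roundLabels (b c n : ℕ) : List Label :=
  List.replicate n .mid ++ (List.replicate b .left ++ (List.replicate b .right ++
    (List.replicate c .wit ++ (List.replicate n .ptr ++ [.opt, .opt, .side]))))

/-- The moves have the lengths that are given by `roundLabels`. -/
structure Round.Legal (b c n : ℕ) (m : Round) : Prop where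
  mid : m.mid.length = n
  left : m.left.length = b
  right : m.right.length = b
  wit : m.wit.length = c
  ptr : m.ptr.length = n

lemma Evaluates.round {b c n : ℕ} {p : Round → Prop}
    (h : ∀ m : Round, m.Legal b c n → Evaluates B s w ls (m.cells.reverse ++ P) (p m)) :
    Evaluates B s w (roundLabels b c n ++ ls) P
      (∃ m : Round, m.Legal b c n ∧ ∀ side, p { m with side := side }) := by
  simp only [roundLabels, List.append_assoc]
  refine (Evaluates.exists_word (L := .mid) (by decide) n fun mid hmid =>
    Evaluates.exists_word (L := .left) (by decide) b fun left hleft =>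
    Evaluates.exists_word (L := .right) (by decide) b fun right hright =>
    Evaluates.exists_word (L := .wit) (by decide) c fun wit hwit =>
    Evaluates.exists_word (L := .ptr) (by decide) n fun ptr hptr =>
    Evaluates.exists_bit (L := .opt) (by decide) fun o₁ =>
    Evaluates.exists_bit (L := .opt) (by decide) fun o₂ =>
    Evaluates.forall_bit (p := fun side => p ⟨mid, left, right, wit, ptr, (o₁, o₂), side⟩)
      fun side => ?_).congr ?_
  · simpa [Round.cells] using h ⟨mid, left, right, wit, ptr, (o₁, o₂), side⟩
      ⟨hmid, hleft, hright, hwit, hptr⟩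
  · constructor
    · rintro ⟨mid, h₁, left, h₂, right, h₃, wit, h₄, ptr, h₅, o₁, o₂, h⟩
      exact ⟨⟨mid, left, right, wit, ptr, (o₁, o₂), true⟩, ⟨h₁, h₂, h₃, h₄, h₅⟩, h⟩
    · rintro ⟨⟨mid, left, right, wit, ptr, ⟨o₁, o₂⟩, _⟩, ⟨h₁, h₂, h₃, h₄, h₅⟩, h⟩
      exact ⟨mid, h₁, left, h₂, right, h₃, wit, h₄, ptr, h₅, o₁, o₂, h⟩

variable (B) in
/-- The verification game with the outcome `o` so far can be won in `N` rounds. -/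
def Win (w : List InputSym) (n : ℕ) : ℕ → Outcome → Prop
  | 0, o => o = .success
  | N + 1, o => ∃ m : Round, m.Legal B.b B.c n ∧
      ∀ side, Win w n N (o.next B w { m with side := side })

/-- The labels of `N` rounds. -/
def labels (b c n : ℕ) : ℕ → List Label
  | 0 => []
  | N + 1 => roundLabels b c n ++ labels b c n N

lemma Round.Legal.fits {b c n : ℕ} (h : m.Legal b c n) (hn : n ≤ s) : m.Fits b c s :=
  ⟨h.mid.trans_le hn, h.left, h.right, h.wit⟩

/-- The bound `s` leaves enough space for the verification game on the input for `x`, with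
nonterminals and pointers of length `n`. -/
structure Room (B : BlackBox G) (s n : ℕ) (x : CFInstance (Fin B.b → Bool)) : Prop where
  two_le : 2 ≤ s
  names : 2 * B.b ≤ s
  wit : B.b + B.c ≤ s
  input : (encodeInput B.c x).length ≤ s
  wellFormed : RulesWellFormed B.b (encodeInput B.c x)
  le : n ≤ s
  ne_zero : n ≠ 0

variable {x : CFInstance (Fin B.b → Bool)} {n : ℕ}

lemma evaluates_outcome (h : Room B s n x) {ms : List Round}
    (hm : ∀ m' ∈ m :: ms, m'.Legal B.b B.c n) :
    Evaluates B s (encodeInput B.c x) [] ((m :: ms).flatMap Round.cells).reverse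
      (outcome B x m ms = .success) := by
  intro hp
  simp only [List.length_reverse, List.length_nil, Nat.add_zero] at hp
  obtain ⟨v, hv, H⟩ := exec_check (B := B) (s := s) (future := []) (x := x) (m := m) (ms := ms)
    (fun m' h' => (hm m' h').fits h.le)
    (fun m' h' e => h.ne_zero (by rw [← (hm m' h').mid, e]; rfl)) h.two_le h.names h.wit h.input
    h.wellFormed hp
  exact ⟨v, hv, fun R hR => .while_true rfl (.ite_true rfl (.ite_false rfl H)) hR⟩

lemma evaluates_win (h : Room B s n x) (N : ℕ) {ms : List Round}
    (hm : ∀ m' ∈ m :: ms, m'.Legal B.b B.c n) :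
    Evaluates B s (encodeInput B.c x) (labels B.b B.c n N) ((m :: ms).flatMap Round.cells).reverse
      (Win B (encodeInput B.c x) n N (outcome B x m ms)) := by
  induction N generalizing ms with
  | zero => exact evaluates_outcome h hm
  | succ N ih =>
    refine Evaluates.round
      (p := fun m' => Win B _ n N ((outcome B x m ms).next B (encodeInput B.c x) m'))
      fun m' hm' => ?_
    have := ih (ms := ms ++ [m']) (by
      simp only [List.mem_cons, List.mem_append, List.not_mem_nil, or_false] at hm ⊢
      rintro r (rfl | h | rfl)
      exacts [hm r (.inl rfl), hm r (.inr h), hm'])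
    simpa [outcome] using this

/-- The search through all plays determines whether the verification game can be won. -/
theorem exists_exec_search (h : Room B s n x) (N : ℕ) (hp : (labels B.b B.c n (N + 1)).length ≤ s) :
    ∃ v : Bool,
      (v = true ↔ ∃ m : Round, m.Legal B.b B.c n ∧
        Win B (encodeInput B.c x) n N (Outcome.initial B x m)) ∧
      Exec B s search (base (encodeInput B.c x) ((labels B.b B.c n (N + 1)).map .kind) [] [])
        (returning (encodeInput B.c x) ((labels B.b B.c n (N + 1)).map .kind) [] v) := by
  obtain ⟨v, hv, H⟩ := Evaluates.round (P := [])
    (B := B) (s := s) (p := fun m => Win B (encodeInput B.c x) n N (Outcome.initial B x m))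
    (fun m hm => by
      simpa [outcome] using evaluates_win h (m := m) (ms := []) N
        (by simpa using hm)) (by simpa [labels] using hp)
  refine ⟨v, hv.trans ⟨fun ⟨m, hm, h⟩ => ⟨m, hm, h m.side⟩, fun ⟨m, hm, h⟩ => ⟨m, hm, fun _ => h⟩⟩,
    H _ (.while_false rfl)⟩

end StackProgram

/-! ### The initial play -/

namespace StackProgram

variable {G : Type*} [Group G] {B : BlackBox G} {s : ℕ}

/-- Move on in the input while `c` holds, and push the symbol `a` to `k` for each step. -/
def walk (c : Option Sym → Bool) (k : Reg) (a : Sym) : Prog :=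
  .while (fun t => c (t.stk .rest)) (.seq (.push k fun _ => a) advance)

lemma exec_walk {c : Option Sym → Bool} {k : Reg} {a : Sym} (hk : k ≠ .rest) (hk' : k ≠ .seen)
    {l w : List InputSym} (hl : ∀ a ∈ l, c (some (.inp a)) = true)
    (hw : c (inps w).head? = false) {R : Store} (h : R.rest = inps (l ++ w))
    (hs : (R.get k).length + l.length ≤ s) (hs' : R.seen.length + l.length ≤ s) :
    Exec B s (walk c k a) R ({ R with
      rest := inps w, seen := (inps l).reverse ++ R.seen }.set k
        (List.replicate l.length a ++ R.get k)) := by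
  induction l generalizing R with
  | nil =>
    refine (Exec.while_false ?_).congr_right ?_
    · have : R.top.stk .rest = (inps w).head? := congrArg List.head? h
      simp only [this]; exact hw
    · have : { R with rest := inps w, seen := R.seen } = R := by
        have h : R.rest = inps w := h
        rw [← h]
      simp only [List.map_nil, List.reverse_nil, List.nil_append, List.length_nil,
        List.replicate_zero]
      rw [this, Store.set_get]
  | cons b l ih =>
    simp only [List.length_cons] at hs hs'
    have e : R.top.stk .rest = some (.inp b) := congrArg List.head? h
    have e1 : ∀ x, (R.set k x).rest = R.rest := fun x => Store.get_set_of_ne R hk.symm x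
    have e2 : ∀ x, (R.set k x).seen = R.seen := fun x => Store.get_set_of_ne R hk'.symm x
    refine .while_true (by simp [e, hl b]) (.seq (.push (by omega))
      (exec_advance ((e1 _).trans h) ?_))
        ((ih (fun a h => hl a (by simp [h])) rfl ?_ ?_).congr_right ?_)
    · rw [e2]; omega
    · have : ({ R.set k (a :: R.get k) with
          rest := inps (l ++ w),
          seen := .inp b :: (R.set k (a :: R.get k)).seen } :
          Store).get k = a :: R.get k := by
        cases k <;> first | rfl | contradiction
      refine (Nat.add_le_add_right (congrArg List.length this).le _).trans ?_
      simp; omega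
    · simp only [e2, List.length_cons]; omega
    · cases k <;> first | contradiction | simp [Store.set, Store.get, List.replicate_succ']

/-- Push the symbol `a` to `k` for each symbol of the input up to the first that violates `c`. -/
def measure (c : Option Sym → Bool) (k : Reg) (a : Sym) : Prog :=
  .seq (walk c k a) (moveAll .seen .rest)

lemma exec_measure_of_seen {c : Option Sym → Bool} {k : Reg} {a : Sym} (hk : k ≠ .rest)
    (hk' : k ≠ .seen) {l₀ l w : List InputSym} (hl : ∀ a ∈ l, c (some (.inp a)) = true)
    (hw : c (inps w).head? = false) {R : Store} (h : R.rest = inps (l ++ w))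
    (hq : R.seen = (inps l₀).reverse) (hs : (R.get k).length + l.length ≤ s)
    (hs' : (l₀ ++ (l ++ w)).length ≤ s) :
    Exec B s (measure c k a) R ({ R with rest := inps (l₀ ++ (l ++ w)), seen := [] }.set k
      (List.replicate l.length a ++ R.get k)) := by
  simp only [List.length_append] at hs'
  have e1 : ∀ x, ({ R with rest := inps w, seen := (inps l).reverse ++ R.seen }.set k x).get .seen =
      (inps l).reverse ++ (inps l₀).reverse := fun x => by
    rw [Store.get_set_of_ne _ hk'.symm, ← hq]; rfl
  have e2 : ∀ x, ({ R with rest := inps w, seen := (inps l).reverse ++ R.seen }.set k x).get .rest =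
      inps w := fun x => by
    rw [Store.get_set_of_ne _ hk.symm]; rfl
  refine .seq (exec_walk hk hk' hl hw h hs (by rw [hq]; simp; omega))
    ((exec_moveAll (by decide) ?_).congr_right ?_)
  · rw [e1, e2]
    simp; omega
  · rw [e1, e2, List.reverse_append, List.reverse_reverse, List.reverse_reverse, List.append_assoc,
      ← List.map_append, ← List.map_append]
    cases k <;> first | contradiction | rfl

lemma exec_measure {c : Option Sym → Bool} {k : Reg} {a : Sym} (hk : k ≠ .rest) (hk' : k ≠ .seen)
    {l w : List InputSym} (hl : ∀ a ∈ l, c (some (.inp a)) = true)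
    (hw : c (inps w).head? = false) {R : Store} (h : R.rest = inps (l ++ w)) (hq : R.seen = [])
    (hs : (R.get k).length + l.length ≤ s) (hs' : (l ++ w).length ≤ s) :
    Exec B s (measure c k a) R (R.set k (List.replicate l.length a ++ R.get k)) := by
  refine (exec_measure_of_seen (l₀ := []) hk hk' hl hw h hq hs hs').congr_right ?_
  rw [List.nil_append, ← h, ← hq]

/-- Copy the input to the stack `rest`. -/
def readInput : Prog :=
  .seq (.while (fun t => t.inp.isSome)
    (.seq (.push .seen fun t => (t.inp.map .inp).getD .mark) .next)) (moveAll .seen .rest)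

lemma exec_readInput {w : List InputSym} (hs : w.length ≤ s) {R : Store} (h : R.inp = w)
    (hq : R.seen = []) (hr : R.rest = []) :
    Exec B s readInput R { R with inp := [], rest := inps w } := by
  have hloop : ∀ (w : List InputSym) (R : Store), R.inp = w → R.seen.length + w.length ≤ s →
      Exec B s (.while (fun t => t.inp.isSome)
        (.seq (.push .seen fun t => (t.inp.map .inp).getD .mark) .next)) R
        { R with inp := [], seen := (inps w).reverse ++ R.seen } := by
    intro w
    induction w with
    | nil =>
      intro R h _
      refine (Exec.while_false (by simp [Store.top, h])).congr_right ?_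
      cases R
      subst h
      rfl
    | cons a w ih =>
      intro R h hs
      simp only [List.length_cons] at hs
      refine .while_true (by simp [Store.top, h]) (.seq (.push (by change R.seen.length < s; omega))
        (.next (by simp [h]))) ((ih _ (by simp [Store.setInp, h]) ?_).congr_right ?_)
      · simp [Store.set, Store.setInp, Store.get]; omega
      · simp [Store.set, Store.setInp, Store.get, Store.top, h]
  refine .seq (hloop w R h (by simpa [hq])) ((exec_moveAll (by decide) ?_).congr_right ?_)
  · simpa [Store.get, hq, hr] using hs
  · simp [Store.get, Store.set, hq, hr]

/-- Multiply the length of the stack `ruler` by the length of the input. -/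
def scale : Prog :=
  .seq (moveAll .ruler .ruler') (.while (fun t => (t.stk .ruler').isSome)
    (.seq (.pop .ruler') (measure Option.isSome .ruler .mark)))

lemma exec_scale {w : List InputSym} {R : Store} {i : ℕ} (h : R.rest = inps w) (hq : R.seen = [])
    (hr : R.ruler = List.replicate i .mark) (hr' : R.ruler' = []) (hw : w.length ≤ s)
    (hs : i * w.length ≤ s) (hi : i ≤ s) :
    Exec B s scale R { R with ruler := List.replicate (i * w.length) .mark } := by
  have hloop : ∀ (i j : ℕ) (R : Store), R.rest = inps w → R.seen = [] →
      R.ruler = List.replicate j .mark → R.ruler' = List.replicate i .mark →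
      j + i * w.length ≤ s →
      Exec B s (.while (fun t => (t.stk .ruler').isSome)
        (.seq (.pop .ruler') (measure Option.isSome .ruler .mark))) R
        { R with ruler := List.replicate (j + i * w.length) .mark, ruler' := [] } := by
    intro i
    induction i with
    | zero =>
      intro j R h hq hr hr' _
      refine (Exec.while_false (by simp [Store.top, Store.get, hr'])).congr_right ?_
      have : List.replicate 0 Sym.mark = [] := rfl
      rw [Nat.zero_mul, Nat.add_zero, ← hr, ← this, ← hr']
    | succ i ih =>
      intro j R h hq hr hr' hs
      rw [Nat.succ_mul] at hs
      refine .while_true (by simp [Store.top, Store.get, hr', List.replicate_succ]) (.seq .pop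
        (exec_measure (l := w) (w := []) (by decide) (by decide) (fun _ _ => rfl) rfl ?_ hq ?_ ?_))
        ((ih (j + w.length) _ (by exact h) (by exact hq) ?_ ?_ (by omega)).congr_right ?_)
      · rw [List.append_nil]; exact h
      · simp [Store.get, Store.set, hr]; omega
      · simpa
      · simp [Store.get, Store.set, hr]; omega
      · simp [Store.get, Store.set, hr', List.replicate_succ]
      · simp only [Store.set]
        congr 2
        ring
  refine .seq (exec_moveAll (k := .ruler) (k' := .ruler') (by decide) ?_)
    ((hloop i 0 _ (by exact h) (by exact hq) ?_ ?_ (by omega)).congr_right ?_)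
  · simpa [Store.get, hr, hr']
  · simp [Store.set]
  · simp [Store.get, Store.set, hr, hr']
  · simp [Store.set, hr']

/-- Prepend the labels of a round to the unassigned positions. -/
def pushRound : Prog :=
  block [.push .future fun _ => .kind .side, .push .future fun _ => .kind .opt,
    .push .future fun _ => .kind .opt, measure Option.isSome .future (.kind .ptr),
    block [skipBits, advance, measure isBit .future (.kind .wit)],
    measure isBit .future (.kind .right), measure isBit .future (.kind .left),
    measure Option.isSome .future (.kind .mid)]

lemma exec_pushRound {b c : ℕ} {w w' : List InputSym}
    (hw : w = (List.replicate b true).map .bit ++ .hash ::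
      ((List.replicate c true).map .bit ++ .hash :: w'))
    {R : Store} (h : R.rest = inps w) (hq : R.seen = [])
    (hs : w.length ≤ s) (hs' : (roundLabels b c w.length).length + R.future.length ≤ s) :
    Exec B s pushRound R
      { R with future := (roundLabels b c w.length).map .kind ++ R.future } := by
  have hwl := congrArg List.length hw
  simp only [List.length_append, List.length_cons, List.length_map, List.length_replicate] at hwl
  simp only [roundLabels, List.length_append, List.length_replicate, List.length_cons,
    List.length_nil] at hs'
  have hbit : ∀ n, ∀ a ∈ (List.replicate n true).map InputSym.bit,
      isBit (some (.inp a)) = true := by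
    intro n a ha
    obtain ⟨v, -, rfl⟩ := List.mem_map.1 ha
    rfl
  set f₃ := Sym.kind .opt :: .kind .opt :: .kind .side :: R.future with hf₃
  set f₄ := List.replicate w.length (Sym.kind .ptr) ++ f₃ with hf₄
  set f₅ := List.replicate c (Sym.kind .wit) ++ f₄ with hf₅
  set f₆ := List.replicate b (Sym.kind .right) ++ f₅ with hf₆
  set f₇ := List.replicate b (Sym.kind .left) ++ f₆ with hf₇
  have h₃ : f₃.length = 3 + R.future.length := by simp [hf₃]; omega
  have h₄ : f₄.length = w.length + f₃.length := by simp [hf₄]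
  have h₅ : f₅.length = c + f₄.length := by simp [hf₅]
  have h₆ : f₆.length = b + f₅.length := by simp [hf₆]
  have h₇ : f₇.length = b + f₆.length := by simp [hf₇]
  have hm₁ : ∀ f L, f.length + w.length ≤ s → Exec B s (measure Option.isSome .future (.kind L))
      { R with future := f } { R with future := List.replicate w.length (.kind L) ++ f } := by
    intro f L hf
    exact exec_measure (R := { R with future := f }) (l := w) (w := []) (by decide) (by decide)
      (fun _ _ => rfl) rfl (by rw [List.append_nil]; exact h) hq hf (by simpa)
  have hm₂ : ∀ f L, f.length + b ≤ s → Exec B s (measure isBit .future (.kind L))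
      { R with future := f } { R with future := List.replicate b (.kind L) ++ f } := by
    intro f L hf
    refine (exec_measure (R := { R with future := f }) (by decide) (by decide) (hbit b) rfl
      (h.trans (congrArg inps hw)) hq ?_ (by rw [← hw]; exact hs)).congr_right ?_
    · simpa [Store.get] using hf
    · simp [Store.get, Store.set]
  have hm₃ : ∀ f L, f.length + c ≤ s →
      Exec B s (block [skipBits, advance, measure isBit .future (.kind L)])
        { R with future := f } { R with future := List.replicate c (.kind L) ++ f } := by
    intro f L hf
    refine .seq (exec_skipBits (l := List.replicate b true) (by exact rfl)
        (h.trans (congrArg inps hw)) ?_)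
      (.seq (exec_advance (a := .hash) (w := (List.replicate c true).map .bit ++ .hash :: w') rfl
        ?_)
      ((exec_measure_of_seen (l₀ := (List.replicate b true).map .bit ++ [.hash]) (by decide)
        (by decide) (hbit c) (w := .hash :: w') rfl rfl ?_ ?_ ?_).congr_right ?_))
    · simp [hq]; omega
    · simp [hq]; omega
    · simp [hq]
    · simpa [Store.get] using hf
    · simp; omega
    · have : (List.replicate b true).map .bit ++ [.hash] ++
          ((List.replicate c true).map .bit ++ .hash :: w') = w := by rw [hw]; simp
      rw [this, ← h, ← hq]
      simp [Store.get, Store.set]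
  refine .seq (.push (by change R.future.length < s; omega)) (.seq (.push (by
    change R.future.length + 1 < s; omega))
      (.seq (.push (by change R.future.length + 1 + 1 < s; omega))
    (.seq (hm₁ f₃ .ptr (by omega)) (.seq (hm₃ f₄ .wit (by omega)) (.seq (hm₂ f₅ .right (by omega))
    (.seq (hm₂ f₆ .left (by omega)) ((hm₁ f₇ .mid (by omega)).congr_right ?_)))))))
  simp [roundLabels, hf₇, hf₆, hf₅, hf₄, hf₃]

/-- Prepend the labels of as many rounds as the length of the stack `ruler` tells. -/
def pushRounds : Prog := .while (fun t => (t.stk .ruler).isSome) (.seq (.pop .ruler) pushRound)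

lemma labels_succ' (b c n N : ℕ) : labels b c n N ++ roundLabels b c n = labels b c n (N + 1) := by
  induction N with
  | zero => simp [labels]
  | succ N ih => rw [labels, List.append_assoc, ih]; rfl

lemma length_labels (b c n N : ℕ) :
    (labels b c n N).length = N * (roundLabels b c n).length := by
  induction N with
  | zero => simp [labels]
  | succ N ih => rw [labels, List.length_append, ih]; ring

lemma exec_pushRounds {b c : ℕ} {w w' : List InputSym}
    (hw : w = (List.replicate b true).map .bit ++ .hash ::
      ((List.replicate c true).map .bit ++ .hash :: w'))
    {N : ℕ} {R : Store} (h : R.rest = inps w) (hq : R.seen = [])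
      (hr : R.ruler = List.replicate N .mark)
    (hs : w.length ≤ s) (hs' : (labels b c w.length N).length + R.future.length ≤ s) :
    Exec B s pushRounds R
      { R with ruler := [], future := (labels b c w.length N).map .kind ++ R.future } := by
  induction N generalizing R with
  | zero =>
    refine (Exec.while_false (by simp [Store.top, Store.get, hr])).congr_right ?_
    have hr : R.ruler = [] := hr
    rw [← hr]; rfl
  | succ N ih =>
    rw [← labels_succ', List.length_append] at hs'
    refine .while_true (by simp [Store.top, Store.get, hr, List.replicate_succ]) (.seq .pop
      (exec_pushRound (b := b) (c := c) hw (by exact h) (by exact hq) hs (by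
        change _ + R.future.length ≤ s; omega)))
      ((ih (by exact h) (by exact hq) ?_ ?_).congr_right ?_)
    · simp [Store.set, Store.get, hr, List.replicate_succ]
    · simp [Store.set, Store.get]; omega
    · rw [← labels_succ']
      simp [Store.set]

/-! ### The whole program -/

/-- Decide whether the input is the code of a positive instance. -/
def decideProblem : Prog :=
  block [readInput, .push .ruler fun _ => .mark,
    block [scale, scale, scale, scale, scale, scale, scale], pushRounds, .push .mode fun _ => .down,
    search]

lemma exec_decideProblem {x : CFInstance (Fin B.b → Bool)} {N n : ℕ}
    (hn : (encodeInput B.c x).length = n) (hN : n ^ 7 = N + 1) (h : Room B s n x)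
    (hs : (labels B.b B.c n (N + 1)).length ≤ s) :
    ∃ (v : Bool) (R : Store),
      (v = true ↔ ∃ m : Round, m.Legal B.b B.c n ∧
        Win B (encodeInput B.c x) n N (Outcome.initial B x m)) ∧
      Exec B s decideProblem (Compile.initStore (encodeInput B.c x)) R ∧ R.mode = [.up v] := by
  obtain ⟨v, hv, hE⟩ := exists_exec_search h N hs
  refine ⟨v, returning (encodeInput B.c x) ((labels B.b B.c n (N + 1)).map .kind) [] v, hv, ?_, rfl⟩
  set w := encodeInput B.c x with hw
  have hlen : w.length ≤ s := h.input
  have hs2 := h.two_le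
  have hN' : n ^ 7 ≤ s := by
    rw [length_labels] at hs
    have : 1 ≤ (roundLabels B.b B.c n).length := by simp [roundLabels]; omega
    rw [hN]
    nlinarith
  have hpow : ∀ i ≤ 7, n ^ i ≤ s := fun i hi =>
    (Nat.pow_le_pow_right (Nat.pos_of_ne_zero h.ne_zero) hi).trans hN'
  set R₁ : Store := { Compile.initStore w with inp := [], rest := inps w } with hR₁
  have h1 : Exec B s readInput (Compile.initStore w) R₁ := exec_readInput hlen rfl rfl rfl
  have h2 : Exec B s (.push .ruler fun _ => .mark) R₁
      { R₁ with ruler := List.replicate (n ^ 0) .mark } := .push (by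
        change 0 < s; omega)
  have h3 : ∀ i < 7, Exec B s scale { R₁ with ruler := List.replicate (n ^ i) .mark }
      { R₁ with ruler := List.replicate (n ^ (i + 1)) .mark } := by
    intro i hi
    have := hpow (i + 1) hi
    refine (exec_scale (w := w) (i := n ^ i) rfl rfl rfl rfl hlen ?_ (hpow i hi.le)).congr_right ?_
    · rw [hn, ← pow_succ]; exact this
    · rw [hn, ← pow_succ]
  have h4 : Exec B s (block [scale, scale, scale, scale, scale, scale, scale])
      { R₁ with ruler := List.replicate (n ^ 0) .mark }
      { R₁ with ruler := List.replicate (n ^ 7) .mark } :=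
    .seq (h3 0 (by omega)) (.seq (h3 1 (by omega)) (.seq (h3 2 (by omega)) (.seq (h3 3 (by omega))
      (.seq (h3 4 (by omega)) (.seq (h3 5 (by omega)) (h3 6 (by omega)))))))
  have h5 : Exec B s pushRounds { R₁ with ruler := List.replicate (n ^ 7) .mark }
      { R₁ with ruler := [], future := (labels B.b B.c n (N + 1)).map .kind } := by
    refine (exec_pushRounds (encodeInput_eq B.c x) (N := N + 1) rfl rfl (by rw [← hN]) hlen
      ?_).congr_right ?_
    · rw [← hw, hn]; exact hs
    · rw [← hw, hn]
      simp [hR₁, Compile.initStore]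
  exact .seq h1 (.seq h2 (.seq h4 (.seq h5 (.seq (.push (by change 0 < s; omega)) hE))))

end StackProgram

/-! ### The productions in the input -/

namespace StackProgram

open ContextFreeSubset

variable {b c : ℕ} {x : CFInstance (Fin b → Bool)}

lemma exists_startsWith_of_suffix {l : List (CNFRule (Fin b → Bool))} {w : List InputSym}
    (h : .rule :: w <:+ l.flatMap encodeRule) : ∃ r ∈ l, StartsWith (.rule :: w) r := by
  induction l with
  | nil => simp at h
  | cons r l ih =>
    rw [List.flatMap_cons] at h
    have hbody : ∃ body, encodeRule r = .rule :: body ∧ InputSym.rule ∉ body := by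
      cases r <;> exact ⟨_, rfl, by simp [encodeNonterminal, encodeName]⟩
    obtain ⟨body, hr, hbody⟩ := hbody
    obtain ⟨t, ht⟩ := h
    obtain ⟨z, h1, h2⟩ | ⟨z, h1, h2⟩ := List.append_eq_append_iff.1 ht
    · rcases z with _ | ⟨a, z⟩
      · obtain ⟨r', h, h'⟩ := ih ⟨[], by simpa using h2⟩
        exact ⟨r', by simp [h], h'⟩
      · obtain ⟨rfl, h2⟩ := List.cons_eq_cons.1 h2
        rcases t with _ | ⟨a, t⟩
        · refine ⟨r, by simp, _, atRule_flatMap l, ?_⟩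
          rw [h1, h2]; rfl
        · rw [hr, List.cons_append, List.cons_eq_cons] at h1
          exact absurd (by simp [h1.2]) hbody
    · obtain ⟨r', h, h'⟩ := ih ⟨z, h2.symm⟩
      exact ⟨r', by simp [h], h'⟩

lemma exists_startsWith {i : ℕ} {w : List InputSym} (h : (encodeInput c x).drop i = .rule :: w) :
    ∃ r ∈ x.rules, StartsWith (.rule :: w) r := by
  obtain ⟨t, ht⟩ : .rule :: w <:+ encodeInput c x := h ▸ List.drop_suffix ..
  rw [encodeInput] at ht
  obtain ⟨z, h1, h2⟩ | ⟨z, h1, h2⟩ := List.append_eq_append_iff.1 ht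
  · rcases z with _ | ⟨a, z⟩
    · exact exists_startsWith_of_suffix ⟨[], by simpa using h2⟩
    · obtain ⟨rfl, -⟩ := List.cons_eq_cons.1 h2
      have : InputSym.rule ∈ t ++ .rule :: z := by simp
      rw [← h1] at this
      simp [encodeNonterminal, encodeName] at this
  · exact exists_startsWith_of_suffix ⟨z, h2.symm⟩

lemma rulesWellFormed (c : ℕ) (x : CFInstance (Fin b → Bool)) :
    RulesWellFormed b (encodeInput c x) := by
  intro i w h
  obtain ⟨r, -, hr⟩ := exists_startsWith h
  exact ⟨r, h ▸ hr⟩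

lemma mem_rules_of_startsWith {i : ℕ} {r : CNFRule (Fin b → Bool)}
    (h : StartsWith ((encodeInput c x).drop i) r) : r ∈ x.rules := by
  obtain ⟨w, hw⟩ : ∃ w, (encodeInput c x).drop i = .rule :: w := by
    obtain ⟨w', -, e⟩ := h
    cases r <;> exact ⟨_, e⟩
  obtain ⟨r', hr', h'⟩ := exists_startsWith hw
  rw [hw] at h
  rwa [h.unique h']

lemma exists_startsWith_drop {r : CNFRule (Fin b → Bool)} (h : r ∈ x.rules) (c : ℕ) :
    ∃ i ≤ (encodeInput c x).length, StartsWith ((encodeInput c x).drop i) r := by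
  obtain ⟨l₁, l₂, h⟩ := List.append_of_mem h
  obtain ⟨pre, hpre⟩ : ∃ pre, encodeInput c x = pre ++ (encodeRule r ++ l₂.flatMap encodeRule) :=
    ⟨_, by rw [encodeInput, h, List.flatMap_append, List.flatMap_cons, ← List.append_assoc]⟩
  refine ⟨pre.length, by rw [hpre]; simp, _, atRule_flatMap l₂, ?_⟩
  rw [hpre, List.drop_left]

/-! ### Names of group elements -/

variable {G : Type*} [Group G] {B : BlackBox G}

variable (B) in
/-- The bit string `l` is a name of `g`. -/
structure Names (l : List Bool) (g : G) : Prop where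
  length : l.length = B.b
  eq : B.f (toName l) = some g

namespace Names

variable {l m : List Bool} {g h : G}

lemma exists_of_isValid (hl : l.length = B.b) (h : isValid B l = true) : ∃ g, Names B l g := by
  obtain ⟨g, hg⟩ := (B.valid_iff _).1 h
  exact ⟨g, hl, hg⟩

lemma isValid (h : Names B l g) : isValid B l = true := (B.valid_iff _).2 ⟨g, h.eq⟩

lemma ofFn {y : Fin B.b → Bool} (h : B.f y = some g) : Names B (List.ofFn y) g :=
  ⟨by simp, by simpa using h⟩

lemma exists_name (B : BlackBox G) (g : G) : ∃ l, Names B l g := by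
  obtain ⟨y, hy⟩ := B.exists_name g
  exact ⟨_, ofFn hy⟩

lemma inverse (h : Names B l g) : Names B (inverse B l) g⁻¹ := ofFn (B.inv_spec _ _ h.eq)

lemma mul (hl : Names B l g) (hm : Names B m h) : Names B (mul B l m) (g * h) :=
  ofFn (B.prod_spec _ _ _ _ hl.eq hm.eq)

lemma eq_one (hl : Names B l g) {z : List Bool} (h : isOne B l z = true) : g = 1 :=
  (B.isId_spec _ _ hl.eq).2 ⟨_, h⟩

lemma exists_isOne (hl : Names B l g) (h : g = 1) : ∃ z, z.length = B.c ∧ isOne B l z = true := by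
  obtain ⟨z, hz⟩ := (B.isId_spec _ _ hl.eq).1 h
  exact ⟨List.ofFn z, by simp, by simpa [isOne] using hz⟩

lemma quotient {u v : List Bool} {xs : List (Fin B.b → Bool)} {gs : List G} (hu : Names B u g)
    (hv : Names B v h) (hxs : xs.map B.f = gs.map some) :
    Names B (quotient B u xs v) (g⁻¹ * gs.prod * h) := by
  refine Names.mul ?_ hv
  have : ∀ (xs : List (Fin B.b → Bool)) (gs : List G) (a : List Bool) (k : G), Names B a k →
      xs.map B.f = gs.map some →
      Names B (xs.foldl (fun a x => StackProgram.mul B a (List.ofFn x)) a) (k * gs.prod) := by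
    intro xs
    induction xs with
    | nil =>
      intro gs a k ha h
      obtain rfl : gs = [] := by simpa using h.symm
      simpa using ha
    | cons y xs ih =>
      rintro (_ | ⟨k', gs⟩) a k ha h
      · simp at h
      · simp only [List.map_cons, List.cons.injEq] at h
        rw [List.prod_cons, ← mul_assoc]
        exact ih gs _ _ (ha.mul (ofFn h.1)) h.2
  exact this xs gs _ _ hu.inverse hxs

end Names

/-! ### The verification game and proofs -/

section Game

variable {x : CFInstance (Fin B.b → Bool)} {I : CFInstance G}

lemma exists_rule_of_mem (h : B.Represents x I) {r : CNFRule (Fin B.b → Bool)} (hr : r ∈ x.rules) :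
    ∃ r' ∈ I.rules, r.map B.f = r'.map some := by
  have h : x.rules.map (CNFRule.map B.f) = I.rules.map (CNFRule.map some) :=
    congrArg CFInstance.rules h
  have := List.mem_map_of_mem (f := CNFRule.map B.f) hr
  rw [h] at this
  obtain ⟨r', h1, h2⟩ := List.mem_map.1 this
  exact ⟨r', h1, h2.symm⟩

lemma exists_rule_of_mem' (h : B.Represents x I) {r : CNFRule G} (hr : r ∈ I.rules) :
    ∃ r' ∈ x.rules, r'.map B.f = r.map some := by
  have h : x.rules.map (CNFRule.map B.f) = I.rules.map (CNFRule.map some) :=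
    congrArg CFInstance.rules h
  have := List.mem_map_of_mem (f := CNFRule.map some) hr
  rw [← h] at this
  exact List.mem_map.1 this

lemma pair_mem_iff (h : B.Represents x I) {P Q S : List Bool} :
    CNFRule.pair P Q S ∈ x.rules ↔ CNFRule.pair P Q S ∈ I.rules := by
  constructor
  · intro hr
    obtain ⟨_ | _, h1, h2⟩ := exists_rule_of_mem h hr <;> simp [CNFRule.map] at h2
    obtain ⟨rfl, rfl, rfl⟩ := h2
    exact h1
  · intro hr
    obtain ⟨_ | _, h1, h2⟩ := exists_rule_of_mem' h hr <;> simp [CNFRule.map] at h2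
    obtain ⟨rfl, rfl, rfl⟩ := h2
    exact h1

lemma exists_of_single_mem (h : B.Represents x I) {P : List Bool} {y : Fin B.b → Bool}
    (hr : CNFRule.single P y ∈ x.rules) : ∃ g, B.f y = some g ∧ CNFRule.single P g ∈ I.rules := by
  obtain ⟨_ | _, h1, h2⟩ := exists_rule_of_mem h hr <;> simp [CNFRule.map] at h2
  obtain ⟨rfl, h2⟩ := h2
  exact ⟨_, h2, h1⟩

lemma exists_single_mem (h : B.Represents x I) {P : List Bool} {g : G}
    (hr : CNFRule.single P g ∈ I.rules) : ∃ y, B.f y = some g ∧ CNFRule.single P y ∈ x.rules := by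
  obtain ⟨_ | _, h1, h2⟩ := exists_rule_of_mem' h hr <;> simp [CNFRule.map] at h2
  obtain ⟨rfl, h2⟩ := h2
  exact ⟨_, h2, h1⟩

lemma not_win_failure (w : List InputSym) (n N : ℕ) : ¬ Win B w n N .failure := by
  induction N with
  | zero => simp [Win]
  | succ N ih =>
    rintro ⟨m, -, h⟩
    exact ih (h true)

lemma win_success (w : List InputSym) (n N : ℕ) : Win B w n N .success := by
  induction N with
  | zero => rfl
  | succ N ih =>
    exact ⟨⟨List.replicate n true, List.replicate B.b true, List.replicate B.b true,
      List.replicate B.c true, List.replicate n true, (true, true), true⟩,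
      ⟨by simp, by simp, by simp, by simp, by simp⟩, fun _ => ih⟩

/-- A winning strategy yields a proof of the fact to be verified. -/
theorem Win.proof (hI : B.Represents x I) {n N : ℕ} {A u v : List Bool} {X : Option (List Bool)}
    {p : G × G} (hu : Names B u p.1) (hv : Names B v p.2)
    (h : Win B (encodeInput B.c x) n N (.running A X u v)) : Proof I.rules N A X p := by
  induction N generalizing A u v X p with
  | zero => simp [Win] at h
  | succ N ih =>
    obtain ⟨m, hm, h⟩ := h
    have hmem : ∀ r, (ruleAt ((encodeInput B.c x).drop m.pos) : Option (CNFRule (Fin B.b → Bool))) =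
      some r → r ∈ x.rules := fun r hr => mem_rules_of_startsWith (ruleAt_eq_some_iff.1 hr)
    rcases hopt : m.opt with ⟨_ | _, _ | _⟩ <;> simp only [Outcome.next, hopt] at h
    · simp only [Outcome.split] at h
      split_ifs at h with hval
      · obtain ⟨g, hg⟩ := Names.exists_of_isValid hm.left hval.1
        obtain ⟨k, hk⟩ := Names.exists_of_isValid hm.right hval.2
        have h1 := ih (p := (g, k)) hg hk (by simpa using h false)
        have h2 := ih (p := (g⁻¹ * p.1, k⁻¹ * p.2)) (hg.inverse.mul hu) (hk.inverse.mul hv)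
          (by simpa using h true)
        simpa using Proof.trans h1 h2
      · exact absurd (h true) (not_win_failure _ _ _)
    · replace h := h true
      unfold Outcome.leftEdge at h
      split at h
      · rename_i P Q S hr
        have hr := (pair_mem_iff hI).1 (hmem _ hr)
        split_ifs at h with hc
        · obtain ⟨⟨rfl, rfl⟩, hone⟩ := hc
          have hp : p = (p.1, 1) := Prod.ext rfl (hv.eq_one hone)
          rw [hp]
          exact .left hr (hp ▸ ih hu hv h)
        · exact absurd h (not_win_failure _ _ _)
      · exact absurd h (not_win_failure _ _ _)
    · replace h := h true
      unfold Outcome.rightEdge at h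
      split at h
      · rename_i P Q S hr
        have hr := (pair_mem_iff hI).1 (hmem _ hr)
        split_ifs at h with hc
        · obtain ⟨⟨rfl, rfl⟩, hone⟩ := hc
          have hp : p = (1, p.2) := Prod.ext (hu.eq_one hone) rfl
          rw [hp]
          exact .right hr (hp ▸ ih hu hv h)
        · exact absurd h (not_win_failure _ _ _)
      · exact absurd h (not_win_failure _ _ _)
    · replace h := h true
      unfold Outcome.leaf at h
      split at h
      · rename_i P y hr
        obtain ⟨g, hg, hr⟩ := exists_of_single_mem hI (hmem _ hr)
        split_ifs at h with hc
        · obtain ⟨⟨rfl, rfl⟩, hone⟩ := hc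
          have := (hu.quotient (gs := [g]) hv (by simp [hg])).eq_one hone
          rw [List.prod_singleton, mul_assoc, inv_mul_eq_one] at this
          exact .single (u := p.1) (v := p.2) hr this
        · exact absurd h (not_win_failure _ _ _)
      · exact absurd h (not_win_failure _ _ _)

lemma exists_pointer {i n : ℕ} (h : i ≤ n) : ∃ l : List Bool, l.length = n ∧ l.count false = i :=
  ⟨List.replicate i false ++ List.replicate (n - i) true, by simp; omega, by
    simp [List.count_replicate]⟩

lemma exists_encoding {A : List Bool} {n : ℕ} (h : A.length < n) :
    ∃ l : List Bool, l.length = n ∧ decode l = A :=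
  ⟨A ++ true :: List.replicate (n - A.length - 1) false, by simp; omega, decode_append _ _⟩

lemma _root_.ContextFreeSubset.Proof.exists_rule {rules : List (CNFRule G)} {d : ℕ} {A : List Bool}
    {X : Option (List Bool)} {p : G × G} (h : Proof rules d A X p) :
    (∃ g, CNFRule.single A g ∈ rules) ∨ ∃ B C, CNFRule.pair A B C ∈ rules := by
  induction h with
  | single h _ => exact .inl ⟨_, h⟩
  | left h _ _ => exact .inr ⟨_, _, h⟩
  | right h _ _ => exact .inr ⟨_, _, h⟩
  | trans _ _ ih _ => exact ih

lemma length_lt_of_proof (hI : B.Represents x I) {d : ℕ} {A : List Bool}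
    {X : Option (List Bool)} {p : G × G} (h : Proof I.rules d A X p) :
    A.length < (encodeInput B.c x).length := by
  obtain ⟨r, hr, hA⟩ : ∃ r ∈ x.rules, A.length < (encodeRule r).length := by
    obtain ⟨g, h⟩ | ⟨Q, S, h⟩ := h.exists_rule
    · obtain ⟨y, -, hy⟩ := exists_single_mem hI h
      exact ⟨_, hy, by simp [encodeRule, encodeNonterminal]; omega⟩
    · exact ⟨_, (pair_mem_iff hI).2 h, by simp [encodeRule, encodeNonterminal]; omega⟩
  obtain ⟨i, -, hi⟩ := exists_startsWith_drop hr B.c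
  have := hi.length_le
  rw [List.length_drop] at this
  omega

/-- A proof yields a winning strategy. -/
theorem _root_.ContextFreeSubset.Proof.win (hI : B.Represents x I) {N : ℕ} {A u v : List Bool}
    {X : Option (List Bool)} {p : G × G} (hu : Names B u p.1) (hv : Names B v p.2)
    (h : Proof I.rules N A X p) :
    Win B (encodeInput B.c x) (encodeInput B.c x).length N (.running A X u v) := by
  set w := encodeInput B.c x with hw
  have hrule : ∀ r ∈ x.rules, ∃ l : List Bool, l.length = w.length ∧
      (ruleAt (w.drop (l.count false)) : Option (CNFRule (Fin B.b → Bool))) = some r := by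
    intro r hr
    obtain ⟨i, hi, h⟩ := exists_startsWith_drop hr B.c
    obtain ⟨l, hl, hl'⟩ := exists_pointer hi
    exact ⟨l, hl, by rw [hl']; exact ruleAt_eq_some_iff.2 h⟩
  have hpad : ∀ n, (List.replicate n true).length = n := fun n => List.length_replicate
  induction h generalizing u v with
  | @single d A g a b hr h =>
    obtain ⟨y, hy, hr⟩ := exists_single_mem hI hr
    obtain ⟨l, hl, hlr⟩ := hrule _ hr
    have hq := hu.quotient (xs := [y]) (gs := [g]) hv (by simp [hy])
    obtain ⟨z, hz, hz'⟩ := hq.exists_isOne (by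
      simp only [List.prod_singleton]
      rw [mul_assoc, inv_mul_eq_one, h])
    refine ⟨⟨_, _, _, z, l, (true, true), true⟩, ⟨hpad _, hpad _, hpad _, hz, hl⟩, fun side => ?_⟩
    simp only [Outcome.next, Round.pos, hlr, Outcome.leaf, hz', and_self, if_true]
    exact win_success _ _ _
  | left hr _ ih =>
    obtain ⟨l, hl, hlr⟩ := hrule _ ((pair_mem_iff hI).2 hr)
    obtain ⟨z, hz, hz'⟩ := hv.exists_isOne rfl
    refine ⟨⟨_, _, _, z, l, (false, true), true⟩, ⟨hpad _, hpad _, hpad _, hz, hl⟩, fun side => ?_⟩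
    simp only [Outcome.next, Round.pos, hlr, Outcome.leftEdge, hz', and_self, if_true]
    exact ih hu hv
  | right hr _ ih =>
    obtain ⟨l, hl, hlr⟩ := hrule _ ((pair_mem_iff hI).2 hr)
    obtain ⟨z, hz, hz'⟩ := hu.exists_isOne rfl
    refine ⟨⟨_, _, _, z, l, (true, false), true⟩, ⟨hpad _, hpad _, hpad _, hz, hl⟩, fun side => ?_⟩
    simp only [Outcome.next, Round.pos, hlr, Outcome.rightEdge, hz', and_self, if_true]
    exact ih hu hv
  | @trans d A M X p q h₁ h₂ ih₁ ih₂ =>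
    obtain ⟨l, hl, hl'⟩ := exists_encoding (length_lt_of_proof hI h₂)
    obtain ⟨u', hu'⟩ := Names.exists_name B p.1
    obtain ⟨v', hv'⟩ := Names.exists_name B p.2
    refine ⟨⟨l, u', v', _, _, (false, false), true⟩, ⟨hl, hu'.length, hv'.length, hpad _, hpad _⟩,
      fun side => ?_⟩
    simp only [Outcome.next, Outcome.split, hu'.isValid, hv'.isValid, and_self, if_true, hl']
    cases side with
    | false => simpa using ih₁ hu' hv'
    | true =>
      simp only [if_true]
      exact ih₂ (by simpa using hu'.inverse.mul hu) (by simpa using hv'.inverse.mul hv)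

/-! ### Positive instances -/

lemma target_map (hI : B.Represents x I) : x.target.map B.f = I.target.map some :=
  congrArg CFInstance.target hI

lemma card_prod_le (B : BlackBox G) : Nat.card (G × G) ≤ 2 ^ (2 * B.b) := by
  choose f hf using B.exists_name
  have hinj : Function.Injective f := fun g h e => by
    have := hf g
    rw [e, hf h] at this
    simpa using this.symm
  have := Nat.card_le_card_of_injective f hinj
  rw [Nat.card_fun, Nat.card_eq_fintype_card (α := Bool), Fintype.card_bool,
    Nat.card_fin] at this
  rw [Nat.card_prod, two_mul, pow_add]
  exact Nat.mul_le_mul this this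

lemma length_input (x : CFInstance (Fin B.b → Bool)) :
    B.b + B.c + x.rules.length + 4 ≤ (encodeInput B.c x).length := by
  have h : x.rules.length ≤ (x.rules.flatMap encodeRule).length := by
    induction x.rules with
    | nil => simp
    | cons r l ih =>
      rw [List.flatMap_cons, List.length_append, List.length_cons]
      have : 1 ≤ (encodeRule r).length := by cases r <;> simp [encodeRule]
      omega
  simp only [encodeInput, encodeNonterminal, List.length_append, List.length_replicate,
    List.length_cons, List.length_nil]
  omega

lemma height_lt {k b n : ℕ} (h : b + k + 4 ≤ n) :
    (k * (2 * b) + 1) * ((2 * k + 1) * (2 * b + 3)) < n ^ 7 := by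
  have h1 : k * (2 * b) + 1 ≤ 3 * n ^ 2 := by nlinarith
  have h2 : 2 * k + 1 ≤ 3 * n := by omega
  have h3 : 2 * b + 3 ≤ 3 * n := by omega
  have h4 : 4 ^ 3 ≤ n ^ 3 := Nat.pow_le_pow_left (by omega) 3
  have h5 : 0 < n ^ 4 := Nat.pow_pos (by omega)
  calc (k * (2 * b) + 1) * ((2 * k + 1) * (2 * b + 3))
      ≤ (3 * n ^ 2) * ((3 * n) * (3 * n)) := Nat.mul_le_mul h1 (Nat.mul_le_mul h2 h3)
    _ = 27 * n ^ 4 := by ring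
    _ < 4 ^ 3 * n ^ 4 := by omega
    _ ≤ n ^ 3 * n ^ 4 := Nat.mul_le_mul_right _ h4
    _ = n ^ 7 := by ring

/-- The verification game can be won exactly for the positive instances. -/
theorem exists_win_iff [Finite G] (hI : B.Represents x I) {N : ℕ}
    (hN : (encodeInput B.c x).length ^ 7 = N + 1) :
    (∃ m : Round, m.Legal B.b B.c (encodeInput B.c x).length ∧
      Win B (encodeInput B.c x) (encodeInput B.c x).length N (Outcome.initial B x m)) ↔
      I.IsPositive := by
  have hstart : x.start = I.start := congrArg CFInstance.start hI
  have hlen := length_input x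
  rw [isPositive_iff_yields]
  constructor
  · rintro ⟨m, hm, h⟩
    unfold Outcome.initial at h
    split_ifs at h with hc
    · obtain ⟨g, hg⟩ := Names.exists_of_isValid hm.left hc.1.1
      obtain ⟨k, hk⟩ := Names.exists_of_isValid hm.right hc.1.2
      have hq := (hg.quotient hk (target_map hI)).eq_one hc.2
      rw [mul_assoc, inv_mul_eq_one] at hq
      have : Yields I.rules x.start (g * k⁻¹) := (Win.proof hI (p := (g, k)) hg hk h).valid
      rw [hstart] at this
      rwa [eq_mul_inv_of_mul_eq hq.symm]
    · exact absurd h (not_win_failure _ _ _)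
  · intro h
    have hrules : (producers I.rules).card ≤ x.rules.length := by
      have := congrArg List.length (congrArg CFInstance.rules hI)
      simp only [CFInstance.map, List.length_map] at this
      rw [this]
      exact card_producers_le _
    have hp := (h.proof (card_prod_le B) hrules).mono (e := N)
      (by have := height_lt (k := x.rules.length) (b := B.b) (n := (encodeInput B.c x).length)
            (by omega)
          omega)
    obtain ⟨u, hu⟩ := Names.exists_name B I.target.prod
    obtain ⟨v, hv⟩ := Names.exists_name B 1
    obtain ⟨z, hz, hz'⟩ := (hu.quotient hv (target_map hI)).exists_isOne (by simp)
    have hpad : ∀ n, (List.replicate n true).length = n := fun n => List.length_replicate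
    refine ⟨⟨_, u, v, z, _, (true, true), true⟩, ⟨hpad _, hu.length, hv.length, hz, hpad _⟩, ?_⟩
    simp only [Outcome.initial, hu.isValid, hv.isValid, hz', and_self, if_true, hstart]
    exact hp.win hI hu hv

end Game

end StackProgram

theorem theorem4p1 :
    ∃ (M : BlackBoxTM InputSym) (p : Polynomial ℕ),
      ∀ (G : Type*) [Group G] [Finite G] (B : BlackBox G)
        (I : CFInstance G) (x : CFInstance (Fin B.b → Bool)), B.Represents x I →
          (I.IsPositive → M.Accepts B (encodeInput B.c x)) ∧
          (¬ I.IsPositive → M.Rejects B (encodeInput B.c x)) ∧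
          M.RunsInSpace B (encodeInput B.c x) (p.eval (encodeInput B.c x).length) := by
  refine ⟨StackProgram.Compile.machine StackProgram.decideProblem, Polynomial.X ^ 9, ?_⟩
  intro G _ _ B I x hI
  have hlen := StackProgram.length_input x
  rw [Polynomial.eval_pow, Polynomial.eval_X]
  set n := (encodeInput B.c x).length with hn
  have hn8 : 0 < n ^ 8 := Nat.pow_pos (by omega)
  have hn9 : n ≤ n ^ 9 := Nat.le_self_pow (by norm_num) n
  have hn9' : 4 * n ≤ n ^ 9 := by
    have h : n * n ≤ n ^ 9 := by
      rw [← sq]; exact Nat.pow_le_pow_right (by omega) (by norm_num)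
    nlinarith
  -- `n ^ 7` rounds exceed the height that is needed for proofs, by `height_lt`.
  obtain ⟨N, hN⟩ : ∃ N, n ^ 7 = N + 1 := Nat.exists_eq_succ_of_ne_zero (pow_ne_zero 7 (by omega))
  have hroom : StackProgram.Room B (n ^ 9) n x :=
    ⟨by omega, by omega, by omega, hn9, StackProgram.rulesWellFormed _ _, hn9, by omega⟩
  have hspace : (StackProgram.labels B.b B.c n (N + 1)).length ≤ n ^ 9 := by
    rw [StackProgram.length_labels, ← hN]
    have : (StackProgram.roundLabels B.b B.c n).length ≤ n ^ 2 := by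
      simp only [StackProgram.roundLabels, List.length_append, List.length_replicate,
        List.length_cons, List.length_nil]
      nlinarith
    calc n ^ 7 * _ ≤ n ^ 7 * n ^ 2 := Nat.mul_le_mul_left _ this
      _ = n ^ 9 := by ring
  obtain ⟨v, R, hv, hE, hR⟩ := StackProgram.exec_decideProblem hn.symm hN hroom hspace
  rw [hn, StackProgram.exists_win_iff hI (hn ▸ hN)] at hv
  obtain ⟨h1, h2, h3⟩ := StackProgram.Compile.machine_spec (by omega) hn9 hE hR
  exact ⟨fun h => h1 (hv.2 h), fun h => h2 (by simpa using mt hv.1 h), h3⟩
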